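/- **Setting.** For a strict partition $\lambda=(\lambda_1>\dots>\lambda_\ell\ge 0)$ let $SD(\lambda)=\{(i,j)\in\mathbb Z^2: 1\le i\le \ell,\ i\le j\le \lambda_i+i-1\}$ (rows $i$ numbered downwards), and for strict $\mu$ with $SD(\mu)\subseteq SD(\lambda)$ let $SD(\lambda/\mu)=SD(\lambda)\setminus SD(\mu)$. The content of a box $(i,j)$ is $j-i$. A skew shifted shape is a set of boxes that is some $SD(\alpha/\beta)$ up to a slide along the diagonal. For a finite set $S$ of boxes, $QSST(S)$ is the set of fillings $M=(m_x)_{x\in S}$ of $S$ with letters from $1'<1<2'<2<\cdots$ that increase weakly along rows and columns, with each $i'$ at most once per row and each $i$ at most once per column; with $|i|=|i'|=i$ put, for $\boldsymbol s=(s_x)_{x\in S}\in\mathbb C^S$, $$\zeta^Q_S(\boldsymbol s)=\sum_{M\in QSST(S)}\ \prod_{x\in S}|m_x|^{-s_x},\qquad \zeta^Q_\emptyset=1 .$$ A strip is a nonempty edgewise connected skew shifted shape with at most one box on each diagonal; its starting (ending) box is its box of least (greatest) content. An outside decomposition of $SD(\lambda/\mu)$ is a sequence $\theta=(\theta_1,\dots,\theta_r)$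 of strips with disjoint union $SD(\lambda/\mu)$, each having its starting box on the left or bottom perimeter and its ending box on the right or top perimeter of $SD(\lambda/\mu)$. In it, all boxes of a given content are approached from the same direction (from the left or from below) in their strips, where a starting box on only one of the left and the bottom perimeter counts as approached from there; for each positive content where this determines nothing, choose a direction arbitrarily. This defines an infinite strip with one box of each content $0,1,2,\dots$, the box of content $c>0$ being approached from the direction fixed for $c$. For strips $S,T$ let $T$ start at content $a$ and $S$ end at content $b$. If $a\le b$, then $S\#T$ is the piece of the infinite strip with contents $a,\dots,b$; if $a=b+1$, then $S\#T=\emptyset$; if $a>b+1$, or if $S=\emptyset$, then $S\#T$ is undefined and we set $\zeta^Q_{S\#T}=0$. Let $\overline S=S\#\rho$, where $\rho$ is a single box of content $0$, and $\overline\emptyset=\emptyset$. Let $(\overline S,\overline T)$ be the juxtaposition of $\overline S$ and $\overline T$ with their boxes of content $0$ consecutive on the main diagonal, that of $\overline S$ immediately above and to the left of that of $\overline T$. **Theorem.** Let $\theta=(\theta_1,\dots,\theta_k,\theta_{k+1},\dots,\theta_r)$ be an outside decomposition of $SD(\lambda/\mu)$, where $\theta_1,\dots,\theta_k$ contain a box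 of the main diagonal, these boxes being ordered from top left to bottom right, and $\theta_{k+1},\dots,\theta_r$ contain none. Let $\boldsymbol s$ be constant along diagonals, with entry $a_c$ at content $c$ (for contents $c\geq 0$ that do not occur in $SD(\lambda/\mu)$ let $a_c\in\mathbb C$ be arbitrary), and fill every other shape in the same way. If $k$ is odd, replace $\theta$ by $(\emptyset,\theta_1,\dots,\theta_r)$ and $(k,r)$ by $(k+1,r+1)$. Suppose that all series in the entries of the matrix below converge absolutely. Then the series $\zeta^Q_{\lambda/\mu}(\boldsymbol s)$ converges absolutely and $$\zeta^Q_{\lambda/\mu}(\boldsymbol s)=\mathrm{pf}\begin{pmatrix} \bigl(\zeta^Q_{(\overline\theta_p,\overline\theta_q)}\bigr)_{p,q} & \bigl(\zeta^Q_{\theta_i\#\theta_{r+k+1-j}}\bigr)_{i,j}\\ -{}^t\bigl(\zeta^Q_{\theta_i\#\theta_{r+k+1-j}}\bigr)_{i,j} & 0\end{pmatrix},\qquad 1\le p,q,i\le r,\quad k+1\le j\le r .$$ Here, for $p<q$, $\zeta^Q_{(\overline\theta_p,\overline\theta_q)}$ is the $Q$-multiple zeta function of $(\overline\theta_p,\overline\theta_q)$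 if this is a skew shifted shape, and otherwise it is $-1$ times that of $(\overline\theta_q,\overline\theta_p)$, which is then a skew shifted shape; moreover $\zeta^Q_{(\overline\theta_q,\overline\theta_p)}=-\zeta^Q_{(\overline\theta_p,\overline\theta_q)}$ and $\zeta^Q_{(\overline\theta_p,\overline\theta_p)}=0$. The pfaffian of a $2n\times 2n$ matrix $(x_{ij})$ is $\sum_\pi \mathrm{sgn}(\pi)\prod_{i=1}^n x_{\pi(2i-1),\pi(2i)}$ over the permutations $\pi$ with $\pi(1)<\pi(3)<\dots<\pi(2n-1)$ and $\pi(2i-1)<\pi(2i)$ for all $i$. -/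

import Mathlib

/-! ### Strict partitions and shifted diagrams -/

/-- A strict partition `λ₁ > λ₂ > ⋯ > λ_r ≥ 0`. -/
structure StrictPartition where
  parts : List ℕ
  strict : parts.Pairwise (fun x y => x > y)

/-- A box `(i, j)`: row `i` (counted downwards) and column `j`. -/
abbrev Box : Type := ℤ × ℤ

/-- The content `j - i` of the box `(i, j)`. -/
def content (x : Box) : ℤ := x.2 - x.1

/-- `SD(λ) = {(i, j) | 1 ≤ i ≤ r, i ≤ j ≤ λ_i + i - 1}`; the list is indexed from `0`, so that
row `i + 1` belongs to the entry number `i`. -/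
noncomputable def shiftedDiagram (l : StrictPartition) : Finset Box :=
  (Finset.range l.parts.length).biUnion fun i =>
    (Finset.Icc ((i : ℤ) + 1) ((i : ℤ) + (l.parts.getD i 0 : ℕ))).image fun j => ((i : ℤ) + 1, j)

/-- `SD(λ/μ) = SD(λ) \ SD(μ)`. -/
noncomputable def skewShiftedDiagram (l m : StrictPartition) : Finset Box :=
  shiftedDiagram l \ shiftedDiagram m

/-- A finite set of boxes on or above the main diagonal is, up to a slide along the diagonal, of
the form `SD(α/β)` exactly when it contains with two boxes every box (on or above the main
diagonal) that lies weakly between them. The order on boxes is the componentwise one. -/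
def IsSkewShiftedShape (S : Finset Box) : Prop :=
  (∀ x ∈ S, x.1 ≤ x.2) ∧
    ∀ x ∈ S, ∀ y ∈ S, ∀ z : Box, z.1 ≤ z.2 → x ≤ z → z ≤ y → z ∈ S

/-! ### Marked tableaux and Schur `Q`-multiple zeta functions -/

/-- The alphabet `1' < 1 < 2' < 2 < ⋯`: the pair `(i, false)` is `i'` and `(i, true)` is `i`. -/
abbrev MarkedNat : Type := ℕ+ ×ₗ Bool

/-- `|i'| = |i| = i`. -/
def MarkedNat.abs (m : MarkedNat) : ℕ+ := (ofLex m).1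

/-- The letter is one of `1', 2', …`. -/
def MarkedNat.IsPrimed (m : MarkedNat) : Prop := (ofLex m).2 = false

/-- Semi-standard marked fillings of a set of boxes (primes on the main diagonal are allowed). -/
structure IsQTableau (S : Finset Box) (t : S → MarkedNat) : Prop where
  row_le : ∀ x y : S, x.1.1 = y.1.1 → x.1.2 ≤ y.1.2 → t x ≤ t y
  col_le : ∀ x y : S, x.1.2 = y.1.2 → x.1.1 ≤ y.1.1 → t x ≤ t y
  row_primed : ∀ x y : S, x ≠ y → x.1.1 = y.1.1 → t x = t y → ¬ (t x).IsPrimed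
  col_unprimed : ∀ x y : S, x ≠ y → x.1.2 = y.1.2 → t x = t y → (t x).IsPrimed

/-- The set `QSST` of a shape. -/
def QSST (S : Finset Box) : Type := {t : S → MarkedNat // IsQTableau S t}

/-- `1 / M^s = ∏ |m_{ij}|^{-s_{ij}}`. -/
noncomputable def zetaQTerm (S : Finset Box) (s : S → ℂ) (M : QSST S) : ℂ :=
  ∏ x : S, 1 / (((M.1 x).abs : ℕ) : ℂ) ^ s x

/-- The series `ζ^Q_S(s) = ∑_{M ∈ QSST(S)} 1 / M^s` converges absolutely (for series of complex
numbers this is the same as unconditional summability). -/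
def ConvergesQ (S : Finset Box) (s : S → ℂ) : Prop := Summable (zetaQTerm S s)

/-- The Schur `Q`-multiple zeta function `ζ^Q_S(s) = ∑_{M ∈ QSST(S)} 1 / M^s`. -/
noncomputable def zetaQ (S : Finset Box) (s : S → ℂ) : ℂ := ∑' M : QSST S, zetaQTerm S s M

/-- The filling of `S` that is constant along diagonals, with entry `a c` at content `c`. -/
def diagFilling (a : ℤ → ℂ) (S : Finset Box) : S → ℂ := fun x => a (content x.1)

/-! ### Strips and outside decompositions -/

/-- Two boxes share an edge. -/
def EdgeAdjacent (x y : Box) : Prop :=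
  (x.1 = y.1 ∧ |x.2 - y.2| = 1) ∨ (x.2 = y.2 ∧ |x.1 - y.1| = 1)

/-- A strip: a nonempty edgewise connected skew shifted shape with at most one box on each
diagonal. -/
structure IsStrip (S : Finset Box) : Prop where
  nonempty : S.Nonempty
  shape : IsSkewShiftedShape S
  connected : ∀ x ∈ S, ∀ y ∈ S,
    Relation.ReflTransGen (fun u v => v ∈ S ∧ EdgeAdjacent u v) x y
  diagonal : ∀ x ∈ S, ∀ y ∈ S, content x = content y → x = y

/-- `x` is the starting (bottommost and leftmost) box of `S`. -/
def IsStartingBox (S : Finset Box) (x : Box) : Prop :=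
  x ∈ S ∧ ∀ y ∈ S, y.1 ≤ x.1 ∧ x.2 ≤ y.2

/-- `x` is the ending (topmost and rightmost) box of `S`. -/
def IsEndingBox (S : Finset Box) (x : Box) : Prop :=
  x ∈ S ∧ ∀ y ∈ S, x.1 ≤ y.1 ∧ y.2 ≤ x.2

/-- `θ₁, …, θ_r` is an outside decomposition of the diagram `D`: the `θ_p` are strips, `D` is
their disjoint union, and each of them has its starting box on the left or bottom perimeter and its
ending box on the right or top perimeter of `D`. -/
structure IsOutsideDecomposition (D : Finset Box) {r : ℕ} (θ : Fin r → Finset Box) : Prop where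
  strip : ∀ p, IsStrip (θ p)
  disjoint : ∀ p q, p ≠ q → Disjoint (θ p) (θ q)
  union : Finset.univ.biUnion θ = D
  start : ∀ p x, IsStartingBox (θ p) x → (x.1, x.2 - 1) ∉ D ∨ (x.1 + 1, x.2) ∉ D
  ending : ∀ p x, IsEndingBox (θ p) x → (x.1, x.2 + 1) ∉ D ∨ (x.1 - 1, x.2) ∉ D

/-- `fromLeft c = true` says that boxes of content `c` are approached from the left,
`fromLeft c = false` that they are approached from below. This is an admissible rule for the
outside decomposition `θ` of `D` if each box is approached as in its strip; a starting box that
lies on only one of the left and the bottom perimeter of `D` counts as approached from there.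
Contents for which this determines nothing are free. -/
structure IsApproachRule (D : Finset Box) {r : ℕ} (θ : Fin r → Finset Box)
    (fromLeft : ℤ → Bool) : Prop where
  left : ∀ p, ∀ x ∈ θ p, (x.1, x.2 - 1) ∈ θ p → fromLeft (content x) = true
  below : ∀ p, ∀ x ∈ θ p, (x.1 + 1, x.2) ∈ θ p → fromLeft (content x) = false
  start_left : ∀ p x, IsStartingBox (θ p) x → (x.1 + 1, x.2) ∈ D → fromLeft (content x) = true
  start_below : ∀ p x, IsStartingBox (θ p) x → (x.1, x.2 - 1) ∈ D → fromLeft (content x) = false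

/-- The box of content `c ≥ 0` on the infinite strip that starts at `(0, 0)` and in which boxes are
approached according to `fromLeft`: one step to the right for each content `0 < d ≤ c` that is
approached from the left, one step up for each one that is approached from below. -/
noncomputable def ruleBox (fromLeft : ℤ → Bool) (c : ℤ) : Box :=
  (-(((Finset.Ioc 0 c).filter fun d => fromLeft d = false).card : ℤ),
    (((Finset.Ioc 0 c).filter fun d => fromLeft d = true).card : ℤ))

/-- The boxes of contents `a, a + 1, …, b`, placed according to the rule. -/
noncomputable def ruleStrip (fromLeft : ℤ → Bool) (a b : ℤ) : Finset Box :=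
  (Finset.Icc a b).image (ruleBox fromLeft)

/-- `S # T`, up to a slide along the diagonal. Boxes of equal content are approached from the same
direction, so that superimposing the strips `S` and `T` (and bridging a gap) gives a piece of the
strip of the rule; one takes the boxes from the starting box of `T` to the ending box of `S`. If the
ending box of `S` comes just before the starting box of `T` this is `∅`, if it comes earlier than
that, `S # T` is undefined (`none`); it is also undefined if `S` or `T` is `∅`. -/
noncomputable def stripHash (fromLeft : ℤ → Bool) (S T : Finset Box) : Option (Finset Box) :=
  if h : S.Nonempty ∧ T.Nonempty then
    if T.inf' h.2 content ≤ S.sup' h.1 content + 1 then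
      some (ruleStrip fromLeft (T.inf' h.2 content) (S.sup' h.1 content))
    else none
  else none

/-- `ζ^Q` of a possibly undefined shape; it is `0` if the shape is undefined. -/
noncomputable def hashZeta (fromLeft : ℤ → Bool) (a : ℤ → ℂ) (S T : Finset Box) : ℂ :=
  match stripHash fromLeft S T with
  | some R => zetaQ R (diagFilling a R)
  | none => 0

/-- `S̄ = S # ρ` for the strip `ρ` that consists of one box of content `0`, and `∅̄ = ∅`. -/
noncomputable def extendStrip (fromLeft : ℤ → Bool) (S : Finset Box) : Finset Box :=
  (stripHash fromLeft S {(0, 0)}).getD ∅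

/-- `(P, Q)`: the strip `P` with its box of content `0` at `(0, 0)`, and `Q` with its box of content
`0` at `(1, 1)`, immediately below and to the right of that of `P`. -/
def juxtapose (P Q : Finset Box) : Finset Box :=
  P ∪ Q.image fun x => (x.1 + 1, x.2 + 1)

open Classical in
/-- The one of the two juxtapositions `(P, Q)` and `(Q, P)` that is a skew shifted shape. -/
noncomputable def pairShape (P Q : Finset Box) : Finset Box :=
  if IsSkewShiftedShape (juxtapose P Q) then juxtapose P Q else juxtapose Q P

open Classical in
/-- `ζ^Q_{(P, Q)}`, where `ζ^Q_{(P, Q)} = -ζ^Q_{(Q, P)}` if `(P, Q)` is not a skew shifted shape. -/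
noncomputable def pairZeta (a : ℤ → ℂ) (P Q : Finset Box) : ℂ :=
  if IsSkewShiftedShape (juxtapose P Q) then
    zetaQ (pairShape P Q) (diagFilling a (pairShape P Q))
  else -zetaQ (pairShape P Q) (diagFilling a (pairShape P Q))

/-! ### The pfaffian and the block matrix -/

/-- The set `𝔉_{2n}` of permutations `π` with `π(1) < π(3) < ⋯ < π(2n-1)` and
`π(2i-1) < π(2i)` for all `i` (here indexed from `0`). -/
def pfaffianPerms (n : ℕ) : Finset (Equiv.Perm (Fin (2 * n))) :=
  Finset.univ.filter fun π =>
    (∀ i j : Fin n, i < j → π ⟨2 * i, by omega⟩ < π ⟨2 * j, by omega⟩) ∧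
      ∀ i : Fin n, π ⟨2 * i, by omega⟩ < π ⟨2 * i + 1, by omega⟩

/-- `pf(A) = ∑_{π ∈ 𝔉_{2n}} sgn(π) ∏_i a_{π(2i-1), π(2i)}`. -/
def pfaffian {R : Type*} [CommRing R] {n : ℕ} (A : Matrix (Fin (2 * n)) (Fin (2 * n)) R) : R :=
  ∑ π ∈ pfaffianPerms n, ((Equiv.Perm.sign π : ℤ) : R) *
    ∏ i : Fin n, A (π ⟨2 * i, by omega⟩) (π ⟨2 * i + 1, by omega⟩)

/-- `(θ₁, …, θ_r)` if `k` is even and `(∅, θ₁, …, θ_r)` if `k` is odd. -/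
def augment {r : ℕ} (k : ℕ) (θ : Fin r → Finset Box) : Fin (r + k % 2) → Finset Box :=
  fun p => if h : (p : ℕ) < k % 2 then ∅ else θ ⟨p - k % 2, by omega⟩

/-- The strips of the last `r - k` columns, in the order `θ_r, θ_{r-1}, …, θ_{k+1}`. -/
def columnStrip {r : ℕ} (k : ℕ) (θ : Fin r → Finset Box) : Fin (r - k) → Finset Box :=
  fun c => θ ⟨r - 1 - c, by omega⟩

/-- The antisymmetric block with entries `ζ^Q_{(θ̄_p, θ̄_q)}`. -/
noncomputable def pairBlock {r : ℕ} (k : ℕ) (θ : Fin r → Finset Box) (fromLeft : ℤ → Bool)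
    (a : ℤ → ℂ) : Matrix (Fin (r + k % 2)) (Fin (r + k % 2)) ℂ :=
  Matrix.of fun p q =>
    if p < q then
      pairZeta a (extendStrip fromLeft (augment k θ p)) (extendStrip fromLeft (augment k θ q))
    else if q < p then
      -pairZeta a (extendStrip fromLeft (augment k θ q)) (extendStrip fromLeft (augment k θ p))
    else 0

/-- The block with entries `ζ^Q_{θ_i # θ_{r+k+1-j}}`, `k + 1 ≤ j ≤ r`. -/
noncomputable def hashBlock {r : ℕ} (k : ℕ) (θ : Fin r → Finset Box) (fromLeft : ℤ → Bool)
    (a : ℤ → ℂ) : Matrix (Fin (r + k % 2)) (Fin (r - k)) ℂ :=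
  Matrix.of fun i c => hashZeta fromLeft a (augment k θ i) (columnStrip k θ c)

theorem hamelSize {r k : ℕ} (hk : k ≤ r) : (r + k % 2) + (r - k) = 2 * (r - k / 2) := by
  omega

/-- The block matrix, with its rows and columns numbered consecutively. -/
noncomputable def hamelMatrix {r k : ℕ} (hk : k ≤ r) (θ : Fin r → Finset Box)
    (fromLeft : ℤ → Bool) (a : ℤ → ℂ) :
    Matrix (Fin (2 * (r - k / 2))) (Fin (2 * (r - k / 2))) ℂ :=
  Matrix.reindex (finSumFinEquiv.trans (finCongr (hamelSize hk)))
    (finSumFinEquiv.trans (finCongr (hamelSize hk)))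
    (Matrix.fromBlocks (pairBlock k θ fromLeft a) (hashBlock k θ fromLeft a)
      (-(hashBlock k θ fromLeft a).transpose) 0)

/-- All series in the entries of the block matrix converge absolutely. -/
def EntriesConverge {r : ℕ} (k : ℕ) (θ : Fin r → Finset Box) (fromLeft : ℤ → Bool)
    (a : ℤ → ℂ) : Prop :=
  (∀ p q : Fin (r + k % 2), p < q →
    ConvergesQ (pairShape (extendStrip fromLeft (augment k θ p)) (extendStrip fromLeft (augment k θ q)))
      (diagFilling a _)) ∧
  ∀ (i : Fin (r + k % 2)) (c : Fin (r - k)) (R : Finset Box),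
    stripHash fromLeft (augment k θ i) (columnStrip k θ c) = some R → ConvergesQ R (diagFilling a R)

/-! The identity is purely algebraic for a finite alphabet `L` (`truncZeta`), and the series follow
by letting `L` grow.

For a finite alphabet the diagonals are treated as time. All strips are pieces of one infinite
strip, slid along the diagonal by amounts `δ p`, so a shape with an outside decomposition is a
`StripSystem`. A tableau is a sequence of families of letters, one family per content, with a
condition between consecutive families only. Since "may stand to the left of" and "may stand below"
are complementary relations on marked letters, that condition is an equivalence (`Interlace`): a
letter of strip `p` may be followed by a letter of strip `q` exactly when `p` is not after `q` in
the order given by `key`. Hence the zero-one matrix of permitted steps is the full triangular one if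
the families interlace, and its determinant is `1`; otherwise it is a staircase matrix of another
form with determinant `0` (`det_staircase`).

With given letters of content `c`, let `gram` have as entry `(p, q)` the generating function of the
continuations from strip `p`, along the infinite strip, to the end of strip `q`. One step to content
`c + 1` factors its rows through the matrix of permitted steps, and Cauchy–Binet
(`sum_prod_mul_alternating`) turns the determinant into a sum over interlacing families
(`det_gram_step`). By induction `partialSum_eq_det`: the tableaux above a given diagonal are counted
by a determinant. No path involution is needed.

Summing over the strictly increasing letters on the main diagonal gives a sum of determinants in
which `k` rows depend on the letters and `r - k` rows are fixed. The minor summation formula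
(`pfaffian_skewBlock_letterForm`), deduced from de Bruijn's formula by expanding along the last
columns, makes this a pfaffian. Its entries are identified by applying the same determinant formula
to systems of one and of two strips. For odd `k` a new smallest letter and a new coordinate that
only this letter has are added; they play the role of the empty strip.

In the limit, pfaffians are continuous in their entries. Absolute convergence of the left side comes
from the same identity for the real parts of the exponents, whose terms are the absolute values of
the original ones: the partial sums are monotone and have a limit, hence are bounded. -/

section SortedSums

/-! ### Sums over sorted words, Cauchy–Binet and staircase determinants -/

variable {ι Ω K : Type*} [Fintype ι] [Fintype Ω] [CommRing K]

/-- The map `y` preserves the strict orders defined by the keys `f` and `g`. -/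
def KeySorted (f : ι → ℤ) (g : Ω → ℤ) (y : ι → Ω) : Prop :=
  ∀ p q, f p < f q → g (y p) < g (y q)

theorem exists_equiv_strictMono (f : ι → ℤ) (hf : Function.Injective f) :
    ∃ e : Fin (Fintype.card ι) ≃ ι, StrictMono (f ∘ e) := by
  let e₀ : Fin (Fintype.card ι) ≃ ι := (Fintype.equivFin ι).symm
  refine ⟨(Tuple.sort (f ∘ e₀)).trans e₀, ?_⟩
  have h := Tuple.monotone_sort (f ∘ e₀)
  exact h.strictMono_of_injective
    ((hf.comp e₀.injective).comp (Tuple.sort (f ∘ e₀)).injective)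

-- Each injective word is a rearrangement of exactly one increasing word, by exactly one
-- permutation, which sorting recovers; all other words contribute nothing.
open Classical in
theorem sum_eq_sum_strictMono_fin {n : ℕ} (g : Ω → ℤ) (hg : Function.Injective g)
    (φ : (Fin n → Ω) → K) (hφ : ∀ y, ¬ Function.Injective y → φ y = 0) :
    ∑ y, φ y = ∑ y : Fin n → Ω with StrictMono (g ∘ y), ∑ σ : Equiv.Perm (Fin n), φ (y ∘ σ) := by
  rw [Finset.sum_sigma']
  have key : ∀ (y : Fin n → Ω) (σ : Equiv.Perm (Fin n)), StrictMono (g ∘ y) →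
      Tuple.sort (g ∘ (y ∘ σ)) = σ⁻¹ := by
    intro y σ hy
    have h1 : (g ∘ (y ∘ σ)) ∘ Tuple.sort (g ∘ (y ∘ σ)) = (g ∘ (y ∘ σ)) ∘ (σ⁻¹ : Equiv.Perm _) := by
      refine Tuple.unique_monotone (Tuple.monotone_sort _) ?_
      have : (g ∘ (y ∘ σ)) ∘ (σ⁻¹ : Equiv.Perm _) = g ∘ y := by
        ext i; simp
      rw [this]; exact hy.monotone
    have hinj : Function.Injective (g ∘ (y ∘ σ)) := by
      have : g ∘ (y ∘ σ) = (g ∘ y) ∘ σ := rfl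
      rw [this]; exact hy.injective.comp σ.injective
    ext i
    exact congrArg _ (hinj (congrFun h1 i))
  rw [← Finset.sum_filter_add_sum_filter_not Finset.univ (fun y : Fin n → Ω => Function.Injective y)]
  rw [Finset.sum_eq_zero (s := Finset.univ.filter fun y : Fin n → Ω => ¬ Function.Injective y), add_zero]
  swap
  · intro y hy
    exact hφ y (by simpa using hy)
  symm
  refine Finset.sum_bij' (fun x _ => x.1 ∘ x.2)
    (fun y _ => ⟨y ∘ Tuple.sort (g ∘ y), (Tuple.sort (g ∘ y))⁻¹⟩) ?_ ?_ ?_ ?_ ?_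
  · rintro ⟨y, σ⟩ h
    simp only [Finset.mem_sigma, Finset.mem_filter, Finset.mem_univ, true_and, and_true] at h ⊢
    exact (Function.Injective.of_comp h.injective).comp σ.injective
  · intro y h
    simp only [Finset.mem_sigma, Finset.mem_filter, Finset.mem_univ, true_and, and_true] at h ⊢
    exact (Tuple.monotone_sort (g ∘ y)).strictMono_of_injective
      ((hg.comp h).comp (Tuple.sort (g ∘ y)).injective)
  · rintro ⟨y, σ⟩ h
    simp only [Finset.mem_sigma, Finset.mem_filter, Finset.mem_univ, true_and, and_true] at h
    have := key y σ h
    simp only [this, inv_inv]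
    congr 1
    ext i; simp
  · intro y h
    ext i; simp
  · intros; rfl

variable [DecidableEq ι]

open Classical in
theorem sum_eq_sum_keySorted (f : ι → ℤ) (hf : Function.Injective f) (g : Ω → ℤ)
    (hg : Function.Injective g) (φ : (ι → Ω) → K) (hφ : ∀ y, ¬ Function.Injective y → φ y = 0) :
    ∑ y, φ y = ∑ y : ι → Ω with KeySorted f g y, ∑ σ : Equiv.Perm ι, φ (y ∘ σ) := by
  obtain ⟨e, he⟩ := exists_equiv_strictMono f hf
  let E : (Fin (Fintype.card ι) → Ω) ≃ (ι → Ω) := e.arrowCongr (Equiv.refl Ω)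
  have hE : ∀ y, E y = y ∘ e.symm := fun y => rfl
  rw [← E.sum_comp, sum_eq_sum_strictMono_fin g hg]
  · refine Finset.sum_equiv E ?_ ?_
    · intro y
      rw [Finset.mem_filter_univ, Finset.mem_filter_univ, hE]
      constructor
      · intro h p q hpq
        apply h
        have : f (e (e.symm p)) < f (e (e.symm q)) := by simpa using hpq
        exact he.lt_iff_lt.1 this
      · intro h i j hij
        have := h (e i) (e j) (he hij)
        simpa using this
    · intro y _
      refine Fintype.sum_equiv e.permCongr _ _ ?_
      intro σ
      congr 1
      ext p
      simp [hE, Equiv.permCongr_apply]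
  · intro y hy
    apply hφ
    intro h
    apply hy
    rw [hE] at h
    intro i j hij
    have := @h (e i) (e j) (by simpa using hij)
    simpa using this

open Classical in
/-- The Cauchy–Binet expansion of an alternating function along the rows of a matrix. -/
theorem sum_prod_mul_alternating (f : ι → ℤ) (hf : Function.Injective f) (g : Ω → ℤ)
    (hg : Function.Injective g) (N : ι → Ω → K) (D : (ι → Ω) → K)
    (h0 : ∀ y, ¬ Function.Injective y → D y = 0)
    (hperm : ∀ y (σ : Equiv.Perm ι), D (y ∘ σ) = ((Equiv.Perm.sign σ : ℤ) : K) * D y) :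
    ∑ y : ι → Ω, (∏ p, N p (y p)) * D y =
      ∑ y : ι → Ω with KeySorted f g y, (Matrix.of fun p q => N p (y q)).det * D y := by
  rw [sum_eq_sum_keySorted f hf g hg _ (fun y hy => by rw [h0 y hy, mul_zero])]
  refine Finset.sum_congr rfl fun y _ => ?_
  -- The sum over the rearrangements of one sorted word is the Leibniz expansion of its minor.
  rw [← Matrix.det_transpose, Matrix.det_apply', Finset.sum_mul]
  refine Finset.sum_congr rfl fun σ _ => ?_
  rw [hperm]
  simp only [Matrix.transpose_apply, Matrix.of_apply, Function.comp]
  ring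

open Classical in
/-- The determinant of a matrix of zeros and ones whose rows are nested up-sets is `1` if the matrix
is the full upper triangular one, and `0` otherwise. -/
theorem det_staircase (f : ι → ℤ) (hf : Function.Injective f) (P : ι → ι → Prop)
    (hcol : ∀ p q q', P p q → f q ≤ f q' → P p q') (hrow : ∀ p p' q, P p q → f p' ≤ f p → P p' q) :
    (Matrix.of fun p q => if P p q then (1 : K) else 0).det =
      if ∀ p q, P p q ↔ f p ≤ f q then 1 else 0 := by
  let _ : LinearOrder ι := LinearOrder.lift' f hf
  have hle : ∀ p q : ι, p ≤ q ↔ f p ≤ f q := fun p q => Iff.rfl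
  split_ifs with h
  · rw [Matrix.det_of_isUpperTriangular]
    · refine Finset.prod_eq_one fun p _ => ?_
      simp [h]
    · intro p q hpq
      have : ¬ f p ≤ f q := by rw [← hle]; exact not_le.2 hpq
      simp [h, this]
  -- A nonzero determinant has no zero row and no two equal rows, so the supports `U p` are nonempty
  -- and strictly nested. Counting the possible cardinalities then leaves only the triangular case.
  · by_contra hdet
    apply h
    let U : ι → Finset ι := fun p => Finset.univ.filter fun q => P p q
    have hU : ∀ p q, q ∈ U p ↔ P p q := fun p q => by simp [U]
    have hne : ∀ p, (U p).Nonempty := by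
      intro p
      by_contra hp
      apply hdet
      apply Matrix.det_eq_zero_of_row_eq_zero p
      intro q
      have : ¬ P p q := fun hpq => hp ⟨q, (hU p q).2 hpq⟩
      simp [this]
    have hneq : ∀ p q, p ≠ q → U p ≠ U q := by
      intro p q hpq hUpq
      apply hdet
      apply Matrix.det_zero_of_row_eq hpq
      ext j
      have : P p j ↔ P q j := by rw [← hU, ← hU, hUpq]
      simp [this]
    have hss : ∀ p q, p < q → U q ⊂ U p := by
      intro p q hpq
      refine lt_of_le_of_ne ?_ (hneq _ _ hpq.ne')
      intro j hj
      rw [hU] at hj ⊢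
      exact hrow _ _ _ hj ((hle _ _).1 hpq.le)
    have hcard : StrictAnti fun p => (U p).card := fun p q hpq => Finset.card_lt_card (hss p q hpq)
    -- The supports of the rows `q ≥ p` have distinct cardinalities between `1` and that of `U p`;
    -- those of the rows `q < p` have distinct larger ones. The two bounds add up to the number of
    -- rows.
    have hge : ∀ p, (Finset.univ.filter fun q => p ≤ q).card ≤ (U p).card := by
      intro p
      have : (Finset.univ.filter fun q => p ≤ q).card ≤ (Finset.Icc 1 (U p).card).card := by
        refine Finset.card_le_card_of_injOn (fun q => (U q).card) ?_ hcard.injective.injOn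
        intro q hq
        simp only [Finset.coe_filter, Finset.mem_univ, true_and, Set.mem_ofPred_eq] at hq
        simp only [Finset.coe_Icc, Set.mem_Icc]
        exact ⟨(hne q).card_pos, hcard.antitone hq⟩
      simpa using this
    have hle2 : ∀ p, (U p).card + (Finset.univ.filter fun q => q < p).card ≤ Fintype.card ι := by
      intro p
      have : (Finset.univ.filter fun q => q < p).card ≤
          (Finset.Ioc (U p).card (Fintype.card ι)).card := by
        refine Finset.card_le_card_of_injOn (fun q => (U q).card) ?_ hcard.injective.injOn
        intro q hq
        simp only [Finset.coe_filter, Finset.mem_univ, true_and, Set.mem_ofPred_eq] at hq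
        simp only [Finset.coe_Ioc, Set.mem_Ioc]
        exact ⟨hcard hq, Finset.card_le_univ _⟩
      rw [Nat.card_Ioc] at this
      have := Finset.card_le_univ (U p)
      omega
    have hcompl : ∀ p : ι, (Finset.univ.filter fun q => p ≤ q).card +
        (Finset.univ.filter fun q => q < p).card = Fintype.card ι := by
      intro p
      have := Finset.card_filter_add_card_filter_not (s := (Finset.univ : Finset ι)) (fun q => p ≤ q)
      simpa [not_le] using this
    have heq : ∀ p, (U p).card = (Finset.univ.filter fun q => p ≤ q).card := by
      intro p
      have := hge p
      have := hle2 p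
      have := hcompl p
      omega
    intro p q
    rw [← hU, ← hle]
    -- An element of the up-set `U p` below `p` would bring all `q ≥ p` with it, one more than the
    -- cardinality permits.
    have hsub : U p ⊆ Finset.univ.filter fun q => p ≤ q := by
      intro j hj
      by_contra hjp
      have hjp' : j < p := by simpa using hjp
      have : insert j (Finset.univ.filter fun q => p ≤ q) ⊆ U p := by
        intro i hi
        rw [Finset.mem_insert] at hi
        rcases hi with rfl | hi
        · exact hj
        · rw [hU] at hj ⊢
          refine hcol _ _ _ hj ((hle _ _).1 (hjp'.le.trans ?_))
          simpa using hi
      have h2 := Finset.card_le_card this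
      rw [Finset.card_insert_of_notMem hjp, heq p] at h2
      omega
    rw [Finset.eq_of_subset_of_card_le hsub (heq p).ge]
    simp

end SortedSums

/-! ### Neighbour relations between marked letters -/

section Relations

variable {Λ : Type*} [LinearOrder Λ] (pr : Λ → Prop)

/-- The relation between a letter and its right neighbour in a marked tableau. -/
def RowRel (a b : Λ) : Prop := a < b ∨ (a = b ∧ ¬ pr a)

/-- The relation between a letter and its lower neighbour in a marked tableau. -/
def ColRel (a b : Λ) : Prop := a < b ∨ (a = b ∧ pr a)

/-- The relation between a letter and the next one on a strip, where the next box is approached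
from the left or from below. -/
def StepRel (l : Bool) (a b : Λ) : Prop := if l = true then RowRel pr a b else ColRel pr b a

/-- Between equal letters exactly one of the two relations holds, as decided by the prime. This
complementarity is what lets the tableau conditions be stated as an equivalence in `Interlace`. -/
theorem not_rowRel {a b : Λ} : ¬ RowRel pr a b ↔ ColRel pr b a := by
  unfold RowRel ColRel
  rcases lt_trichotomy a b with h | rfl | h
  · simp [h, h.not_gt, h.ne']
  · simp
  · simp [h, h.not_gt, h.ne']

theorem not_colRel {a b : Λ} : ¬ ColRel pr a b ↔ RowRel pr b a := by
  rw [← not_rowRel, not_not]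

variable {pr}

theorem RowRel.trans_lt {a b c : Λ} (h : RowRel pr a b) (h' : b < c) : a < c := by
  rcases h with h | ⟨rfl, _⟩
  · exact h.trans h'
  · exact h'

theorem ColRel.trans_lt {a b c : Λ} (h : ColRel pr a b) (h' : b < c) : a < c := by
  rcases h with h | ⟨rfl, _⟩
  · exact h.trans h'
  · exact h'

theorem RowRel.lt_trans {a b c : Λ} (h' : a < b) (h : RowRel pr b c) : a < c := by
  rcases h with h | ⟨rfl, _⟩
  · exact h'.trans h
  · exact h'

theorem ColRel.lt_trans {a b c : Λ} (h' : a < b) (h : ColRel pr b c) : a < c := by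
  rcases h with h | ⟨rfl, _⟩
  · exact h'.trans h
  · exact h'

/-- The hypotheses give `a ≤ b ≤ c`, and equality throughout would make the letter both unprimed and
primed. Strict increase along diagonals comes from here. -/
theorem RowRel.lt_of_not {a b c : Λ} (h : RowRel pr a b) (h' : ¬ RowRel pr c b) : a < c := by
  rw [not_rowRel] at h'
  unfold RowRel at h
  unfold ColRel at h'
  grind

theorem RowRel.lt_of_not' {a b c : Λ} (h : RowRel pr a b) (h' : ¬ RowRel pr a c) : c < b := by
  rw [not_rowRel] at h'
  unfold RowRel at h
  unfold ColRel at h'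
  grind

end Relations

/-! ### Strip systems and letters on consecutive diagonals -/

/-- A system of `r` strips: strip `p` has one box of each content from `α p` to `β p`, and is
obtained from the infinite strip by a slide of `δ p` steps along the diagonal. -/
structure StripSystem (fl : ℕ → Bool) (r : ℕ) where
  α : Fin r → ℕ
  β : Fin r → ℕ
  δ : Fin r → ℤ
  le : ∀ p, α p ≤ β p

namespace StripSystem

variable {fl : ℕ → Bool} {r : ℕ} (T : StripSystem fl r)

/-- The strip `p` has a box of content `c`. -/
def Act (c : ℕ) (p : Fin r) : Prop := T.α p ≤ c ∧ c ≤ T.β p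

/-- The strip `p` has a box of content `c` or `c + 1`. -/
def Near (c : ℕ) (p : Fin r) : Prop := T.Act c p ∨ T.Act (c + 1) p

/-- The position of strip `p` among the boxes of contents `c` and `c + 1`. -/
def key (c : ℕ) (p : Fin r) : ℤ := if fl (c + 1) = true then T.δ p else -T.δ p

/-- Strips of equal slide neither meet nor touch, and strips start and end on the perimeter. -/
structure IsOutside : Prop where
  ne : ∀ c p q, p ≠ q → T.Near c p → T.Near c q → T.δ p ≠ T.δ q
  start : ∀ c p q, T.α p = c + 1 → T.Near c q → T.key c p ≤ T.key c q
  ending : ∀ c p q, T.β p = c → T.Near c q → T.key c q ≤ T.key c p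

variable {T} in
theorem IsOutside.key_ne (hT : T.IsOutside) {c : ℕ} {p q : Fin r} (h : p ≠ q) (hp : T.Near c p)
    (hq : T.Near c q) : T.key c p ≠ T.key c q := by
  have := hT.ne c p q h hp hq
  unfold key
  split_ifs
  · exact this
  · exact fun h' => this (neg_injective h')

theorem near_of_ending {c : ℕ} {p : Fin r} (h : T.β p = c) : T.Near c p :=
  Or.inl ⟨h ▸ T.le p, h.ge⟩

-- Two strips that end at the same content would both have the greatest key there, but keys of
-- different strips differ.
variable {T} in
theorem IsOutside.ending_unique (hT : T.IsOutside) {p q : Fin r} (h : T.β p = T.β q) : p = q := by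
  by_contra hpq
  have hp := T.near_of_ending h
  have hq := T.near_of_ending (p := q) rfl
  exact hT.key_ne hpq hp hq (le_antisymm (hT.ending _ q p rfl hp) (hT.ending _ p q h hq))

variable {Λ K : Type*} [LinearOrder Λ] [Fintype Λ] [CommRing K] (pr : Λ → Prop)
  (w : ℕ → Λ → K)

/-- A family of letters, one for each strip with a box of content `c`. -/
def Valid (c : ℕ) (u : Fin r → Option Λ) : Prop := ∀ p, (u p).isSome ↔ T.Act c p

/-- The letters increase along the diagonal. -/
def Increasing (u : Fin r → Option Λ) : Prop :=
  ∀ p q a b, u p = some a → u q = some b → T.δ p < T.δ q → a < b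

/-- The tableau conditions between the letters `t` of content `c` and the letters `u` of content
`c + 1`. -/
def Interlace (c : ℕ) (t u : Fin r → Option Λ) : Prop :=
  ∀ p q a b, t p = some a → u q = some b →
    (StepRel pr (fl (c + 1)) a b ↔ T.key c p ≤ T.key c q)

/-- The product of the weights of the letters of content `c`. -/
def weight (c : ℕ) (u : Fin r → Option Λ) : K := ∏ p, (u p).elim 1 (w c)

open Classical in
/-- The generating function of the letters of contents `c + 1, …, c + n` above given letters of
content `c`. -/
noncomputable def partialSum : ℕ → ℕ → (Fin r → Option Λ) → K
  | 0, _, _ => 1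
  | n + 1, c, t => ∑ u : Fin r → Option Λ,
      if T.Valid (c + 1) u ∧ T.Interlace pr c t u then
        weight w (c + 1) u * partialSum n (c + 1) u else 0

open Classical in
/-- The generating function of the strips of contents `c, …, c + d` starting with the letter `m`,
without the weight of that letter. -/
noncomputable def stripSum {Λ K : Type*} [LinearOrder Λ] [Fintype Λ] [CommRing K] (fl : ℕ → Bool)
    (pr : Λ → Prop) (w : ℕ → Λ → K) : ℕ → ℕ → Λ → K
  | 0, _, _ => 1
  | d + 1, c, m => ∑ b : Λ,
      (if StepRel pr (fl (c + 1)) m b then 1 else 0) * w (c + 1) b * stripSum fl pr w d (c + 1) b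

/-- The continuation of a strip from the letter `m` of content `c` to content `b`. -/
noncomputable def tailSum (fl : ℕ → Bool) (c : ℕ) (m : Λ) (b : ℕ) : K :=
  if c ≤ b then stripSum fl pr w (b - c) c m else 0

/-- The generating function of the strips of contents `a, …, b`. -/
noncomputable def fullSum (fl : ℕ → Bool) (a b : ℕ) : K :=
  -- The value `1` is that of the empty piece and the value `0` stands for an undefined one, as in
  -- the definition of `#`.
  if a ≤ b then ∑ m, w a m * stripSum fl pr w (b - a) a m else if a = b + 1 then 1 else 0

/-- The row of strip `p` in the matrix of content `c`. -/
noncomputable def rowVec (c : ℕ) (p : Fin r) : Option Λ → Fin r → K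
  | some m => fun q => tailSum pr w fl c m (T.β q)
  -- For valid letters, a strip without a letter of content `c` has either ended, whence a unit row,
  -- or not yet begun, whence the generating functions of the pieces from its own start to the ends
  -- of the strips `q`.
  | none => if T.β p < c then Pi.single p 1 else fun q => fullSum pr w fl (T.α p) (T.β q)

/-- The matrix of content `c`. -/
noncomputable def gram (c : ℕ) (u : Fin r → Option Λ) : Matrix (Fin r) (Fin r) K :=
  Matrix.of fun p => T.rowVec pr w c p (u p)

-- Of two strips, the one of smaller key cannot end at `c`. Its letter of content `c + 1` separates
-- the two letters of content `c`: only one of them may precede it.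
variable {T pr} in
omit [Fintype Λ] in
theorem Interlace.increasing_left (hT : T.IsOutside) {c : ℕ} {t u : Fin r → Option Λ}
    (ht : T.Valid c t) (hu : T.Valid (c + 1) u) (h : T.Interlace pr c t u) : T.Increasing t := by
  intro p q a b hp hq hpq
  have hpa : T.Act c p := (ht p).1 (by simp [hp])
  have hqa : T.Act c q := (ht q).1 (by simp [hq])
  by_cases hf : fl (c + 1) = true
  · have hkey : ∀ p, T.key c p = T.δ p := fun p => by simp [key, hf]
    have hp1 : T.β p ≠ c := fun he => by
      have := hT.ending c p q he (Or.inl hqa)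
      rw [hkey, hkey] at this; omega
    obtain ⟨e, he⟩ := Option.isSome_iff_exists.1 ((hu p).2 ⟨hpa.1.trans (by omega),
      lt_of_le_of_ne hpa.2 hp1.symm⟩)
    have h1 := h p p a e hp he
    have h2 := h q p b e hq he
    simp only [StepRel, hf, if_true, hkey, le_refl, iff_true] at h1 h2
    exact h1.lt_of_not (fun h3 => by have := h2.1 h3; omega)
  · have hkey : ∀ p, T.key c p = -T.δ p := fun p => by simp [key, hf]
    have hp1 : T.β q ≠ c := fun he => by
      have := hT.ending c q p he (Or.inl hpa)
      rw [hkey, hkey] at this; omega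
    obtain ⟨e, he⟩ := Option.isSome_iff_exists.1 ((hu q).2 ⟨hqa.1.trans (by omega),
      lt_of_le_of_ne hqa.2 hp1.symm⟩)
    have h1 := h p q a e hp he
    have h2 := h q q b e hq he
    simp only [StepRel, hf, hkey, le_refl, iff_true, neg_le_neg_iff] at h1 h2
    have h3 : ¬ ColRel pr e a := fun h3 => by have := h1.1 h3; omega
    rw [not_colRel] at h3
    refine h3.lt_of_not ?_
    rwa [not_rowRel]

-- Dually, the strip of larger key cannot start at `c + 1`, and its letter of content `c` separates
-- the two letters of content `c + 1`.
variable {T pr} in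
omit [Fintype Λ] in
theorem Interlace.increasing_right (hT : T.IsOutside) {c : ℕ} {t u : Fin r → Option Λ}
    (ht : T.Valid c t) (hu : T.Valid (c + 1) u) (h : T.Interlace pr c t u) : T.Increasing u := by
  intro p q a b hp hq hpq
  have hpa : T.Act (c + 1) p := (hu p).1 (by simp [hp])
  have hqa : T.Act (c + 1) q := (hu q).1 (by simp [hq])
  by_cases hf : fl (c + 1) = true
  · have hkey : ∀ p, T.key c p = T.δ p := fun p => by simp [key, hf]
    have hp1 : T.α q ≠ c + 1 := fun he => by
      have := hT.start c q p he (Or.inr hpa)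
      rw [hkey, hkey] at this; omega
    obtain ⟨e, he⟩ := Option.isSome_iff_exists.1 ((ht q).2 ⟨by have := hqa.1; omega,
      by have := hqa.2; omega⟩)
    have h1 := h q p e a he hp
    have h2 := h q q e b he hq
    simp only [StepRel, hf, if_true, hkey, le_refl, iff_true] at h1 h2
    exact h2.lt_of_not' (fun h3 => by have := h1.1 h3; omega)
  · have hkey : ∀ p, T.key c p = -T.δ p := fun p => by simp [key, hf]
    have hp1 : T.α p ≠ c + 1 := fun he => by
      have := hT.start c p q he (Or.inr hqa)
      rw [hkey, hkey] at this; omega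
    obtain ⟨e, he⟩ := Option.isSome_iff_exists.1 ((ht p).2 ⟨by have := hpa.1; omega,
      by have := hpa.2; omega⟩)
    have h1 := h p p e a he hp
    have h2 := h p q e b he hq
    simp only [StepRel, hf, hkey, le_refl, iff_true, neg_le_neg_iff] at h1 h2
    have h3 : ¬ ColRel pr b e := fun h3 => by have := h2.1 h3; omega
    rw [not_colRel] at h3
    refine h3.lt_of_not' ?_
    rwa [not_rowRel]

end StripSystem

/-! ### Expansion of the determinant of content `c` over the next letters -/

namespace StripSystem

variable {fl : ℕ → Bool} {r : ℕ} (T : StripSystem fl r)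
variable {Λ K : Type*} [LinearOrder Λ] [Fintype Λ] [CommRing K] (pr : Λ → Prop)
  (w : ℕ → Λ → K)

theorem tailSum_of_lt {c b : ℕ} (m : Λ) (h : b < c) : tailSum pr w fl c m b = 0 :=
  if_neg h.not_ge

theorem tailSum_of_le {c b : ℕ} (m : Λ) (h : c ≤ b) :
    tailSum pr w fl c m b = stripSum fl pr w (b - c) c m :=
  if_pos h

open Classical in
theorem tailSum_succ {c : ℕ} (m : Λ) {b : ℕ} (h : c < b) :
    tailSum pr w fl c m b = ∑ x : Λ, (if StepRel pr (fl (c + 1)) m x then 1 else 0) *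
      (w (c + 1) x * tailSum pr w fl (c + 1) x b) := by
  obtain ⟨d, rfl⟩ := Nat.exists_eq_add_of_lt h
  have e1 : c + d + 1 - c = d + 1 := by omega
  have e2 : c + d + 1 - (c + 1) = d := by omega
  rw [tailSum_of_le _ _ _ h.le, e1, stripSum]
  refine Finset.sum_congr rfl fun x _ => ?_
  rw [tailSum_of_le _ _ _ (show c + 1 ≤ c + d + 1 by omega), e2, mul_assoc]

/-- The two kinds of continuation of a strip with a box of content `c` or `c + 1`: ending, or
another letter. -/
noncomputable def vertexRow (c : ℕ) : Option Λ → Fin r → K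
  | none => fun q => if T.β q = c then 1 else 0
  | some b => fun q => w (c + 1) b * tailSum pr w fl (c + 1) b (T.β q)

/-- A letter, or the start of a strip, may be followed by the given letter or the end. -/
def Follows (l : Bool) (a b : Option Λ) : Prop :=
  ∀ x y, a = some x → b = some y → StepRel pr l x y

-- A continuation to the end of `q` takes one permitted step if that end lies beyond `c`, and stops
-- if it lies at `c`. A strip that begins at `c + 1` may take any letter; the column with `T.β q =
-- c` then needs the value `1` of `fullSum` on the empty piece.
open Classical in
theorem rowVec_eq_sum {c : ℕ} {t : Fin r → Option Λ} (ht : T.Valid c t) {p : Fin r}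
    (hp : T.Near c p) :
    T.rowVec pr w c p (t p) = ∑ b : Option Λ,
      (if Follows pr (fl (c + 1)) (t p) b then (1 : K) else 0) • T.vertexRow pr w c b := by
  funext q
  rw [Fintype.sum_option, Pi.add_apply, Finset.sum_apply]
  simp only [vertexRow, Pi.smul_apply, smul_eq_mul]
  have h0 : Follows pr (fl (c + 1)) (t p) none := by intro x y _ h; simp at h
  rw [if_pos h0, one_mul]
  by_cases hact : T.Act c p
  · obtain ⟨m, hm⟩ := Option.isSome_iff_exists.1 ((ht p).2 hact)
    have h1 : ∀ b, Follows pr (fl (c + 1)) (t p) (some b) ↔ StepRel pr (fl (c + 1)) m b := by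
      intro b
      simp [Follows, hm]
    rw [hm, rowVec]
    rw [hm] at h1
    simp only [h1]
    rcases lt_trichotomy (T.β q) c with hq | hq | hq
    · simp [tailSum_of_lt, hq, hq.ne, hq.trans (Nat.lt_succ_self c)]
    · simp [tailSum_of_lt, tailSum_of_le, hq, stripSum]
    · rw [if_neg hq.ne', zero_add, tailSum_succ pr w m hq]
  · have hact' : T.Act (c + 1) p := hp.resolve_left hact
    have hα : T.α p = c + 1 := by
      unfold Act at hact hact'; omega
    have hm : t p = none := by
      rw [← Option.not_isSome_iff_eq_none]
      exact fun h => hact ((ht p).1 h)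
    have h1 : ∀ b, Follows pr (fl (c + 1)) (t p) (some b) := by
      intro b
      simp [Follows, hm]
    rw [hm, rowVec, if_neg (by have := T.le p; omega)]
    rw [hm] at h1
    simp only [h1, if_true, one_mul]
    rw [hα, fullSum]
    rcases lt_trichotomy (T.β q) c with hq | hq | hq
    · simp [tailSum_of_lt, hq.ne, hq.ne', hq.not_gt, hq.trans (Nat.lt_succ_self c)]
    · simp [tailSum_of_lt, hq]
    · rw [if_pos (show c + 1 ≤ T.β q from hq), if_neg hq.ne', zero_add]
      refine Finset.sum_congr rfl fun x _ => ?_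
      rw [tailSum_of_le _ _ _ (show c + 1 ≤ T.β q from hq)]

theorem rowVec_eq_of_not_near {c : ℕ} {t : Fin r → Option Λ} (ht : T.Valid c t) {p : Fin r}
    (hp : ¬ T.Near c p) : T.rowVec pr w c p (t p) = T.rowVec pr w (c + 1) p none := by
  have hm : t p = none := by
    rw [← Option.not_isSome_iff_eq_none]
    exact fun h => hp (Or.inl ((ht p).1 h))
  rw [hm, rowVec, rowVec]
  have := T.le p
  have h : T.β p < c ↔ T.β p < c + 1 := by
    unfold Near Act at hp; omega
  simp only [h]

open Classical in
/-- The matrix of content `c + 1` in which the rows of the strips near `c` are free. -/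
noncomputable def freeDet (c : ℕ) (y : {p // T.Near c p} → Option Λ) : K :=
  (Matrix.of fun p => if h : T.Near c p then T.vertexRow pr w c (y ⟨p, h⟩)
    else T.rowVec pr w (c + 1) p none).det

theorem freeDet_of_not_injective (c : ℕ) (y : {p // T.Near c p} → Option Λ)
    (hy : ¬ Function.Injective y) : T.freeDet pr w c y = 0 := by
  unfold Function.Injective at hy
  push Not at hy
  obtain ⟨⟨p, hp⟩, ⟨q, hq⟩, h, hne⟩ := hy
  refine Matrix.det_zero_of_row_eq (i := p) (j := q) (fun h => hne (Subtype.ext h)) ?_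
  funext j
  rw [Matrix.of_apply, Matrix.of_apply, dif_pos hp, dif_pos hq, h]

open Classical in
theorem freeDet_perm (c : ℕ) (y : {p // T.Near c p} → Option Λ)
    (σ : Equiv.Perm {p // T.Near c p}) :
    T.freeDet pr w c (y ∘ σ) = ((Equiv.Perm.sign σ : ℤ) : K) * T.freeDet pr w c y := by
  rw [← Equiv.Perm.sign_ofSubtype, freeDet, freeDet, ← Matrix.det_permute]
  congr 1
  ext p q
  simp only [Matrix.of_apply, Matrix.submatrix_apply, id]
  by_cases hp : T.Near c p
  · rw [dif_pos hp, Equiv.Perm.ofSubtype_apply_of_mem σ hp, dif_pos (σ ⟨p, hp⟩).2]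
    rfl
  · rw [dif_neg hp, Equiv.Perm.ofSubtype_apply_of_not_mem σ hp, dif_neg hp]

-- Multilinearity is used in the rows near `c` only; the other rows are the same at contents `c` and
-- `c + 1` and stay frozen by `domDomRestrict`.
open Classical in
theorem det_gram_eq_sum {c : ℕ} {t : Fin r → Option Λ} (ht : T.Valid c t) :
    (T.gram pr w c t).det = ∑ y : {p // T.Near c p} → Option Λ,
      (∏ p, if Follows pr (fl (c + 1)) (t p.1) (y p) then (1 : K) else 0) * T.freeDet pr w c y := by
  let F := (Matrix.detRowAlternating (n := Fin r) (R := K)).toMultilinearMap.domDomRestrict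
    (T.Near c) (fun p => T.rowVec pr w (c + 1) p.1 none)
  have h1 : (T.gram pr w c t).det = F fun p => ∑ b : Option Λ,
      (if Follows pr (fl (c + 1)) (t p) b then (1 : K) else 0) • T.vertexRow pr w c b := by
    rw [MultilinearMap.domDomRestrict_apply]
    change Matrix.detRowAlternating _ = Matrix.detRowAlternating _
    congr 1
    funext p
    by_cases hp : T.Near c p
    · rw [dif_pos hp]
      exact T.rowVec_eq_sum pr w ht hp
    · rw [dif_neg hp]
      exact T.rowVec_eq_of_not_near pr w ht hp
  rw [h1, MultilinearMap.map_sum]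
  refine Finset.sum_congr rfl fun y _ => ?_
  rw [MultilinearMap.map_smul_univ, smul_eq_mul]
  rfl

end StripSystem

/-! ### Integer keys for letters, with the empty letter as the greatest -/

section LetterKey

variable {Λ : Type*} [LinearOrder Λ] [Fintype Λ]

/-- The number of smaller letters. -/
def letterRank (m : Λ) : ℤ := ((Finset.univ.filter fun x => x < m).card : ℤ)

theorem letterRank_strictMono : StrictMono (letterRank (Λ := Λ)) := by
  intro a b hab
  unfold letterRank
  rw [Nat.cast_lt]
  apply Finset.card_lt_card
  refine ⟨fun x hx => ?_, fun h => ?_⟩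
  · simp only [Finset.mem_filter, Finset.mem_univ, true_and] at hx ⊢
    exact hx.trans hab
  · have := h (show a ∈ _ by simpa using hab)
    simp at this

/-- The order of the letters or its reverse, with the empty letter put last. -/
def optionKey (l : Bool) : Option Λ → ℤ
  | none => Fintype.card Λ + 1
  | some m => if l = true then letterRank m else -letterRank m

theorem optionKey_some_lt_none (l : Bool) (m : Λ) : optionKey l (some m) < optionKey l (none : Option Λ) := by
  have h1 : letterRank m ≤ Fintype.card Λ := by
    unfold letterRank
    exact_mod_cast Finset.card_le_univ _
  have h2 : 0 ≤ letterRank m := by unfold letterRank; positivity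
  simp only [optionKey]
  split_ifs <;> omega

theorem optionKey_some_lt_some (l : Bool) (a b : Λ) :
    optionKey l (some a) < optionKey l (some b) ↔ if l = true then a < b else b < a := by
  simp only [optionKey]
  split_ifs
  · exact letterRank_strictMono.lt_iff_lt
  · rw [neg_lt_neg_iff]; exact letterRank_strictMono.lt_iff_lt

theorem optionKey_injective (l : Bool) : Function.Injective (optionKey (Λ := Λ) l) := by
  have h := letterRank_strictMono (Λ := Λ)
  rintro (_ | a) (_ | b) hab
  · rfl
  · exact absurd hab (optionKey_some_lt_none l b).ne'
  · exact absurd hab (optionKey_some_lt_none l a).ne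
  · simp only [optionKey] at hab
    split_ifs at hab
    · rw [h.injective hab]
    · rw [h.injective (neg_injective hab)]

end LetterKey

/-! ### The transfer step and the determinant formula -/

namespace StripSystem

variable {fl : ℕ → Bool} {r : ℕ} {T : StripSystem fl r}
variable {Λ K : Type*} [LinearOrder Λ] [Fintype Λ] [CommRing K] (pr : Λ → Prop)
  (w : ℕ → Λ → K)

open Classical in
/-- A nonvanishing sorted determinant has the empty letter exactly at the strips that end. -/
theorem eq_none_iff_of_freeDet_ne_zero (hT : T.IsOutside) {c : ℕ}
    {y : {p // T.Near c p} → Option Λ}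
    (hy : KeySorted (fun p => T.key c p.1) (optionKey (fl (c + 1))) y)
    (hdet : T.freeDet pr w c y ≠ 0) (p : {p // T.Near c p}) : y p = none ↔ T.β p.1 = c := by
  -- The row of an empty letter is zero unless some strip `q` ends at `c`. If `q` is not `p`, it has
  -- a greater key, so sortedness would require a letter beyond the empty one.
  have hnone : ∀ p, y p = none → T.β p.1 = c := by
    intro p hp
    by_contra hpc
    have hex : ∃ q, T.β q = c := by
      by_contra hno
      push Not at hno
      apply hdet
      apply Matrix.det_eq_zero_of_row_eq_zero p.1
      intro q
      rw [Matrix.of_apply, dif_pos p.2]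
      simp [hp, vertexRow, hno]
    obtain ⟨q, hq⟩ := hex
    have hpq : p.1 ≠ q := fun h => hpc (h ▸ hq)
    have hlt := lt_of_le_of_ne (hT.ending c q p.1 hq p.2)
      (hT.key_ne hpq p.2 (T.near_of_ending hq))
    have h2 := hy p ⟨q, T.near_of_ending hq⟩ hlt
    rw [hp] at h2
    rcases h3 : y ⟨q, T.near_of_ending hq⟩ with _ | b
    · rw [h3] at h2; exact lt_irrefl _ h2
    · rw [h3] at h2
      exact lt_asymm h2 (optionKey_some_lt_none _ b)
  refine ⟨hnone p, fun hp => ?_⟩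
  by_contra hne
  apply hdet
  -- In the column of a strip ending at `c`, a row near `c` is nonzero only for the empty letter,
  -- which occurs only at a strip ending at `c`, hence only at `p`. The frozen rows vanish there
  -- too: they are unit rows of other strips, or start at content at least `c + 2`.
  apply Matrix.det_eq_zero_of_column_eq_zero p.1
  intro q
  rw [Matrix.of_apply]
  split_ifs with hq
  · rcases h3 : y ⟨q, hq⟩ with _ | b
    · have : q = p.1 := hT.ending_unique ((hnone _ h3).trans hp.symm)
      subst this
      exact absurd h3 hne
    · simp [vertexRow, tailSum_of_lt, hp]
  · have hqp : p.1 ≠ q := fun h => hq (h ▸ p.2)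
    rw [rowVec]
    split_ifs with h4
    · exact Pi.single_eq_of_ne hqp 1
    · have := T.le q
      unfold Near Act at hq
      simp only [fullSum]
      rw [if_neg (by omega), if_neg (by omega)]

-- The weights are taken out row by row. For a strip ending at `c` the indicator of `T.β q = c` is
-- its unit row, because ending contents are distinct.
open Classical in
theorem freeDet_restrict (hT : T.IsOutside) {c : ℕ} {u : Fin r → Option Λ}
    (hu : T.Valid (c + 1) u) :
    T.freeDet pr w c (fun p => u p.1) = weight w (c + 1) u * (T.gram pr w (c + 1) u).det := by
  rw [weight, ← Matrix.det_mul_column, freeDet]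
  congr 1
  ext p q
  rw [Matrix.of_apply, Matrix.of_apply, gram, Matrix.of_apply]
  split_ifs with hp
  · rcases h : u p with _ | b
    · have hn : ¬ T.Act (c + 1) p := fun h' => by simpa [h] using (hu p).2 h'
      have hpc : T.β p = c := by
        unfold Near Act at *; omega
      simp only [vertexRow, Option.elim_none, one_mul, rowVec]
      rw [if_pos (show T.β p < c + 1 by omega), Pi.single_apply]
      have : T.β q = c ↔ q = p := ⟨fun h => hT.ending_unique (h.trans hpc.symm), fun h => h ▸ hpc⟩
      simp only [this]
    · simp [vertexRow, rowVec]
  · have : u p = none := by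
      rw [← Option.not_isSome_iff_eq_none]
      exact fun h => hp (Or.inr ((hu p).1 h))
    rw [this]
    simp

/-- For a step from below both keys reverse their orders. The strip that ends has the greatest key,
in accordance with the empty letter being last. -/
theorem keySorted_restrict_iff (hT : T.IsOutside) {c : ℕ} {u : Fin r → Option Λ}
    (hu : T.Valid (c + 1) u) :
    KeySorted (fun p : {p // T.Near c p} => T.key c p.1) (optionKey (fl (c + 1)))
      (fun p => u p.1) ↔ T.Increasing u := by
  constructor
  · intro h p q a b hp hq hpq
    have hpa : T.Near c p := Or.inr ((hu p).1 (by simp [hp]))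
    have hqa : T.Near c q := Or.inr ((hu q).1 (by simp [hq]))
    by_cases hf : fl (c + 1) = true
    · have h1 := h ⟨p, hpa⟩ ⟨q, hqa⟩ (by simpa [key, hf] using hpq)
      simp only [hp, hq] at h1
      simpa [optionKey_some_lt_some, hf] using h1
    · have h1 := h ⟨q, hqa⟩ ⟨p, hpa⟩ (by simpa [key, hf] using hpq)
      simp only [hp, hq] at h1
      simpa [optionKey_some_lt_some, hf] using h1
  · rintro h ⟨p, hp⟩ ⟨q, hq⟩ hpq
    have hend : ∀ {p}, T.Near c p → u p = none → T.β p = c := by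
      intro p hp h0
      have hn : ¬ T.Act (c + 1) p := fun h' => by simpa [h0] using (hu p).2 h'
      unfold Near Act at *; omega
    change optionKey _ (u p) < optionKey _ (u q)
    change T.key c p < T.key c q at hpq
    rcases h1 : u p with _ | a
    · exact absurd (hT.ending c p q (hend hp h1) hq) hpq.not_ge
    · rcases h2 : u q with _ | b
      · exact optionKey_some_lt_none _ _
      · rw [optionKey_some_lt_some]
        split_ifs with hf
        · simp only [key, hf, if_true] at hpq
          exact h p q a b h1 h2 hpq
        · simp only [key, hf] at hpq
          exact h q p b a h2 h1 (by simpa using hpq)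

-- Since letters increase along both diagonals, the permitted steps form nested up-sets in the order
-- of the keys, and `det_staircase` applies. Strips that start or end at this step satisfy the
-- triangular condition by extremality of their keys, so that it reduces to `Interlace`.
omit [Fintype Λ] in
open Classical in
theorem det_follows (hT : T.IsOutside) {c : ℕ} {t u : Fin r → Option Λ} (ht : T.Valid c t)
    (hti : T.Increasing t) (hu : T.Valid (c + 1) u) (hui : T.Increasing u) :
    (Matrix.of fun p q : {p // T.Near c p} =>
      if Follows pr (fl (c + 1)) (t p.1) (u q.1) then (1 : K) else 0).det =
      if T.Interlace pr c t u then 1 else 0 := by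
  have hstart : ∀ {p}, T.Near c p → t p = none → T.α p = c + 1 := by
    intro p hp h0
    have hn : ¬ T.Act c p := fun h' => by simpa [h0] using (ht p).2 h'
    unfold Near Act at *; omega
  have hend : ∀ {p}, T.Near c p → u p = none → T.β p = c := by
    intro p hp h0
    have hn : ¬ T.Act (c + 1) p := fun h' => by simpa [h0] using (hu p).2 h'
    unfold Near Act at *; omega
  have hinj : Function.Injective fun p : {p // T.Near c p} => T.key c p.1 := by
    intro p q h
    by_contra hpq
    exact hT.key_ne (fun h' => hpq (Subtype.ext h')) p.2 q.2 h
  rw [det_staircase (fun p : {p // T.Near c p} => T.key c p.1) hinj]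
  · congr 1
    apply propext
    constructor
    · intro h p q a b hp hq
      have hpa : T.Near c p := Or.inl ((ht p).1 (by simp [hp]))
      have hqa : T.Near c q := Or.inr ((hu q).1 (by simp [hq]))
      rw [← h ⟨p, hpa⟩ ⟨q, hqa⟩]
      simp [Follows, hp, hq]
    · rintro h ⟨p, hp⟩ ⟨q, hq⟩
      change Follows pr _ (t p) (u q) ↔ T.key c p ≤ T.key c q
      rcases h1 : t p with _ | a
      · exact iff_of_true (by simp [Follows]) (hT.start c p q (hstart hp h1) hq)
      · rcases h2 : u q with _ | b
        · exact iff_of_true (by simp [Follows]) (hT.ending c q p (hend hq h2) hp)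
        · rw [← h p q a b h1 h2]
          simp [Follows]
  · rintro ⟨p, hp⟩ ⟨q, hq⟩ ⟨q', hq'⟩ h hle x z hx hz
    change T.key c q ≤ T.key c q' at hle
    change Follows pr _ (t p) (u q) at h
    change t p = some x at hx
    change u q' = some z at hz
    rcases eq_or_ne q q' with rfl | hne
    · exact h x z hx hz
    have hlt := lt_of_le_of_ne hle (hT.key_ne hne hq hq')
    rcases h2 : u q with _ | b
    · exact absurd (hT.ending c q q' (hend hq h2) hq') hlt.not_ge
    · have h3 := h x b hx h2
      unfold StepRel at h3 ⊢
      unfold key at hlt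
      split_ifs at h3 hlt ⊢ with hf
      · exact Or.inl (h3.trans_lt (hui q q' b z h2 hz hlt))
      · exact Or.inl (h3.lt_trans (hui q' q z b hz h2 (by omega)))
  · rintro ⟨p, hp⟩ ⟨p', hp'⟩ ⟨q, hq⟩ h hle x z hx hz
    change T.key c p' ≤ T.key c p at hle
    change Follows pr _ (t p) (u q) at h
    change t p' = some x at hx
    change u q = some z at hz
    rcases eq_or_ne p' p with rfl | hne
    · exact h x z hx hz
    have hlt := lt_of_le_of_ne hle (hT.key_ne hne hp' hp)
    rcases h2 : t p with _ | b
    · exact absurd (hT.start c p p' (hstart hp h2) hp') hlt.not_ge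
    · have h3 := h b z h2 hz
      unfold StepRel at h3 ⊢
      unfold key at hlt
      split_ifs at h3 hlt ⊢ with hf
      · exact Or.inl (h3.lt_trans (hti p' p x b hx h2 hlt))
      · exact Or.inl (h3.trans_lt (hti p p' b x h2 hx (by omega)))

-- This is Cauchy–Binet for the factorisation of the rows through the permitted steps. The sorted
-- words that survive are the valid families of content `c + 1`, and the minor of such a family is
-- `1` or `0` according to `Interlace`.
open Classical in
theorem det_gram_step (hT : T.IsOutside) {c : ℕ} {t : Fin r → Option Λ} (ht : T.Valid c t)
    (hti : T.Increasing t) :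
    (T.gram pr w c t).det = ∑ u : Fin r → Option Λ,
      if T.Valid (c + 1) u ∧ T.Interlace pr c t u then
        weight w (c + 1) u * (T.gram pr w (c + 1) u).det else 0 := by
  have hinj : Function.Injective fun p : {p // T.Near c p} => T.key c p.1 := by
    intro p q h
    by_contra hpq
    exact hT.key_ne (fun h' => hpq (Subtype.ext h')) p.2 q.2 h
  rw [T.det_gram_eq_sum pr w ht]
  have h1 := sum_prod_mul_alternating (fun p : {p // T.Near c p} => T.key c p.1) hinj
    (optionKey (fl (c + 1))) (optionKey_injective (Λ := Λ) _)
    (fun p b => if Follows pr (fl (c + 1)) (t p.1) b then (1 : K) else 0) (T.freeDet pr w c)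
    (T.freeDet_of_not_injective pr w c) (T.freeDet_perm pr w c)
  refine h1.trans ?_
  rw [← Finset.sum_filter]
  symm
  refine Finset.sum_bij_ne_zero (fun u _ _ p => u p.1) ?_ ?_ ?_ ?_
  · intro u hu _
    rw [Finset.mem_filter_univ] at hu ⊢
    exact (keySorted_restrict_iff hT hu.1).2 (hu.2.increasing_right hT ht hu.1)
  · intro u hu _ v hv _ huv
    rw [Finset.mem_filter_univ] at hu hv
    funext p
    by_cases hp : T.Near c p
    · exact congrFun huv ⟨p, hp⟩
    · have h1 : ∀ {u : Fin r → Option Λ}, T.Valid (c + 1) u → u p = none := by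
        intro u hu
        rw [← Option.not_isSome_iff_eq_none]
        exact fun h => hp (Or.inr ((hu p).1 h))
      rw [h1 hu.1, h1 hv.1]
  · intro y hy hne
    rw [Finset.mem_filter_univ] at hy
    have hne2 := right_ne_zero_of_mul hne
    have hiff := eq_none_iff_of_freeDet_ne_zero pr w hT hy hne2
    let u : Fin r → Option Λ := fun p => if h : T.Near c p then y ⟨p, h⟩ else none
    have huy : (fun p : {p // T.Near c p} => u p.1) = y := by
      funext p
      simp [u, p.2]
    have hu : T.Valid (c + 1) u := by
      intro p
      by_cases hp : T.Near c p
      · have h2 := hiff ⟨p, hp⟩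
        simp only [u, dif_pos hp]
        rw [Option.isSome_iff_ne_none, Ne, h2]
        change ¬ T.β p = c ↔ _
        unfold Near Act at *
        omega
      · simp only [u, dif_neg hp]
        simpa using fun h => hp (Or.inr h)
    have hui : T.Increasing u := by
      rw [← keySorted_restrict_iff hT hu, huy]; exact hy
    rw [← huy] at hne
    have hdet := det_follows (K := K) pr hT ht hti hu hui
    have hint : T.Interlace pr c t u := by
      by_contra hno
      rw [if_neg hno] at hdet
      exact left_ne_zero_of_mul hne hdet
    refine ⟨u, by rw [Finset.mem_filter_univ]; exact ⟨hu, hint⟩, ?_, huy⟩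
    rw [← freeDet_restrict pr w hT hu]
    exact right_ne_zero_of_mul hne
  · intro u hu _
    rw [Finset.mem_filter_univ] at hu
    have hdet := det_follows (K := K) pr hT ht hti hu.1 (hu.2.increasing_right hT ht hu.1)
    rw [if_pos hu.2] at hdet
    change _ = (Matrix.of fun p q : {p // T.Near c p} =>
      if Follows pr (fl (c + 1)) (t p.1) (u q.1) then (1 : K) else 0).det * _
    rw [hdet, one_mul, freeDet_restrict pr w hT hu.1]

open Classical in
/-- The generating function above given letters on one diagonal is a determinant. -/
theorem partialSum_eq_det (hT : T.IsOutside) (n : ℕ) : ∀ (c : ℕ) (t : Fin r → Option Λ),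
    T.Valid c t → T.Increasing t → (∀ p, T.β p < c + n) →
      T.partialSum pr w n c t = (T.gram pr w c t).det := by
  induction n with
  | zero =>
    intro c t ht _ hn
    -- Beyond all ends every row is the unit row of a finished strip.
    have : T.gram pr w c t = 1 := by
      ext p q
      have hp : t p = none := by
        rw [← Option.not_isSome_iff_eq_none]
        intro h
        have := ((ht p).1 h).2
        have := hn p
        omega
      rw [gram, Matrix.of_apply, hp, rowVec, if_pos (show T.β p < c from hn p), Matrix.one_apply, Pi.single_apply]
      simp only [eq_comm]
    rw [this, Matrix.det_one, partialSum]
  | succ n ih =>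
    intro c t ht hti hn
    rw [partialSum, det_gram_step pr w hT ht hti]
    refine Finset.sum_congr rfl fun u _ => ?_
    split_ifs with hu
    · rw [ih (c + 1) u hu.1 (hu.2.increasing_right hT ht hu.1) (fun p => by have := hn p; omega)]
    · rfl

end StripSystem

/-! ### Pfaffians: sums over all permutations and expansion along a row -/

section Pfaffian

/-- The positions `2 i` and `2 i + 1`. -/
def pairEquiv (n : ℕ) : Fin n × Bool ≃ Fin (2 * n) where
  toFun x := ⟨2 * x.1 + x.2.toNat, by have := x.1.2; have := x.2.toNat_lt; omega⟩
  invFun l := (⟨l / 2, by omega⟩, decide ((l : ℕ) % 2 = 1))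
  left_inv := by
    rintro ⟨i, b⟩
    cases b
    · ext <;> simp
    · ext
      · simp; omega
      · simp
  right_inv := by
    intro l
    ext
    rcases Nat.mod_two_eq_zero_or_one l with h | h <;> simp [h] <;> omega

variable {K : Type*} [CommRing K]

/-- The summand of the pfaffian. -/
def pfTerm {n : ℕ} (A : Matrix (Fin (2 * n)) (Fin (2 * n)) K) (π : Equiv.Perm (Fin (2 * n))) : K :=
  ((Equiv.Perm.sign π : ℤ) : K) *
    ∏ i : Fin n, A (π (pairEquiv n (i, false))) (π (pairEquiv n (i, true)))

theorem pfaffian_eq_sum {n : ℕ} (A : Matrix (Fin (2 * n)) (Fin (2 * n)) K) :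
    pfaffian A = ∑ π ∈ pfaffianPerms n, pfTerm A π := rfl

theorem mem_pfaffianPerms {n : ℕ} {π : Equiv.Perm (Fin (2 * n))} : π ∈ pfaffianPerms n ↔
    (StrictMono fun i => π (pairEquiv n (i, false))) ∧
      ∀ i, π (pairEquiv n (i, false)) < π (pairEquiv n (i, true)) := by
  simp only [pfaffianPerms, Finset.mem_filter, Finset.mem_univ, true_and]
  rfl

/-- The permutation of positions that permutes the pairs and the entries of each pair. -/
def pairPerm {n : ℕ} (ε : Fin n → Equiv.Perm Bool) (τ : Equiv.Perm (Fin n)) :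
    Equiv.Perm (Fin (2 * n)) :=
  (pairEquiv n).permCongr
    ((Equiv.prodCongrLeft fun _ => τ : Equiv.Perm (Fin n × Bool)) * Equiv.prodCongrRight ε)

theorem pairPerm_apply {n : ℕ} (ε : Fin n → Equiv.Perm Bool) (τ : Equiv.Perm (Fin n)) (i : Fin n)
    (b : Bool) : pairPerm ε τ (pairEquiv n (i, b)) = pairEquiv n (τ i, ε i b) := by
  simp [pairPerm, Equiv.permCongr_apply]

theorem sign_pairPerm {n : ℕ} (ε : Fin n → Equiv.Perm Bool) (τ : Equiv.Perm (Fin n)) :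
    Equiv.Perm.sign (pairPerm ε τ) = ∏ i, Equiv.Perm.sign (ε i) := by
  rw [pairPerm, Equiv.Perm.sign_permCongr, Equiv.Perm.sign_mul, Equiv.Perm.sign_prodCongrLeft,
    Equiv.Perm.sign_prodCongrRight]
  simp

theorem bool_perm_cases (e : Equiv.Perm Bool) : e = 1 ∨ e = Equiv.swap false true := by
  revert e; decide

/-- Permuting whole pairs is even, and each swap inside a pair costs a sign that antisymmetry of `A`
restores. -/
theorem pfTerm_mul_pairPerm {n : ℕ} (A : Matrix (Fin (2 * n)) (Fin (2 * n)) K)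
    (hA : ∀ i j, A i j = -A j i) (π : Equiv.Perm (Fin (2 * n))) (ε : Fin n → Equiv.Perm Bool)
    (τ : Equiv.Perm (Fin n)) : pfTerm A (π * pairPerm ε τ) = pfTerm A π := by
  unfold pfTerm
  have h1 : ∀ i : Fin n, A ((π * pairPerm ε τ) (pairEquiv n (i, false)))
      ((π * pairPerm ε τ) (pairEquiv n (i, true))) = ((Equiv.Perm.sign (ε i) : ℤ) : K) *
        A (π (pairEquiv n (τ i, false))) (π (pairEquiv n (τ i, true))) := by
    intro i
    rw [Equiv.Perm.mul_apply, Equiv.Perm.mul_apply, pairPerm_apply, pairPerm_apply]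
    rcases bool_perm_cases (ε i) with h | h
    · simp [h]
    · rw [h, Equiv.swap_apply_left, Equiv.swap_apply_right, Equiv.Perm.sign_swap (by decide), hA]
      simp
  rw [Finset.prod_congr rfl fun i _ => h1 i, Finset.prod_mul_distrib, Equiv.Perm.sign_mul,
    sign_pairPerm, Equiv.prod_comp τ fun i => A (π (pairEquiv n (i, false))) (π (pairEquiv n (i, true)))]
  have h2 : (((∏ i, Equiv.Perm.sign (ε i) : ℤˣ) : ℤ) : K) * ∏ i, ((Equiv.Perm.sign (ε i) : ℤ) : K) = 1 := by
    push_cast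
    rw [← Finset.prod_mul_distrib]
    refine Finset.prod_eq_one fun i _ => ?_
    rw [← Int.cast_mul, ← Units.val_mul, Int.units_mul_self]; simp
  rw [Units.val_mul, Int.cast_mul]
  linear_combination ((Equiv.Perm.sign π : ℤ) : K) *
    (∏ i, A (π (pairEquiv n (i, false))) (π (pairEquiv n (i, true)))) * h2

/-- Together with `exists_pairPerm_decomposition`, this makes `pfaffianPerms n` a set of coset
representatives modulo the permutations `pairPerm`, of which there are `2 ^ n * n!`. -/
theorem pairPerm_decomposition_injective {n : ℕ} {π π' : Equiv.Perm (Fin (2 * n))}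
    (hπ : π ∈ pfaffianPerms n) (hπ' : π' ∈ pfaffianPerms n) {ε ε' : Fin n → Equiv.Perm Bool}
    {τ τ' : Equiv.Perm (Fin n)} (h : π * pairPerm ε τ = π' * pairPerm ε' τ') :
    π = π' ∧ ε = ε' ∧ τ = τ' := by
  rw [mem_pfaffianPerms] at hπ hπ'
  have h1 : ∀ i b, π (pairEquiv n (τ i, ε i b)) = π' (pairEquiv n (τ' i, ε' i b)) := by
    intro i b
    have := congrArg (fun f : Equiv.Perm _ => f (pairEquiv n (i, b))) h
    simpa [pairPerm_apply] using this
  have h2 : ∀ i, ε i = ε' i ∧ ∀ b, π (pairEquiv n (τ i, b)) = π' (pairEquiv n (τ' i, b)) := by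
    intro i
    have hf := h1 i false
    have ht := h1 i true
    have l1 := hπ.2 (τ i)
    have l2 := hπ'.2 (τ' i)
    rcases bool_perm_cases (ε i) with e | e <;> rcases bool_perm_cases (ε' i) with e' | e' <;>
      simp only [e, e', Equiv.Perm.one_apply, Equiv.swap_apply_left, Equiv.swap_apply_right] at hf ht
    · refine ⟨by rw [e, e'], ?_⟩
      rintro (_ | _) <;> assumption
    · rw [hf, ht] at l1; exact absurd l1 l2.asymm
    · rw [hf, ht] at l1; exact absurd l1 l2.asymm
    · refine ⟨by rw [e, e'], ?_⟩
      rintro (_ | _) <;> assumption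
  have hτ : τ = τ' := by
    have h3 : (fun i => π (pairEquiv n (τ i, false))) ∘ (τ⁻¹ : Equiv.Perm _) =
        (fun i => π (pairEquiv n (τ i, false))) ∘ (τ'⁻¹ : Equiv.Perm _) := by
      apply Tuple.unique_monotone
      · intro i j hij
        simpa using hπ.1.monotone hij
      · intro i j hij
        simp only [Function.comp, (h2 _).2]
        simpa using hπ'.1.monotone hij
    have hinj : Function.Injective fun i => π (pairEquiv n (τ i, false)) :=
      hπ.1.injective.comp τ.injective
    have h4 : τ⁻¹ = τ'⁻¹ := Equiv.ext fun i => hinj (congrFun h3 i)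
    exact inv_injective h4
  subst hτ
  refine ⟨?_, funext fun i => (h2 i).1, rfl⟩
  ext l
  obtain ⟨⟨i, b⟩, rfl⟩ := (pairEquiv n).surjective l
  have := (h2 (τ⁻¹ i)).2 b
  have hi : τ (τ⁻¹ i) = i := by simp
  rw [hi] at this
  rw [this]

/-- Put the two values of each pair in order, and sort the pairs by their smaller values. -/
theorem exists_pairPerm_decomposition {n : ℕ} (σ : Equiv.Perm (Fin (2 * n))) :
    ∃ π ∈ pfaffianPerms n, ∃ ε τ, π * pairPerm ε τ = σ := by
  let ε : Fin n → Equiv.Perm Bool := fun i =>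
    if σ (pairEquiv n (i, false)) < σ (pairEquiv n (i, true)) then 1 else Equiv.swap false true
  let m : Fin n → Fin (2 * n) := fun i => σ (pairEquiv n (i, ε i false))
  have hm : ∀ i, m i < σ (pairEquiv n (i, ε i true)) := by
    intro i
    simp only [m, ε]
    split_ifs with h
    · simpa using h
    · rw [Equiv.swap_apply_left, Equiv.swap_apply_right]
      refine lt_of_le_of_ne (not_lt.1 h) ?_
      intro h'
      have := (pairEquiv n).injective (σ.injective h')
      simp at this
  have hεε : ∀ i b, ε i (ε i b) = b := by
    intro i b
    rcases bool_perm_cases (ε i) with h | h <;> simp [h]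
  let τ := Tuple.sort m
  refine ⟨σ * pairPerm (fun i => ε (τ i)) τ, ?_, ε, τ⁻¹, ?_⟩
  · rw [mem_pfaffianPerms]
    simp only [Equiv.Perm.mul_apply, pairPerm_apply]
    refine ⟨?_, fun i => hm (τ i)⟩
    refine (Tuple.monotone_sort m).strictMono_of_injective ?_
    intro i j hij
    have := (pairEquiv n).injective (σ.injective hij)
    simpa using congrArg Prod.fst this
  · ext l
    obtain ⟨⟨i, b⟩, rfl⟩ := (pairEquiv n).surjective l
    simp [pairPerm_apply, hεε]

/-- The pfaffian as a sum over all permutations. -/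
theorem sum_pfTerm {n : ℕ} (A : Matrix (Fin (2 * n)) (Fin (2 * n)) K)
    (hA : ∀ i j, A i j = -A j i) :
    ∑ σ, pfTerm A σ = (2 ^ n * n.factorial : ℕ) * pfaffian A := by
  have h1 : ∑ σ, pfTerm A σ = ∑ x ∈ pfaffianPerms n ×ˢ
      (Finset.univ : Finset ((Fin n → Equiv.Perm Bool) × Equiv.Perm (Fin n))), pfTerm A x.1 := by
    symm
    refine Finset.sum_bij (fun x _ => x.1 * pairPerm x.2.1 x.2.2) (fun _ _ => Finset.mem_univ _)
      ?_ ?_ ?_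
    · rintro ⟨π, ε, τ⟩ h ⟨π', ε', τ'⟩ h' heq
      simp only [Finset.mem_product, Finset.mem_univ, and_true] at h h'
      obtain ⟨rfl, rfl, rfl⟩ := pairPerm_decomposition_injective h h' heq
      rfl
    · intro σ _
      obtain ⟨π, hπ, ε, τ, h⟩ := exists_pairPerm_decomposition σ
      exact ⟨⟨π, ε, τ⟩, by simpa using hπ, h⟩
    · rintro ⟨π, ε, τ⟩ _
      exact (pfTerm_mul_pairPerm A hA π ε τ).symm
  rw [h1, Finset.sum_product, pfaffian_eq_sum, Finset.mul_sum]
  refine Finset.sum_congr rfl fun π _ => ?_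
  change ∑ y : (Fin n → Equiv.Perm Bool) × Equiv.Perm (Fin n), pfTerm A π = _
  rw [Finset.sum_const, nsmul_eq_mul, Finset.card_univ, Fintype.card_prod, Fintype.card_pi,
    Fintype.card_perm, Fintype.card_perm]
  simp

/-- The expansion of the pfaffian along the first row. -/
theorem pfaffian_succ_row_zero {n : ℕ} (A : Matrix (Fin (2 * (n + 1))) (Fin (2 * (n + 1))) K) :
    pfaffian A = ∑ j : Fin (2 * n + 1), (-1) ^ (j : ℕ) *
      A (0 : Fin (2 * n + 2)) (j.succ : Fin (2 * n + 2)) *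
        pfaffian (A.submatrix (fun l : Fin (2 * n) => ((j.succAbove l).succ : Fin (2 * n + 2)))
          (fun l : Fin (2 * n) => ((j.succAbove l).succ : Fin (2 * n + 2)))) := by
  let G : Equiv.Perm (Fin (2 * n + 2)) → K := fun π =>
    if (π : Equiv.Perm (Fin (2 * (n + 1)))) ∈ pfaffianPerms (n + 1) then
      pfTerm (n := n + 1) A π else 0
  have h0 : pfaffian A = ∑ π, G π := by
    rw [pfaffian_eq_sum, Finset.sum_ite_mem]
    exact Finset.sum_congr (Finset.univ_inter _).symm fun _ _ => rfl
  -- A permutation is encoded by the image `j` of its first position and a permutation of the rest,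
  -- relabelled by `j.succAbove`; the cycle that inserts `j` accounts for the sign `(-1) ^ j`.
  let Φ : Fin (2 * n + 1) × Equiv.Perm (Fin (2 * n)) → Equiv.Perm (Fin (2 * n + 1)) := fun x =>
    x.1.cycleRange.symm * Equiv.Perm.decomposeFin.symm (0, x.2)
  have hΦ0 : ∀ x, Φ x 0 = x.1 := by
    intro x
    simp [Φ]
  have hΦs : ∀ x l, Φ x l.succ = x.1.succAbove (x.2 l) := by
    intro x l
    simp [Φ]
  have hΦsign : ∀ x, Equiv.Perm.sign (Φ x) = (-1) ^ (x.1 : ℕ) * Equiv.Perm.sign x.2 := by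
    intro x
    simp only [Φ, Equiv.Perm.sign_mul, Equiv.Perm.sign_symm, Fin.sign_cycleRange,
      Equiv.Perm.decomposeFin.symm_sign]
    simp
  have hΦ : Function.Bijective Φ := by
    rw [Fintype.bijective_iff_injective_and_card]
    refine ⟨?_, ?_⟩
    · rintro ⟨j, ρ⟩ ⟨j', ρ'⟩ h
      have h1 : j = j' := (hΦ0 (j, ρ)).symm.trans (h ▸ hΦ0 (j', ρ'))
      subst h1
      congr 1
      ext l
      have h2 := hΦs (j, ρ) l
      rw [h, hΦs] at h2
      rw [Fin.succAbove_right_injective h2]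
    · simp [Fintype.card_perm, Nat.factorial_succ]
  rw [h0, ← Equiv.sum_comp Equiv.Perm.decomposeFin.symm, Fintype.sum_prod_type,
    Fintype.sum_eq_single (0 : Fin (2 * n + 2)), ← hΦ.sum_comp, Fintype.sum_prod_type]
  · refine Finset.sum_congr rfl fun j _ => ?_
    rw [pfaffian_eq_sum, Finset.mul_sum, ← Finset.sum_filter_add_sum_filter_not Finset.univ
      (fun ρ => ρ ∈ pfaffianPerms n), Finset.filter_mem_eq_inter, Finset.univ_inter]
    have e0 : pairEquiv (n + 1) (0, false) = (0 : Fin (2 * n + 2)) := rfl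
    have e1 : pairEquiv (n + 1) (0, true) = (Fin.succ 0 : Fin (2 * n + 2)) := rfl
    have e2 : ∀ i b, pairEquiv (n + 1) (Fin.succ i, b) =
        (Fin.succ (Fin.succ (pairEquiv n (i, b))) : Fin (2 * n + 2)) := by
      intro i b
      apply Fin.ext
      change 2 * ((i : ℕ) + 1) + b.toNat = 2 * (i : ℕ) + b.toNat + 1 + 1
      ring
    have v0 : ∀ ρ, Equiv.Perm.decomposeFin.symm ((0 : Fin (2 * n + 2)), Φ (j, ρ))
        (pairEquiv (n + 1) (0, false)) = 0 := by
      intro ρ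
      rw [e0, Equiv.Perm.decomposeFin_symm_apply_zero]
    have v1 : ∀ ρ, Equiv.Perm.decomposeFin.symm ((0 : Fin (2 * n + 2)), Φ (j, ρ))
        (pairEquiv (n + 1) (0, true)) = j.succ := by
      intro ρ
      rw [e1, Equiv.Perm.decomposeFin_symm_apply_succ, hΦ0, Equiv.swap_self]
      rfl
    have v2 : ∀ ρ i b, Equiv.Perm.decomposeFin.symm ((0 : Fin (2 * n + 2)), Φ (j, ρ))
        (pairEquiv (n + 1) (Fin.succ i, b)) = (j.succAbove (ρ (pairEquiv n (i, b)))).succ := by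
      intro ρ i b
      rw [e2, Equiv.Perm.decomposeFin_symm_apply_succ, hΦs, Equiv.swap_self]
      rfl
    have hlt : ∀ a b : Fin (2 * n), (j.succAbove a).succ < (j.succAbove b).succ ↔ a < b := by
      intro a b
      rw [Fin.succ_lt_succ_iff, (Fin.strictMono_succAbove j).lt_iff_lt]
    have hmem : ∀ ρ : Equiv.Perm (Fin (2 * n)),
        (Equiv.Perm.decomposeFin.symm ((0 : Fin (2 * n + 2)), Φ (j, ρ)) :
          Equiv.Perm (Fin (2 * (n + 1)))) ∈ pfaffianPerms (n + 1) ↔ ρ ∈ pfaffianPerms n := by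
      intro ρ
      rw [mem_pfaffianPerms, mem_pfaffianPerms]
      constructor
      · rintro ⟨h1, h2⟩
        refine ⟨fun i i' hi => ?_, fun i => ?_⟩
        · have := h1 (Fin.succ_lt_succ_iff.2 hi)
          simp only [v2] at this
          exact (hlt _ _).1 this
        · have := h2 i.succ
          rw [v2, v2] at this
          exact (hlt _ _).1 this
      · rintro ⟨h1, h2⟩
        refine ⟨fun i i' => ?_, fun i => ?_⟩
        · refine Fin.cases ?_ (fun i' => ?_) i'
          · intro h; exact absurd h (Fin.not_lt_zero i)
          · refine Fin.cases ?_ (fun i => ?_) i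
            · intro _
              change _ < Equiv.Perm.decomposeFin.symm _ (pairEquiv (n + 1) (Fin.succ i', false))
              rw [v2]
              change Equiv.Perm.decomposeFin.symm ((0 : Fin (2 * n + 2)), Φ (j, ρ))
                (pairEquiv (n + 1) (0, false)) < _
              rw [v0]
              exact Fin.succ_pos _
            · intro h
              simp only [v2]
              exact (hlt _ _).2 (h1 (Fin.succ_lt_succ_iff.1 h))
        · refine Fin.cases ?_ (fun i => ?_) i
          · change Equiv.Perm.decomposeFin.symm ((0 : Fin (2 * n + 2)), Φ (j, ρ))
                (pairEquiv (n + 1) (0, false)) < Equiv.Perm.decomposeFin.symm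
                  ((0 : Fin (2 * n + 2)), Φ (j, ρ)) (pairEquiv (n + 1) (0, true))
            rw [v0, v1]
            exact Fin.succ_pos _
          · rw [v2, v2]
            exact (hlt _ _).2 (h2 i)
    rw [Finset.sum_eq_zero (s := Finset.univ.filter fun ρ => ¬ ρ ∈ pfaffianPerms n), add_zero]
    · refine Finset.sum_congr rfl fun ρ hρ => ?_
      simp only [G]
      rw [if_pos ((hmem ρ).2 hρ)]
      unfold pfTerm
      rw [Fin.prod_univ_succ]
      have hs : Equiv.Perm.sign (Equiv.Perm.decomposeFin.symm ((0 : Fin (2 * n + 2)), Φ (j, ρ))) =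
          (-1) ^ (j : ℕ) * Equiv.Perm.sign ρ := by
        rw [Equiv.Perm.decomposeFin.symm_sign, hΦsign]
        simp
      simp only [v0, v1, v2, Matrix.submatrix_apply]
      have hs' := congrArg (fun x : ℤˣ => ((x : ℤ) : K)) hs
      push_cast at hs'
      refine (congrArg (· * _) hs').trans ?_
      ring
    · intro ρ hρ
      rw [Finset.mem_filter] at hρ
      simp only [G]
      rw [if_neg]
      rw [hmem ρ]
      exact hρ.2
  -- Permutations that do not send the first position to `0` drop out: the first value is the least
  -- of all smaller values of pairs, hence the least value.
  · intro p hp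
    refine Finset.sum_eq_zero fun τ _ => ?_
    simp only [G]
    rw [if_neg]
    intro hmem
    rw [mem_pfaffianPerms] at hmem
    set π : Equiv.Perm (Fin (2 * (n + 1))) := Equiv.Perm.decomposeFin.symm (p, τ) with hπ
    have hp0 : π (pairEquiv (n + 1) (0, false)) = p :=
      Equiv.Perm.decomposeFin_symm_apply_zero p τ
    obtain ⟨⟨i, b⟩, hi⟩ := (pairEquiv (n + 1)).surjective (π.symm (0 : Fin (2 * n + 2)))
    have h1 : π (pairEquiv (n + 1) (i, b)) = (0 : Fin (2 * n + 2)) := by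
      rw [hi, Equiv.apply_symm_apply]
    have h2 : p ≤ π (pairEquiv (n + 1) (i, false)) := by
      rw [← hp0]
      exact hmem.1.monotone (Fin.zero_le i)
    have h3 : π (pairEquiv (n + 1) (i, false)) ≤ π (pairEquiv (n + 1) (i, b)) := by
      cases b
      · exact le_rfl
      · exact (hmem.2 i).le
    rw [h1] at h3
    exact hp (Fin.le_zero_iff.1 (h2.trans h3))

end Pfaffian

/-! ### De Bruijn's formula -/

section MinorSummation

variable {K : Type*} [Field K] [CharZero K]

/-- In the sum over all permutations `ρ` is absorbed by a translation. Characteristic zero serves to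
cancel `2 ^ n * n!`. -/
theorem pfaffian_submatrix_perm {n : ℕ} (A : Matrix (Fin (2 * n)) (Fin (2 * n)) K)
    (hA : ∀ i j, A i j = -A j i) (ρ : Equiv.Perm (Fin (2 * n))) :
    pfaffian (A.submatrix ρ ρ) = ((Equiv.Perm.sign ρ : ℤ) : K) * pfaffian A := by
  have hc : ((2 ^ n * n.factorial : ℕ) : K) ≠ 0 := by
    rw [Nat.cast_ne_zero]; positivity
  apply mul_left_cancel₀ hc
  rw [← sum_pfTerm (A.submatrix ρ ρ) (fun i j => hA (ρ i) (ρ j)), mul_left_comm, ← sum_pfTerm A hA, Finset.mul_sum,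
    
    ← Equiv.sum_comp (Equiv.mulLeft ρ) fun σ => ((Equiv.Perm.sign ρ : ℤ) : K) * pfTerm A σ]
  refine Finset.sum_congr rfl fun σ _ => ?_
  simp only [pfTerm, Equiv.coe_mulLeft, Equiv.Perm.sign_mul, Matrix.submatrix_apply,
    Equiv.Perm.mul_apply]
  have h := Int.units_mul_self (Equiv.Perm.sign ρ)
  have h' := congrArg (fun x : ℤˣ => ((x : ℤ) : K)) h
  push_cast at h' ⊢
  linear_combination (-((Equiv.Perm.sign σ : ℤ) : K) * ∏ i, A (ρ (σ (pairEquiv n (i, false))))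
    (ρ (σ (pairEquiv n (i, true))))) * h'

/-- The expansion of the pfaffian along the last column. -/
theorem pfaffian_succ_column_last {n : ℕ} (A : Matrix (Fin (2 * (n + 1))) (Fin (2 * (n + 1))) K)
    (hA : ∀ i j, A i j = -A j i) :
    pfaffian A = ∑ j : Fin (2 * n + 1), (-1) ^ (j : ℕ) *
      A (j.castSucc : Fin (2 * n + 2)) (Fin.last (2 * n + 1)) *
        pfaffian (A.submatrix (fun l : Fin (2 * n) => ((j.succAbove l).castSucc : Fin (2 * n + 2)))
          (fun l : Fin (2 * n) => ((j.succAbove l).castSucc : Fin (2 * n + 2)))) := by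
  -- The cyclic shift that brings the last index to the front is odd; its sign cancels the one from
  -- exchanging row and column in `A`.
  let ρ : Equiv.Perm (Fin (2 * n + 2)) := (finRotate (2 * n + 2)).symm
  have h0 : ρ 0 = Fin.last (2 * n + 1) := by
    rw [Equiv.symm_apply_eq, finRotate_last]
  have hs : ∀ l : Fin (2 * n + 1), ρ l.succ = l.castSucc := by
    intro l
    rw [Equiv.symm_apply_eq]
    apply Fin.ext
    rw [coe_finRotate_of_ne_last]
    · simp
    · exact (Fin.castSucc_lt_last l).ne
  have hsign : ((Equiv.Perm.sign ρ : ℤ) : K) = -1 := by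
    rw [Equiv.Perm.sign_symm, sign_finRotate]
    push_cast
    rw [pow_succ, pow_mul]
    simp
  have h1 := pfaffian_submatrix_perm A hA ρ
  rw [hsign, pfaffian_succ_row_zero] at h1
  have h2 : pfaffian A = -∑ j : Fin (2 * n + 1), (-1) ^ (j : ℕ) *
      (A.submatrix ρ ρ) (0 : Fin (2 * n + 2)) (j.succ : Fin (2 * n + 2)) *
        pfaffian ((A.submatrix ρ ρ).submatrix
          (fun l : Fin (2 * n) => ((j.succAbove l).succ : Fin (2 * n + 2)))
          (fun l : Fin (2 * n) => ((j.succAbove l).succ : Fin (2 * n + 2)))) := by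
    rw [h1]; ring
  rw [h2, ← Finset.sum_neg_distrib]
  refine Finset.sum_congr rfl fun j _ => ?_
  have h3 : (A.submatrix ρ ρ).submatrix
          (fun l : Fin (2 * n) => ((j.succAbove l).succ : Fin (2 * n + 2)))
          (fun l : Fin (2 * n) => ((j.succAbove l).succ : Fin (2 * n + 2))) =
        A.submatrix (fun l : Fin (2 * n) => ((j.succAbove l).castSucc : Fin (2 * n + 2)))
          (fun l : Fin (2 * n) => ((j.succAbove l).castSucc : Fin (2 * n + 2))) := by
    ext a b
    simp only [Matrix.submatrix_apply, hs]
  rw [h3, Matrix.submatrix_apply, h0, hs, hA]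
  ring

/-- The sign of `y - x`. -/
def orderSign (K : Type*) [CommRing K] {Λ : Type*} [LinearOrder Λ] (x y : Λ) : K :=
  if x < y then 1 else if y < x then -1 else 0

omit [CharZero K] in
theorem orderSign_antisymm {Λ : Type*} [LinearOrder Λ] (x y : Λ) :
    orderSign K x y = -orderSign K y x := by
  unfold orderSign
  rcases lt_trichotomy x y with h | rfl | h
  · simp [h, h.not_gt]
  · simp
  · simp [h, h.not_gt]

omit [CharZero K] in
theorem orderSign_strictMono {Λ Λ' : Type*} [LinearOrder Λ] [LinearOrder Λ'] {u : Λ → Λ'}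
    (hu : StrictMono u) (x y : Λ) : orderSign K (u x) (u y) = orderSign K x y := by
  unfold orderSign
  simp only [hu.lt_iff_lt]

omit [CharZero K] in
theorem sum_neg_one_pow_odd (n : ℕ) : ∑ j : Fin (2 * n + 1), (-1 : K) ^ (j : ℕ) = 1 := by
  rw [Fin.sum_univ_eq_sum_range (fun j => (-1 : K) ^ j)]
  induction n with
  | zero => simp
  | succ n ih =>
    rw [show 2 * (n + 1) + 1 = 2 * n + 1 + 1 + 1 by ring, Finset.sum_range_succ,
      Finset.sum_range_succ, ih]
    simp [pow_succ, pow_mul]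

-- Deleting indices leaves a matrix of the same form, so the expansion is an alternating sum of an
-- odd number of ones.
omit [CharZero K] in
theorem pfaffian_orderSign (n : ℕ) :
    pfaffian (Matrix.of fun i j : Fin (2 * n) => orderSign K i j) = 1 := by
  induction n with
  | zero =>
    rw [pfaffian_eq_sum]
    have : pfaffianPerms 0 = {1} := by
      ext π
      simp only [mem_pfaffianPerms, Finset.mem_singleton]
      have : IsEmpty (Fin (2 * 0)) := Fin.isEmpty
      exact iff_of_true ⟨fun i => i.elim0, fun i => i.elim0⟩ (Subsingleton.elim _ _)
    rw [this]
    simp [pfTerm]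
  | succ n ih =>
    rw [pfaffian_succ_row_zero]
    refine Eq.trans ?_ (sum_neg_one_pow_odd n)
    refine Finset.sum_congr rfl fun j _ => ?_
    have h1 : (Matrix.of fun i j : Fin (2 * (n + 1)) => orderSign K i j).submatrix
        (fun l : Fin (2 * n) => ((j.succAbove l).succ : Fin (2 * n + 2)))
        (fun l : Fin (2 * n) => ((j.succAbove l).succ : Fin (2 * n + 2))) =
        Matrix.of fun i j : Fin (2 * n) => orderSign K i j := by
      ext a b
      simp only [Matrix.submatrix_apply, Matrix.of_apply]
      refine orderSign_strictMono (u := fun l : Fin (2 * n) =>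
        ((j.succAbove l).succ : Fin (2 * n + 2))) ?_ a b
      exact (Fin.strictMono_succ).comp (Fin.strictMono_succAbove j)
    rw [h1, ih, Matrix.of_apply, mul_one]
    have : orderSign K (0 : Fin (2 * n + 2)) (j.succ : Fin (2 * n + 2)) = 1 := by
      rw [orderSign, if_pos (Fin.succ_pos j)]
    exact (congrArg _ this).trans (mul_one _)

variable {Λ : Type*} [LinearOrder Λ] [Fintype Λ]

/-- The antisymmetric form on families of vectors indexed by letters. -/
def letterForm {R : Type*} (g : Λ → R → K) : Matrix R R K :=
  Matrix.of fun p q => ∑ m, ∑ m', orderSign K m m' * (g m p * g m' q)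

omit [CharZero K] in
theorem letterForm_antisymm {R : Type*} (g : Λ → R → K) (p q : R) :
    letterForm g p q = -letterForm g q p := by
  simp only [letterForm, Matrix.of_apply, ← Finset.sum_neg_distrib]
  rw [Finset.sum_comm]
  refine Finset.sum_congr rfl fun m _ => Finset.sum_congr rfl fun m' _ => ?_
  rw [orderSign_antisymm]
  ring

open Classical in
/-- De Bruijn's formula. -/
theorem pfaffian_letterForm {n : ℕ} (g : Λ → Fin (2 * n) → K) :
    pfaffian (letterForm g) = ∑ u : Fin (2 * n) → Λ with StrictMono u,
      (Matrix.of fun i => g (u i)).det := by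
  have hc : ((2 ^ n * n.factorial : ℕ) : K) ≠ 0 := by
    rw [Nat.cast_ne_zero]; positivity
  apply mul_left_cancel₀ hc
  rw [← sum_pfTerm _ (letterForm_antisymm g)]
  -- Expanding all entries attaches a letter to every position, and `c u` collects the order signs.
  -- The sum over `σ` then is a determinant, alternating in `u`; over the rearrangements of a sorted
  -- `u` the signs add up to `2 ^ n * n!` times the pfaffian `1` of the order signs.
  let c : (Fin (2 * n) → Λ) → K := fun u =>
    ∏ i : Fin n, orderSign K (u (pairEquiv n (i, false))) (u (pairEquiv n (i, true)))
  have h1 : ∀ σ : Equiv.Perm (Fin (2 * n)), pfTerm (letterForm g) σ =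
      ∑ u : Fin (2 * n) → Λ, c u * (((Equiv.Perm.sign σ : ℤ) : K) * ∏ l, g (u l) (σ l)) := by
    intro σ
    have h2 : ∀ i : Fin n, letterForm g (σ (pairEquiv n (i, false))) (σ (pairEquiv n (i, true))) =
        ∑ z : Bool → Λ, orderSign K (z false) (z true) *
          ∏ b, g (z b) (σ (pairEquiv n (i, b))) := by
      intro i
      rw [letterForm, Matrix.of_apply, ← Fintype.sum_prod_type',
        ← (Equiv.boolArrowEquivProd Λ).sum_comp]
      refine Finset.sum_congr rfl fun z _ => ?_
      rw [Fintype.prod_bool, mul_comm (g (z true) _)]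
      rfl
    rw [pfTerm, Finset.prod_congr rfl fun i _ => h2 i, Finset.prod_univ_sum, Fintype.piFinset_univ,
      Finset.mul_sum]
    refine Fintype.sum_equiv ((Equiv.curry (Fin n) Bool Λ).symm.trans
      ((pairEquiv n).arrowCongr (Equiv.refl Λ))) _ _ fun z => ?_
    have h3 : ∀ i b, (((Equiv.curry (Fin n) Bool Λ).symm.trans
      ((pairEquiv n).arrowCongr (Equiv.refl Λ))) z) (pairEquiv n (i, b)) = z i b := by
      intro i b
      simp [Equiv.arrowCongr_apply, Function.uncurry]
    rw [Finset.prod_mul_distrib]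
    simp only [c, h3]
    rw [← Equiv.prod_comp (pairEquiv n), Fintype.prod_prod_type]
    simp only [h3]
    ring
  rw [Finset.sum_congr rfl fun σ _ => h1 σ, Finset.sum_comm]
  have h4 : ∀ u : Fin (2 * n) → Λ, ∑ σ : Equiv.Perm (Fin (2 * n)),
      c u * (((Equiv.Perm.sign σ : ℤ) : K) * ∏ l, g (u l) (σ l)) =
        c u * (Matrix.of fun i => g (u i)).det := by
    intro u
    rw [← Finset.mul_sum, ← Matrix.det_transpose, Matrix.det_apply']
    rfl
  rw [Finset.sum_congr rfl fun u _ => h4 u,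
    sum_eq_sum_strictMono_fin letterRank letterRank_strictMono.injective, Finset.mul_sum]
  · have hmono : ∀ u : Fin (2 * n) → Λ, StrictMono (letterRank ∘ u) ↔ StrictMono u :=
      fun u => ⟨fun h i j hij => letterRank_strictMono.lt_iff_lt.1 (h hij),
        fun h => letterRank_strictMono.comp h⟩
    simp only [hmono]
    refine Finset.sum_congr rfl fun u hu => ?_
    rw [Finset.mem_filter_univ] at hu
    have h5 : ∀ σ : Equiv.Perm (Fin (2 * n)), c (u ∘ σ) * (Matrix.of fun i => g ((u ∘ σ) i)).det =
        pfTerm (Matrix.of fun i j : Fin (2 * n) => orderSign K i j) σ *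
          (Matrix.of fun i => g (u i)).det := by
      intro σ
      have h6 : (Matrix.of fun i => g ((u ∘ σ) i)).det =
          ((Equiv.Perm.sign σ : ℤ) : K) * (Matrix.of fun i => g (u i)).det := by
        rw [← Matrix.det_permute]
        rfl
      rw [h6, pfTerm]
      simp only [c, Function.comp, orderSign_strictMono hu, Matrix.of_apply]
      ring
    rw [Finset.sum_congr rfl fun σ _ => h5 σ, ← Finset.sum_mul, sum_pfTerm, pfaffian_orderSign,
      mul_one]
    intro i j
    exact orderSign_antisymm i j
  · intro u hu
    unfold Function.Injective at hu
    push Not at hu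
    obtain ⟨i, j, hij, hne⟩ := hu
    rw [Matrix.det_zero_of_row_eq hne, mul_zero]
    funext q
    simp [Matrix.of_apply, hij]

end MinorSummation

/-! ### The minor summation formula, by induction on the number of fixed rows -/

section MinorSummation

variable {K : Type*} [Field K] [CharZero K] {Λ : Type*} [LinearOrder Λ] [Fintype Λ]

/-- The antisymmetric block matrix with blocks `A`, `B`, `-Bᵀ` and `0`. -/
def skewBlock {R d n : ℕ} (h : R + d = 2 * n) (A : Matrix (Fin R) (Fin R) K)
    (B : Matrix (Fin R) (Fin d) K) : Matrix (Fin (2 * n)) (Fin (2 * n)) K :=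
  Matrix.reindex (finSumFinEquiv.trans (finCongr h)) (finSumFinEquiv.trans (finCongr h))
    (Matrix.fromBlocks A B (-B.transpose) 0)

omit [CharZero K] in
theorem skewBlock_antisymm {R d n : ℕ} (h : R + d = 2 * n) (A : Matrix (Fin R) (Fin R) K)
    (hA : ∀ p q, A p q = -A q p) (B : Matrix (Fin R) (Fin d) K) (i j : Fin (2 * n)) :
    skewBlock h A B i j = -skewBlock h A B j i := by
  obtain ⟨i, rfl⟩ := (finSumFinEquiv.trans (finCongr h)).surjective i
  obtain ⟨j, rfl⟩ := (finSumFinEquiv.trans (finCongr h)).surjective j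
  simp only [skewBlock, Matrix.reindex_apply, Matrix.submatrix_apply, Equiv.symm_apply_apply]
  rcases i with i | i <;> rcases j with j | j
  · exact hA i j
  all_goals simp

/-- The matrix whose first rows are the vectors of the letters of `u`, and whose other rows are the
columns of `B` in reverse order. -/
def letterMatrix {R d k : ℕ} (hR : k + d = R) (g : Λ → Fin R → K) (B : Matrix (Fin R) (Fin d) K)
    (u : Fin k → Λ) : Matrix (Fin R) (Fin R) K :=
  Matrix.of fun p => if hp : (p : ℕ) < k then g (u ⟨p, hp⟩)
    else fun q => B q ⟨R - 1 - p, by omega⟩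

-- Row `k` is the first fixed row and, by the reversed order, holds the last column of `B`. This
-- expansion is therefore parallel to `pfaffian_skewBlock_succ`.
omit [CharZero K] [LinearOrder Λ] [Fintype Λ] in
theorem det_letterMatrix_succ {R d k : ℕ} (hR : k + d = R) (hR' : k + (d + 1) = R + 1)
    (g : Λ → Fin (R + 1) → K) (B : Matrix (Fin (R + 1)) (Fin (d + 1)) K) (u : Fin k → Λ) :
    (letterMatrix hR' g B u).det = ∑ j : Fin (R + 1), (-1) ^ (k + j : ℕ) * B j (Fin.last d) *
      (letterMatrix hR (fun m q => g m (j.succAbove q))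
        (B.submatrix j.succAbove Fin.castSucc) u).det := by
  have hk : k < R + 1 := by omega
  rw [Matrix.det_succ_row _ ⟨k, hk⟩]
  refine Finset.sum_congr rfl fun j _ => ?_
  congr 1
  · congr 1
    rw [letterMatrix, Matrix.of_apply, dif_neg (by simp)]
    congr 1
    ext
    simp
    omega
  · congr 1
    ext p q
    simp only [letterMatrix, Matrix.submatrix_apply, Matrix.of_apply]
    by_cases hp : (p : ℕ) < k
    · have h1 : Fin.succAbove ⟨k, hk⟩ p = p.castSucc := by
        apply Fin.succAbove_of_castSucc_lt
        simpa [Fin.lt_def] using hp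
      simp only [h1, Fin.val_castSucc, hp, dif_pos]
    · have h1 : Fin.succAbove ⟨k, hk⟩ p = p.succ := by
        apply Fin.succAbove_of_le_castSucc
        simpa [Fin.le_def] using hp
      have hp' : ¬ (p : ℕ) + 1 < k := by omega
      simp only [h1, Fin.val_succ, hp, hp', dif_neg, not_false_iff]
      congr 1
      ext
      simp
      omega

theorem pfaffian_skewBlock_succ {R d n : ℕ} (h' : R + 1 + (d + 1) = 2 * (n + 1))
    (h : R + d = 2 * n) (A : Matrix (Fin (R + 1)) (Fin (R + 1)) K) (hA : ∀ p q, A p q = -A q p)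
    (B : Matrix (Fin (R + 1)) (Fin (d + 1)) K) :
    pfaffian (skewBlock h' A B) = ∑ j : Fin (R + 1), (-1) ^ (j : ℕ) * B j (Fin.last d) *
      pfaffian (skewBlock h (A.submatrix j.succAbove j.succAbove)
        (B.submatrix j.succAbove Fin.castSucc)) := by
  rw [pfaffian_succ_column_last _ (skewBlock_antisymm h' A hA B)]
  have hsz : R + 1 + d = 2 * n + 1 := by omega
  rw [← Equiv.sum_comp (finCongr hsz), Fin.sum_univ_add]
  have hl : ∀ j : Fin (R + 1), (((finCongr hsz) (Fin.castAdd d j)).castSucc : Fin (2 * n + 2)) =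
      (finSumFinEquiv.trans (finCongr h')) (Sum.inl j) := fun j => Fin.ext (by simp)
  have hr : ∀ j : Fin d, (((finCongr hsz) (Fin.natAdd (R + 1) j)).castSucc : Fin (2 * n + 2)) =
      (finSumFinEquiv.trans (finCongr h')) (Sum.inr j.castSucc) := fun j => Fin.ext (by simp)
  have hlast : (Fin.last (2 * n + 1) : Fin (2 * n + 2)) =
      (finSumFinEquiv.trans (finCongr h')) (Sum.inr (Fin.last d)) := Fin.ext (by simp; omega)
  rw [Finset.sum_eq_zero (s := (Finset.univ : Finset (Fin d))), add_zero]
  · refine Finset.sum_congr rfl fun j _ => ?_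
    rw [hl, hlast]
    have h1 : skewBlock h' A B ((finSumFinEquiv.trans (finCongr h')) (Sum.inl j))
        ((finSumFinEquiv.trans (finCongr h')) (Sum.inr (Fin.last d))) = B j (Fin.last d) := by
      simp only [skewBlock, Matrix.reindex_apply, Matrix.submatrix_apply, Equiv.symm_apply_apply]
      rfl
    rw [h1]
    congr 2
    have h2 : ∀ x : Fin R ⊕ Fin d,
        ((((finCongr hsz) (Fin.castAdd d j)).succAbove
          ((finSumFinEquiv.trans (finCongr h)) x)).castSucc : Fin (2 * n + 2)) =
        (finSumFinEquiv.trans (finCongr h')) (Sum.map j.succAbove Fin.castSucc x) := by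
      intro x
      apply Fin.ext
      rcases x with x | x
      · simp [Fin.succAbove, Fin.lt_def]
        split_ifs <;> simp
      · have : ¬ R + (x : ℕ) < j := by omega
        simp [Fin.succAbove, Fin.lt_def, this]
        omega
    ext a b
    obtain ⟨a, rfl⟩ := (finSumFinEquiv.trans (finCongr h)).surjective a
    obtain ⟨b, rfl⟩ := (finSumFinEquiv.trans (finCongr h)).surjective b
    rw [Matrix.submatrix_apply, h2, h2]
    simp only [skewBlock, Matrix.reindex_apply, Matrix.submatrix_apply, Equiv.symm_apply_apply]
    rcases a with a | a <;> rcases b with b | b <;> rfl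
  · intro j _
    rw [hr, hlast]
    have h1 : skewBlock h' A B ((finSumFinEquiv.trans (finCongr h')) (Sum.inr j.castSucc))
        ((finSumFinEquiv.trans (finCongr h')) (Sum.inr (Fin.last d))) = 0 := by
      simp only [skewBlock, Matrix.reindex_apply, Matrix.submatrix_apply, Equiv.symm_apply_apply]
      rfl
    rw [h1]
    simp

open Classical in
/-- The minor summation formula. -/
theorem pfaffian_skewBlock_letterForm {k : ℕ} (d : ℕ) : ∀ {R n : ℕ} (h : R + d = 2 * n)
    (hR : k + d = R) (g : Λ → Fin R → K) (B : Matrix (Fin R) (Fin d) K),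
    pfaffian (skewBlock h (letterForm g) B) =
      ∑ u : Fin k → Λ with StrictMono u, (letterMatrix hR g B u).det := by
  induction d with
  | zero =>
    intro R n h hR g B
    have hn : R = 2 * n := h
    subst hn
    have hk : k = 2 * n := hR
    subst hk
    have h1 : skewBlock h (letterForm g) B = letterForm g := by
      ext i j
      have hi : ∀ i : Fin (2 * n), i = (finSumFinEquiv.trans (finCongr h)) (Sum.inl i) :=
        fun i => rfl
      conv_lhs => rw [hi i, hi j]
      simp only [skewBlock, Matrix.reindex_apply, Matrix.submatrix_apply, Equiv.symm_apply_apply]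
      rfl
    rw [h1, pfaffian_letterForm]
    refine Finset.sum_congr rfl fun u _ => ?_
    congr 1
    ext i j
    simp [letterMatrix]
  | succ d ih =>
    intro R n h hR g B
    obtain ⟨R, rfl⟩ : ∃ R', R = R' + 1 := ⟨R - 1, by omega⟩
    obtain ⟨n, rfl⟩ : ∃ n', n = n' + 1 := ⟨n - 1, by omega⟩
    -- The sizes force `k` to be even, so the signs of the two expansions agree.
    have hk : (-1 : K) ^ k = 1 := by
      apply Even.neg_one_pow
      exact ⟨n - d, by omega⟩
    rw [pfaffian_skewBlock_succ h (by omega) _ (letterForm_antisymm g)]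
    have h2 : ∀ j : Fin (R + 1), (letterForm g).submatrix j.succAbove j.succAbove =
        letterForm fun m q => g m (j.succAbove q) := fun j => rfl
    have hR' : k + d = R := by omega
    simp only [h2, ih _ hR', Finset.mul_sum]
    rw [Finset.sum_comm]
    refine Finset.sum_congr rfl fun u _ => ?_
    rw [det_letterMatrix_succ hR']
    refine Finset.sum_congr rfl fun j _ => ?_
    rw [pow_add, hk, one_mul]

end MinorSummation

/-! ### Tableau conditions in terms of adjacent diagonals -/

section Tableaux

theorem RowRel.trans {Λ : Type*} [LinearOrder Λ] {pr : Λ → Prop} {a b c : Λ} (h : RowRel pr a b)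
    (h' : RowRel pr b c) : RowRel pr a c := by
  rcases h' with h' | ⟨rfl, _⟩
  · exact Or.inl (h.trans_lt h')
  · exact h

theorem ColRel.trans {Λ : Type*} [LinearOrder Λ] {pr : Λ → Prop} {a b c : Λ} (h : ColRel pr a b)
    (h' : ColRel pr b c) : ColRel pr a c := by
  rcases h' with h' | ⟨rfl, _⟩
  · exact Or.inl (h.trans_lt h')
  · exact h

theorem rowRel_iff {Λ : Type*} [LinearOrder Λ] {pr : Λ → Prop} {a b : Λ} :
    RowRel pr a b ↔ a ≤ b ∧ (a = b → ¬ pr a) := by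
  unfold RowRel
  rw [le_iff_lt_or_eq]
  by_cases h : a = b
  · simp [h]
  · simp [h]

theorem colRel_iff {Λ : Type*} [LinearOrder Λ] {pr : Λ → Prop} {a b : Λ} :
    ColRel pr a b ↔ a ≤ b ∧ (a = b → pr a) := by
  unfold ColRel
  rw [le_iff_lt_or_eq]
  by_cases h : a = b
  · simp [h]
  · simp [h]

/-- The tableau conditions expressed by means of boxes of consecutive contents. -/
def ContentTableau (S : Finset Box) (t : S → MarkedNat) : Prop :=
  ∀ x y : S, content y.1 = content x.1 + 1 →
    (x.1.1 ≤ y.1.1 → RowRel MarkedNat.IsPrimed (t x) (t y)) ∧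
      (y.1.1 < x.1.1 → ColRel MarkedNat.IsPrimed (t y) (t x))

/-- Two boxes of consecutive contents are joined through the corner box that shares a row with one
and a column with the other; it lies in the shape by convexity. Conversely, edge neighbours have
consecutive contents, and the relations compose along a row or a column, which convexity keeps free
of gaps. -/
theorem isQTableau_iff {S : Finset Box} (hS : IsSkewShiftedShape S) (t : S → MarkedNat) :
    IsQTableau S t ↔ ContentTableau S t := by
  constructor
  · rintro ⟨h1, h2, h3, h4⟩ ⟨x, hx⟩ ⟨y, hy⟩ hxy
    have hxd := hS.1 x hx
    have hyd := hS.1 y hy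
    simp only [content] at hxy
    constructor
    · intro hle
      simp only at hle
      have hz : (x.1, y.2) ∈ S := hS.2 x hx y hy _ (by dsimp only; omega)
        (Prod.mk_le_mk.2 ⟨le_rfl, by omega⟩) (Prod.mk_le_mk.2 ⟨hle, le_rfl⟩)
      have l1 := h1 ⟨x, hx⟩ ⟨_, hz⟩ rfl (by dsimp only; omega)
      have l2 := h2 ⟨_, hz⟩ ⟨y, hy⟩ rfl hle
      refine rowRel_iff.2 ⟨l1.trans l2, fun he => ?_⟩
      refine h3 ⟨x, hx⟩ ⟨_, hz⟩ ?_ rfl (le_antisymm l1 (he ▸ l2))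
      intro h
      have := congrArg (fun b : S => b.1.2) h
      simp only at this
      omega
    · intro hlt
      simp only at hlt
      have hz : (y.1, x.2) ∈ S := hS.2 y hy x hx _ (by dsimp only; omega)
        (Prod.mk_le_mk.2 ⟨le_rfl, by omega⟩) (Prod.mk_le_mk.2 ⟨hlt.le, le_rfl⟩)
      have l1 := h1 ⟨y, hy⟩ ⟨_, hz⟩ rfl (by dsimp only; omega)
      have l2 := h2 ⟨_, hz⟩ ⟨x, hx⟩ rfl hlt.le
      refine colRel_iff.2 ⟨l1.trans l2, fun he => ?_⟩
      have e1 : t ⟨y, hy⟩ = t ⟨_, hz⟩ := le_antisymm l1 (he ▸ l2)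
      rw [e1]
      refine h4 ⟨_, hz⟩ ⟨x, hx⟩ ?_ rfl (e1 ▸ he)
      intro h
      have := congrArg (fun b : S => b.1.1) h
      simp only at this
      omega
  · intro h
    have hrow : ∀ (n : ℕ) (x y : S), x.1.1 = y.1.1 → y.1.2 = x.1.2 + (n + 1 : ℕ) →
        RowRel MarkedNat.IsPrimed (t x) (t y) := by
      intro n
      induction n with
      | zero =>
        intro x y h1 h2
        refine (h x y ?_).1 h1.le
        simp only [content]; push_cast at h2; omega
      | succ n ih =>
        rintro ⟨⟨x1, x2⟩, hx⟩ ⟨⟨y1, y2⟩, hy⟩ h1 h2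
        simp only at h1 h2
        push_cast at h2
        have hxd := hS.1 _ hx
        simp only at hxd
        have hz : (x1, x2 + 1) ∈ S := hS.2 _ hx _ hy _ (by dsimp only; omega)
          (Prod.mk_le_mk.2 ⟨le_rfl, by omega⟩) (Prod.mk_le_mk.2 ⟨h1.le, by omega⟩)
        refine RowRel.trans ((h ⟨_, hx⟩ ⟨_, hz⟩ ?_).1 le_rfl) (ih ⟨_, hz⟩ ⟨_, hy⟩ h1 ?_)
        · simp only [content]; ring
        · push_cast; omega
    have hcol : ∀ (n : ℕ) (x y : S), x.1.2 = y.1.2 → y.1.1 = x.1.1 + (n + 1 : ℕ) →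
        ColRel MarkedNat.IsPrimed (t x) (t y) := by
      intro n
      induction n with
      | zero =>
        intro x y h1 h2
        push_cast at h2
        refine (h y x ?_).2 (by omega)
        simp only [content]; omega
      | succ n ih =>
        rintro ⟨⟨x1, x2⟩, hx⟩ ⟨⟨y1, y2⟩, hy⟩ h1 h2
        simp only at h1 h2
        push_cast at h2
        have hyd := hS.1 _ hy
        simp only at hyd
        have hz : (x1 + 1, x2) ∈ S := hS.2 _ hx _ hy _ (by dsimp only; omega)
          (Prod.mk_le_mk.2 ⟨by omega, le_rfl⟩) (Prod.mk_le_mk.2 ⟨by omega, h1.le⟩)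
        refine ColRel.trans ((h ⟨_, hz⟩ ⟨_, hx⟩ ?_).2 (by dsimp only; omega))
          (ih ⟨_, hz⟩ ⟨_, hy⟩ h1 ?_)
        · simp only [content]; ring
        · push_cast; omega
    have hrow' : ∀ x y : S, x ≠ y → x.1.1 = y.1.1 → x.1.2 ≤ y.1.2 →
        RowRel MarkedNat.IsPrimed (t x) (t y) := by
      intro x y hne h1 h2
      have : x.1.2 ≠ y.1.2 := fun h3 => hne (Subtype.ext (Prod.ext h1 h3))
      refine hrow (y.1.2 - x.1.2 - 1).toNat x y h1 ?_
      push_cast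
      omega
    have hcol' : ∀ x y : S, x ≠ y → x.1.2 = y.1.2 → x.1.1 ≤ y.1.1 →
        ColRel MarkedNat.IsPrimed (t x) (t y) := by
      intro x y hne h1 h2
      have : x.1.1 ≠ y.1.1 := fun h3 => hne (Subtype.ext (Prod.ext h3 h1))
      refine hcol (y.1.1 - x.1.1 - 1).toNat x y h1 ?_
      push_cast
      omega
    refine ⟨fun x y h1 h2 => ?_, fun x y h1 h2 => ?_, fun x y hne h1 he => ?_,
      fun x y hne h1 he => ?_⟩
    · rcases eq_or_ne x y with rfl | hne
      · exact le_rfl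
      · exact (rowRel_iff.1 (hrow' x y hne h1 h2)).1
    · rcases eq_or_ne x y with rfl | hne
      · exact le_rfl
      · exact (colRel_iff.1 (hcol' x y hne h1 h2)).1
    · rcases le_total x.1.2 y.1.2 with h2 | h2
      · exact (rowRel_iff.1 (hrow' x y hne h1 h2)).2 he
      · rw [he]
        exact (rowRel_iff.1 (hrow' y x hne.symm h1.symm h2)).2 he.symm
    · rcases le_total x.1.1 y.1.1 with h2 | h2
      · exact (colRel_iff.1 (hcol' x y hne h1 h2)).2 he
      · rw [he]
        exact (colRel_iff.1 (hcol' y x hne.symm h1.symm h2)).2 he.symm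

end Tableaux

/-! ### Coordinates along the infinite strip: content and slide -/

section RuleBox

variable (fromLeft : ℤ → Bool)

theorem ruleBox_zero : ruleBox fromLeft 0 = (0, 0) := by
  simp [ruleBox]

theorem ruleBox_succ (c : ℕ) : ruleBox fromLeft ((c + 1 : ℕ) : ℤ) =
    if fromLeft ((c + 1 : ℕ) : ℤ) = true then
      ((ruleBox fromLeft c).1, (ruleBox fromLeft c).2 + 1)
    else ((ruleBox fromLeft c).1 - 1, (ruleBox fromLeft c).2) := by
  have h : Finset.Ioc (0 : ℤ) ((c + 1 : ℕ) : ℤ) = insert ((c + 1 : ℕ) : ℤ) (Finset.Ioc 0 (c : ℤ)) := by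
    ext x
    simp only [Finset.mem_Ioc, Finset.mem_insert]
    push_cast
    omega
  have hnot : ∀ P : ℤ → Prop, ∀ [DecidablePred P],
      ((c + 1 : ℕ) : ℤ) ∉ (Finset.Ioc 0 (c : ℤ)).filter P := by
    intro P _
    simp
  unfold ruleBox
  rw [h, Finset.filter_insert, Finset.filter_insert]
  cases hf : fromLeft ((c + 1 : ℕ) : ℤ)
  · simp only [if_true, Finset.card_insert_of_notMem (hnot _)]
    simp
    ring
  · simp only [if_true, Finset.card_insert_of_notMem (hnot _)]
    simp

theorem content_ruleBox (c : ℕ) : content (ruleBox fromLeft c) = c := by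
  induction c with
  | zero => simp [ruleBox_zero, content]
  | succ c ih =>
    rw [ruleBox_succ]
    unfold content at *
    split_ifs <;> push_cast <;> omega

theorem ruleBox_fst_antitone : Antitone fun c : ℕ => (ruleBox fromLeft c).1 := by
  refine antitone_nat_of_succ_le fun c => ?_
  rw [ruleBox_succ]
  split_ifs <;> simp

theorem ruleBox_snd_monotone : Monotone fun c : ℕ => (ruleBox fromLeft c).2 := by
  refine monotone_nat_of_le_succ fun c => ?_
  rw [ruleBox_succ]
  split_ifs <;> simp

/-- The box of content `c` on the infinite strip, moved `d` steps along the diagonal. -/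
noncomputable def slideBox (c : ℕ) (d : ℤ) : Box :=
  ((ruleBox fromLeft c).1 + d, (ruleBox fromLeft c).2 + d)

theorem content_slideBox (c : ℕ) (d : ℤ) : content (slideBox fromLeft c d) = c := by
  have := content_ruleBox fromLeft c
  unfold slideBox
  unfold content at *
  simp only
  omega

theorem slideBox_injective {c c' : ℕ} {d d' : ℤ} (h : slideBox fromLeft c d = slideBox fromLeft c' d') :
    c = c' ∧ d = d' := by
  have h1 : c = c' := by
    have := congrArg content h
    rw [content_slideBox, content_slideBox] at this
    exact_mod_cast this
  subst h1
  refine ⟨rfl, ?_⟩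
  have := congrArg Prod.fst h
  simpa [slideBox] using this

theorem exists_eq_slideBox {x : Box} (hx : x.1 ≤ x.2) :
    ∃ d, x = slideBox fromLeft (content x).toNat d := by
  refine ⟨x.1 - (ruleBox fromLeft (content x).toNat).1, ?_⟩
  have := content_ruleBox fromLeft (content x).toNat
  have h : ((content x).toNat : ℤ) = content x := Int.toNat_of_nonneg (by unfold content; omega)
  rw [h] at this
  unfold slideBox
  rw [h]
  unfold content at this ⊢
  ext
  · simp
  · simp only; omega

/-- For slides of strips of a system, the first case is `key c p ≤ key c q` and the second its
negation, matching the exchange of row and column relation in `StepRel`. -/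
theorem slideBox_fst_le_iff (c : ℕ) (d d' : ℤ) :
    (slideBox fromLeft c d).1 ≤ (slideBox fromLeft (c + 1) d').1 ↔
      if fromLeft ((c + 1 : ℕ) : ℤ) = true then d ≤ d' else d < d' := by
  simp only [slideBox]
  rw [ruleBox_succ]
  split_ifs <;> simp only <;> omega

end RuleBox

/-! ### Fillings of a shape as sequences of families of letters -/

namespace StripSystem

section Chains

variable {fl : ℕ → Bool} {r : ℕ} (T : StripSystem fl r)
variable {Λ K : Type*} [LinearOrder Λ] [Fintype Λ] [CommRing K] (pr : Λ → Prop)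
  (w : ℕ → Λ → K)

/-- A sequence of families of letters of contents `c, …, c + n` that forms a tableau, except that
the validity of the first family is not required. -/
def IsChain (c n : ℕ) (V : Fin (n + 1) → Fin r → Option Λ) : Prop :=
  ∀ i : Fin n, T.Valid (c + 1 + i) (V i.succ) ∧ T.Interlace pr (c + i) (V i.castSucc) (V i.succ)

omit [Fintype Λ] in
theorem isChain_cons_cons (c n : ℕ) (t u : Fin r → Option Λ) (U : Fin n → Fin r → Option Λ) :
    T.IsChain pr c (n + 1) (Fin.cons t (Fin.cons u U : Fin (n + 1) → Fin r → Option Λ)) ↔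
      (T.Valid (c + 1) u ∧ T.Interlace pr c t u) ∧ T.IsChain pr (c + 1) n (Fin.cons u U) := by
  unfold IsChain
  rw [Fin.forall_fin_succ]
  refine and_congr Iff.rfl (forall_congr' fun i => ?_)
  have h1 : c + 1 + ((i.succ : Fin (n + 1)) : ℕ) = c + 1 + 1 + i := by simp; ring
  have h2 : c + ((i.succ : Fin (n + 1)) : ℕ) = c + 1 + i := by simp; ring
  rw [h1, h2]
  rfl

open Classical in
theorem partialSum_eq_sum_chain (n : ℕ) : ∀ (c : ℕ) (t : Fin r → Option Λ),
    T.partialSum pr w n c t = ∑ U : Fin n → Fin r → Option Λ,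
      if T.IsChain pr c n (Fin.cons t U) then ∏ i : Fin n, weight w (c + 1 + i) (U i) else 0 := by
  induction n with
  | zero =>
    intro c t
    rw [partialSum, Fintype.sum_unique, if_pos (show T.IsChain pr c 0 _ from fun i => i.elim0)]
    simp
  | succ n ih =>
    intro c t
    rw [partialSum, ← (Fin.consEquiv fun _ => Fin r → Option Λ).sum_comp, Fintype.sum_prod_type]
    refine Finset.sum_congr rfl fun u _ => ?_
    rw [ih]
    have h : ∀ U : Fin n → Fin r → Option Λ, (Fin.consEquiv fun _ => Fin r → Option Λ) (u, U) =
      Fin.cons u U := fun U => rfl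
    simp only [h, isChain_cons_cons]
    split_ifs with hu
    · rw [Finset.mul_sum]
      refine Finset.sum_congr rfl fun U _ => ?_
      simp only [hu, true_and]
      split_ifs
      · rw [Fin.prod_univ_succ]
        congr 1
        refine Finset.prod_congr rfl fun i _ => ?_
        have h1 : c + 1 + ((i.succ : Fin (n + 1)) : ℕ) = c + 1 + 1 + i := by simp; ring
        rw [h1, Fin.cons_succ]
      · rw [mul_zero]
    · simp [hu]

open Classical in
theorem sum_partialSum_eq_sum_chain (n : ℕ) :
    (∑ u : Fin r → Option Λ, if T.Valid 0 u then weight w 0 u * T.partialSum pr w n 0 u else 0) =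
      ∑ V : Fin (n + 1) → Fin r → Option Λ,
        if (∀ i : Fin (n + 1), T.Valid i (V i)) ∧ ∀ i : Fin n, T.Interlace pr i (V i.castSucc) (V i.succ) then
          ∏ i : Fin (n + 1), weight w i (V i) else 0 := by
  rw [← (Fin.consEquiv fun _ => Fin r → Option Λ).sum_comp, Fintype.sum_prod_type]
  refine Finset.sum_congr rfl fun u _ => ?_
  have h : ∀ U : Fin n → Fin r → Option Λ, (Fin.consEquiv fun _ => Fin r → Option Λ) (u, U) =
    Fin.cons u U := fun U => rfl
  have h2 : ∀ U : Fin n → Fin r → Option Λ,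
      ((∀ i : Fin (n + 1), T.Valid i ((Fin.cons u U : Fin (n + 1) → Fin r → Option Λ) i)) ∧
        ∀ i : Fin n, T.Interlace pr i ((Fin.cons u U : Fin (n + 1) → Fin r → Option Λ) i.castSucc)
          ((Fin.cons u U : Fin (n + 1) → Fin r → Option Λ) i.succ)) ↔
        T.Valid 0 u ∧ T.IsChain pr 0 n (Fin.cons u U) := by
    intro U
    unfold IsChain
    rw [Fin.forall_fin_succ, forall_and, and_assoc]
    refine and_congr Iff.rfl (and_congr (forall_congr' fun i => ?_) (forall_congr' fun i => ?_))
    · rw [show 0 + 1 + (i : ℕ) = ((i.succ : Fin (n + 1)) : ℕ) by simp; ring]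
    · rw [zero_add]
  simp only [h, h2, T.partialSum_eq_sum_chain]
  split_ifs with hu
  · rw [Finset.mul_sum]
    refine Finset.sum_congr rfl fun U _ => ?_
    simp only [hu, true_and]
    split_ifs
    · rw [Fin.prod_univ_succ]
      congr 1
      refine Finset.prod_congr rfl fun i _ => ?_
      rw [show 0 + 1 + (i : ℕ) = ((i.succ : Fin (n + 1)) : ℕ) by simp; ring, Fin.cons_succ]
    · rw [mul_zero]
  · simp [hu]

end Chains

section Fillings

variable {fromLeft : ℤ → Bool} {r : ℕ} (T : StripSystem (fun c : ℕ => fromLeft c) r)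

/-- The boxes of `D` are those of the strips of the system. -/
def Describes (D : Finset Box) : Prop :=
  ∀ x, x ∈ D ↔ ∃ p c, T.Act c p ∧ x = slideBox fromLeft c (T.δ p)

/-- The letters of content `c` of a filling. -/
noncomputable def letters {D : Finset Box} {Λ : Type*} (hD : T.Describes D) (t : D → Λ) (c : ℕ)
    (p : Fin r) : Option Λ :=
  open Classical in
  if h : T.Act c p then some (t ⟨slideBox fromLeft c (T.δ p), (hD _).2 ⟨p, c, h, rfl⟩⟩) else none

variable {T}

theorem IsOutside.slideBox_injective (hT : T.IsOutside) {c c' : ℕ} {p p' : Fin r} (hp : T.Act c p)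
    (hp' : T.Act c' p') (h : slideBox fromLeft c (T.δ p) = slideBox fromLeft c' (T.δ p')) :
    c = c' ∧ p = p' := by
  obtain ⟨rfl, h2⟩ := _root_.slideBox_injective fromLeft h
  refine ⟨rfl, ?_⟩
  by_contra hne
  exact hT.ne c p p' hne (Or.inl hp) (Or.inl hp') h2

variable {D : Finset Box} {Λ : Type*} (hD : T.Describes D)

theorem valid_letters (t : D → Λ) (c : ℕ) : T.Valid c (T.letters hD t c) := by
  intro p
  unfold letters
  split_ifs with h <;> simp [h]

theorem letters_eq_some {t : D → Λ} {c : ℕ} {p : Fin r} {a : Λ} (h : T.letters hD t c p = some a) :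
    ∃ h : T.Act c p, t ⟨slideBox fromLeft c (T.δ p), (hD _).2 ⟨p, c, h, rfl⟩⟩ = a := by
  unfold letters at h
  split_ifs at h with h'
  exact ⟨h', Option.some_injective _ h⟩

theorem letters_injective (n : ℕ) (hn : ∀ p, T.β p < n + 1) :
    Function.Injective fun (t : D → Λ) (i : Fin (n + 1)) => T.letters hD t i := by
  intro t t' h
  funext ⟨x, hx⟩
  obtain ⟨p, c, hc, rfl⟩ := (hD x).1 hx
  have h1 := congrFun (congrFun h ⟨c, by have := hn p; have := hc.2; omega⟩) p
  simp only [letters, dif_pos hc] at h1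
  exact Option.some_injective _ h1

theorem exists_letters (hT : T.IsOutside) (n : ℕ) (V : Fin (n + 1) → Fin r → Option Λ)
    (hn : ∀ p, T.β p < n + 1) (hV : ∀ i : Fin (n + 1), T.Valid i (V i)) :
    ∃ t : D → Λ, (fun i : Fin (n + 1) => T.letters hD t i) = V := by
  have hex : ∀ x : D, ∃ a : Λ, ∃ p, ∃ c : Fin (n + 1), T.Act c p ∧
      x.1 = slideBox fromLeft c (T.δ p) ∧ V c p = some a := by
    rintro ⟨x, hx⟩
    obtain ⟨p, c, hc, rfl⟩ := (hD x).1 hx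
    have hcn : c < n + 1 := by have := hn p; have := hc.2; omega
    obtain ⟨a, ha⟩ := Option.isSome_iff_exists.1 ((hV ⟨c, hcn⟩ p).2 hc)
    exact ⟨a, p, ⟨c, hcn⟩, hc, rfl, ha⟩
  choose t P C hact hbox hval using hex
  refine ⟨t, ?_⟩
  funext i p
  by_cases hp : T.Act i p
  · have hx : slideBox fromLeft i (T.δ p) ∈ D := (hD _).2 ⟨p, i, hp, rfl⟩
    have h1 := hT.slideBox_injective hp (hact ⟨_, hx⟩) (hbox ⟨_, hx⟩)
    have h2 := hval ⟨_, hx⟩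
    rw [← h1.2, ← Fin.ext h1.1] at h2
    rw [h2, letters, dif_pos hp]
  · rw [letters, dif_neg hp]
    symm
    rw [← Option.not_isSome_iff_eq_none]
    exact fun h => hp ((hV i p).1 h)

theorem prod_weight_letters {K : Type*} [CommRing K] (hT : T.IsOutside) (n : ℕ)
    (hn : ∀ p, T.β p < n + 1) (w : ℤ → Λ → K) (t : D → Λ) :
    ∏ i : Fin (n + 1), weight (fun c => w c) i (T.letters hD t i) =
      ∏ x : D, w (content x.1) (t x) := by
  classical
  unfold weight
  rw [← Fintype.prod_prod_type' (f := fun (i : Fin (n + 1)) (p : Fin r) =>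
      (T.letters hD t i p).elim 1 (w ((i : ℕ) : ℤ))),
    ← Finset.prod_filter_of_ne (p := fun x : Fin (n + 1) × Fin r => T.Act x.1 x.2)]
  · refine Finset.prod_bij (fun x hx => ⟨slideBox fromLeft x.1 (T.δ x.2),
      (hD _).2 ⟨x.2, x.1, (Finset.mem_filter.1 hx).2, rfl⟩⟩) ?_ ?_ ?_ ?_
    · intro _ _
      exact Finset.mem_univ _
    · rintro ⟨i, p⟩ hx ⟨i', p'⟩ hx' h
      obtain ⟨h1, h2⟩ := hT.slideBox_injective (Finset.mem_filter.1 hx).2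
        (Finset.mem_filter.1 hx').2 (congrArg Subtype.val h)
      exact Prod.ext (Fin.ext h1) h2
    · rintro ⟨x, hx⟩ _
      obtain ⟨p, c, hc, rfl⟩ := (hD x).1 hx
      have hcn : c < n + 1 := by have := hn p; have := hc.2; omega
      exact ⟨(⟨c, hcn⟩, p), by rw [Finset.mem_filter_univ]; exact hc, rfl⟩
    · rintro ⟨i, p⟩ hx
      have hact : T.Act i p := (Finset.mem_filter.1 hx).2
      simp only [letters, dif_pos hact, Option.elim_some, content_slideBox]
  · rintro ⟨i, p⟩ _ h
    by_contra hact
    simp only at hact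
    simp [letters, dif_neg hact] at h

end Fillings

end StripSystem

/-! ### Series over a finite alphabet -/

section Truncation

/-- The weight of a letter in a box of content `c`. -/
noncomputable def letterWeight (a : ℤ → ℂ) (c : ℤ) (m : MarkedNat) : ℂ := 1 / ((m.abs : ℕ) : ℂ) ^ a c

open Classical in
/-- The part of the series `ζ^Q` with letters in a finite set. -/
noncomputable def truncZeta (L : Finset MarkedNat) (a : ℤ → ℂ) (D : Finset Box) : ℂ :=
  ∑ t : D → L, if IsQTableau D (fun x => (t x).1) then
    ∏ x : D, letterWeight a (content x.1) (t x).1 else 0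

theorem truncZeta_empty (L : Finset MarkedNat) (a : ℤ → ℂ) : truncZeta L a ∅ = 1 := by
  unfold truncZeta
  rw [Fintype.sum_unique, if_pos]
  · simp
  · constructor <;> exact fun x => absurd x.2 (Finset.notMem_empty _)

/-- Primed letters of a finite alphabet. -/
def primedIn (L : Finset MarkedNat) (m : L) : Prop := m.1.IsPrimed

theorem rowRel_coe {L : Finset MarkedNat} {a b : L} :
    RowRel MarkedNat.IsPrimed a.1 b.1 ↔ RowRel (primedIn L) a b := by
  unfold RowRel primedIn
  rw [Subtype.coe_lt_coe, Subtype.coe_inj]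

theorem colRel_coe {L : Finset MarkedNat} {a b : L} :
    ColRel MarkedNat.IsPrimed a.1 b.1 ↔ ColRel (primedIn L) a b := by
  unfold ColRel primedIn
  rw [Subtype.coe_lt_coe, Subtype.coe_inj]

end Truncation

namespace StripSystem

variable {fromLeft : ℤ → Bool} {r : ℕ} {T : StripSystem (fun c : ℕ => fromLeft c) r}

/-- For boxes of consecutive contents the two positions exclude each other, and so do the two
relations; the two implications of `ContentTableau` therefore merge into one equivalence. -/
theorem contentTableau_iff {D : Finset Box} (hD : T.Describes D) (L : Finset MarkedNat)
    (t : D → L) (n : ℕ) (hn : ∀ p, T.β p < n + 1) : ContentTableau D (fun x => (t x).1) ↔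
      ∀ i : Fin n, T.Interlace (primedIn L) i (T.letters hD t i) (T.letters hD t (i + 1 : ℕ)) := by
  have taut : ∀ A B : Prop, ((A → B) ∧ (¬A → ¬B)) ↔ (B ↔ A) := by
    intro A B
    by_cases A <;> by_cases B <;> simp [*]
  have key : ∀ (c : ℕ) (p q : Fin r) (hp : slideBox fromLeft c (T.δ p) ∈ D)
      (hq : slideBox fromLeft (c + 1) (T.δ q) ∈ D),
      (((slideBox fromLeft c (T.δ p)).1 ≤ (slideBox fromLeft (c + 1) (T.δ q)).1 →
          RowRel MarkedNat.IsPrimed (t ⟨_, hp⟩).1 (t ⟨_, hq⟩).1) ∧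
        ((slideBox fromLeft (c + 1) (T.δ q)).1 < (slideBox fromLeft c (T.δ p)).1 →
          ColRel MarkedNat.IsPrimed (t ⟨_, hq⟩).1 (t ⟨_, hp⟩).1)) ↔
      (StepRel (primedIn L) (fromLeft ((c + 1 : ℕ) : ℤ)) (t ⟨_, hp⟩) (t ⟨_, hq⟩) ↔
        T.key c p ≤ T.key c q) := by
    intro c p q hp hq
    rw [← not_le, slideBox_fst_le_iff, rowRel_coe, colRel_coe, ← not_rowRel]
    unfold StepRel key
    split_ifs with hf
    · exact taut _ _
    · rw [← not_rowRel, neg_le_neg_iff, ← not_lt, not_iff_not]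
      exact taut _ _
  constructor
  · intro h i p q a b hp hq
    obtain ⟨hpa, rfl⟩ := letters_eq_some hD hp
    obtain ⟨hqa, rfl⟩ := letters_eq_some hD hq
    rw [← key]
    refine h ⟨_, _⟩ ⟨_, _⟩ ?_
    change content (slideBox fromLeft (i + 1) (T.δ q)) = content (slideBox fromLeft i (T.δ p)) + 1
    rw [content_slideBox, content_slideBox]
    push_cast
    ring
  · rintro h ⟨x, hx⟩ ⟨y, hy⟩ hxy
    obtain ⟨p, c, hc, rfl⟩ := (hD x).1 hx
    obtain ⟨q, c', hc', rfl⟩ := (hD y).1 hy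
    simp only [content_slideBox] at hxy
    obtain rfl : c' = c + 1 := by exact_mod_cast hxy
    have hcn : c < n := by have := hn q; have := hc'.2; omega
    refine (key c p q hx hy).2 (h ⟨c, hcn⟩ p q _ _ ?_ ?_)
    · simp only [letters, dif_pos hc]
    · simp only [letters, dif_pos hc']

open Classical in
/-- The truncated series of a shape as a sum of determinants over the letters of content `0`. -/
theorem truncZeta_eq_sum_det (hT : T.IsOutside) {D : Finset Box} (hD : T.Describes D)
    (hS : IsSkewShiftedShape D) (L : Finset MarkedNat) (a : ℤ → ℂ) :
    truncZeta L a D = ∑ u : Fin r → Option L,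
      if T.Valid 0 u ∧ T.Increasing u then
        weight (fun c m => letterWeight a c m.1) 0 u *
          (T.gram (primedIn L) (fun c m => letterWeight a c m.1) 0 u).det else 0 := by
  obtain ⟨n, hn⟩ : ∃ n : ℕ, ∀ p, T.β p < n + 1 := by
    refine ⟨Finset.univ.sup T.β, fun p => ?_⟩
    exact Nat.lt_succ_of_le (Finset.le_sup (Finset.mem_univ p))
  let w : ℕ → L → ℂ := fun c m => letterWeight a c m.1
  have h1 : truncZeta L a D =
      ∑ u : Fin r → Option L, if T.Valid 0 u then
        weight w 0 u * T.partialSum (primedIn L) w (n + 1) 0 u else 0 := by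
    rw [sum_partialSum_eq_sum_chain, ← Finset.sum_filter, truncZeta, ← Finset.sum_filter]
    have hn' : ∀ p, T.β p < (n + 1) + 1 := fun p => (hn p).trans (Nat.lt_succ_self _)
    refine Finset.sum_bij (fun t _ (i : Fin (n + 2)) => T.letters hD t i) ?_ ?_ ?_ ?_
    · intro t ht
      rw [Finset.mem_filter_univ] at ht ⊢
      rw [isQTableau_iff hS] at ht
      exact ⟨fun i => valid_letters hD t i, (contentTableau_iff hD L t (n + 1) hn').1 ht⟩
    · intro t _ t' _ h
      exact letters_injective hD (n + 1) hn' h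
    · intro V hV
      rw [Finset.mem_filter_univ] at hV
      obtain ⟨t, rfl⟩ := exists_letters hD hT (n + 1) V hn' hV.1
      refine ⟨t, ?_, rfl⟩
      rw [Finset.mem_filter_univ, isQTableau_iff hS]
      exact (contentTableau_iff hD L t (n + 1) hn').2 hV.2
    · intro t _
      exact (prod_weight_letters hD hT (n + 1) hn' (fun c (m : L) => letterWeight a c m.1) t).symm
  rw [h1]
  refine Finset.sum_congr rfl fun u _ => ?_
  by_cases hu : T.Valid 0 u
  · by_cases hi : T.Increasing u
    · rw [if_pos hu, if_pos ⟨hu, hi⟩, partialSum_eq_det _ _ hT _ _ _ hu hi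
        (fun p => by rw [zero_add]; exact hn p)]
    -- The depth `n + 1` leaves at least one step, and by `Interlace.increasing_left` no such step
    -- exists from letters that fail to increase.
    · rw [if_pos hu, if_neg (fun h => hi h.2), partialSum, Finset.sum_eq_zero, mul_zero]
      intro v _
      rw [if_neg]
      exact fun h => hi (h.2.increasing_left hT hu h.1)
  · rw [if_neg hu, if_neg (fun h => hu h.1)]

end StripSystem

/-! ### From outside decompositions to strip systems -/

section Geometry

/-- The parts drop by at least one from row to row, so the right ends of the rows never move right
going down. Hence each `shiftedDiagram` is closed towards the upper left, among boxes with positive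
row on or above the main diagonal, and a difference of two such sets is convex. -/
theorem isSkewShiftedShape_skewShiftedDiagram (l m : StrictPartition) :
    IsSkewShiftedShape (skewShiftedDiagram l m) := by
  have hmem : ∀ (l : StrictPartition) (x : Box), x ∈ shiftedDiagram l ↔ ∃ i : ℕ, i < l.parts.length ∧
      x.1 = i + 1 ∧ x.1 ≤ x.2 ∧ x.2 ≤ i + (l.parts.getD i 0 : ℕ) := by
    rintro l ⟨x1, x2⟩
    simp only [shiftedDiagram, Finset.mem_biUnion, Finset.mem_range, Finset.mem_image,
      Finset.mem_Icc, Prod.mk.injEq]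
    constructor
    · rintro ⟨i, hi, j, hj, rfl, rfl⟩
      exact ⟨i, hi, rfl, hj.1, hj.2⟩
    · rintro ⟨i, hi, rfl, h1, h2⟩
      exact ⟨i, hi, x2, ⟨h1, h2⟩, rfl, rfl⟩
  have hdown : ∀ (l : StrictPartition) (x y : Box), 1 ≤ x.1 → x.1 ≤ x.2 → x ≤ y →
      y ∈ shiftedDiagram l → x ∈ shiftedDiagram l := by
    intro l x y h1 h2 hxy hy
    rw [hmem] at hy ⊢
    obtain ⟨i, hi, h3, h4, h5⟩ := hy
    have h6 := hxy.1
    have h7 := hxy.2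
    have hle : (x.1 - 1).toNat ≤ i := by omega
    refine ⟨(x.1 - 1).toNat, by omega, by omega, h2, ?_⟩
    have hdec : ∀ d j : ℕ, j + d < l.parts.length →
        l.parts.getD (j + d) 0 + d ≤ l.parts.getD j 0 := by
      intro d
      induction d with
      | zero => intro j _; simp
      | succ d ih =>
        intro j hj
        have h8 := ih j (by omega)
        have h9 := List.pairwise_iff_getElem.1 l.strict (j + d) (j + (d + 1)) (by omega) hj (by omega)
        rw [List.getD_eq_getElem _ _ (by omega)] at h8 ⊢
        omega
    obtain ⟨d, rfl⟩ := Nat.exists_eq_add_of_le hle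
    have := hdec d _ hi
    omega
  refine ⟨fun x hx => ?_, fun x hx y hy z hz hxz hzy => ?_⟩
  · obtain ⟨i, _, _, h, _⟩ := (hmem l x).1 (Finset.mem_sdiff.1 hx).1
    exact h
  · rw [skewShiftedDiagram, Finset.mem_sdiff] at hx hy ⊢
    obtain ⟨i, _, h1, h2, _⟩ := (hmem l x).1 hx.1
    have h3 := hxz.1
    refine ⟨hdown l z y (by omega) hz hzy hy.1, fun h => hx.2 (hdown m x z (by omega) h2 hxz h)⟩

variable {fromLeft : ℤ → Bool}

theorem slideBox_succ_of_left {c : ℕ} (h : fromLeft ((c + 1 : ℕ) : ℤ) = true) (d : ℤ) :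
    slideBox fromLeft (c + 1) d = ((slideBox fromLeft c d).1, (slideBox fromLeft c d).2 + 1) := by
  simp only [slideBox]
  rw [ruleBox_succ, if_pos h]
  ext <;> simp only; ring

theorem slideBox_succ_of_below {c : ℕ} (h : fromLeft ((c + 1 : ℕ) : ℤ) = false) (d : ℤ) :
    slideBox fromLeft (c + 1) d = ((slideBox fromLeft c d).1 - 1, (slideBox fromLeft c d).2) := by
  simp only [slideBox]
  rw [ruleBox_succ, h]
  ext <;> simp; ring

theorem slideBox_fst_le_snd (c : ℕ) (d : ℤ) :
    (slideBox fromLeft c d).1 ≤ (slideBox fromLeft c d).2 := by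
  have := content_slideBox fromLeft c d
  unfold content at this
  omega

theorem slideBox_antitone_fst {c c' : ℕ} (h : c ≤ c') (d : ℤ) :
    (slideBox fromLeft c' d).1 ≤ (slideBox fromLeft c d).1 :=
  add_le_add_left (ruleBox_fst_antitone fromLeft h) d

theorem slideBox_monotone_snd {c c' : ℕ} (h : c ≤ c') (d : ℤ) :
    (slideBox fromLeft c d).2 ≤ (slideBox fromLeft c' d).2 :=
  add_le_add_left (ruleBox_snd_monotone fromLeft h) d

/-- A neighbour in a strip of a box on the infinite strip lies on the infinite strip as well. -/
theorem exists_slideBox_of_edgeAdjacent {S : Finset Box} (hS : IsSkewShiftedShape S)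
    (hleft : ∀ x ∈ S, (x.1, x.2 - 1) ∈ S → fromLeft (content x) = true)
    (hbelow : ∀ x ∈ S, (x.1 + 1, x.2) ∈ S → fromLeft (content x) = false)
    {c : ℕ} {d : ℤ} {v : Box} (hu : slideBox fromLeft c d ∈ S) (hv : v ∈ S)
    (hadj : EdgeAdjacent (slideBox fromLeft c d) v) :
    ∃ c', v = slideBox fromLeft c' d ∧ (c' = c + 1 ∨ c = c' + 1) := by
  have hcont := content_slideBox fromLeft c d
  have hprev : content v + 1 = c → ∃ c', c = c' + 1 := by
    intro h
    have := hS.1 v hv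
    unfold content at h
    exact ⟨c - 1, by omega⟩
  obtain ⟨v1, v2⟩ := v
  unfold content at hcont
  rcases hadj with ⟨h1, h2⟩ | ⟨h1, h2⟩
  · rcases (abs_eq zero_le_one).1 h2 with h3 | h3
    · obtain ⟨c', rfl⟩ := hprev (by simp only [content] at *; omega)
      have hf := hleft _ hu (by convert hv using 2; simp only at h3; omega)
      rw [content_slideBox] at hf
      refine ⟨c', ?_, Or.inr rfl⟩
      rw [slideBox_succ_of_left hf] at h1 h3
      simp only at h1 h3
      ext <;> simp only <;> omega
    · have hf := hleft _ hv (by convert hu using 1; ext <;> simp only at * <;> omega)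
      have hc : content (v1, v2) = ((c + 1 : ℕ) : ℤ) := by
        simp only [content] at *; push_cast; omega
      rw [hc] at hf
      refine ⟨c + 1, ?_, Or.inl rfl⟩
      rw [slideBox_succ_of_left hf]
      ext <;> simp only at * <;> omega
  · rcases (abs_eq zero_le_one).1 h2 with h3 | h3
    · have hf := hbelow _ hv (by convert hu using 1; ext <;> simp only at * <;> omega)
      have hc : content (v1, v2) = ((c + 1 : ℕ) : ℤ) := by
        simp only [content] at *; push_cast; omega
      rw [hc] at hf
      refine ⟨c + 1, ?_, Or.inl rfl⟩
      rw [slideBox_succ_of_below hf]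
      ext <;> simp only at * <;> omega
    · obtain ⟨c', rfl⟩ := hprev (by simp only [content] at *; omega)
      have hf := hbelow _ hu (by convert hv using 2; simp only at h3; omega)
      rw [content_slideBox] at hf
      refine ⟨c', ?_, Or.inr rfl⟩
      rw [slideBox_succ_of_below hf] at h1 h3
      simp only at h1 h3
      ext <;> simp only <;> omega

/-- A strip is a piece of the infinite strip. -/
theorem IsStrip.exists_slideBox {S : Finset Box} (hS : IsStrip S)
    (hleft : ∀ x ∈ S, (x.1, x.2 - 1) ∈ S → fromLeft (content x) = true)
    (hbelow : ∀ x ∈ S, (x.1 + 1, x.2) ∈ S → fromLeft (content x) = false) :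
    ∃ (α β : ℕ) (δ : ℤ), α ≤ β ∧
      ∀ x, x ∈ S ↔ ∃ c, (α ≤ c ∧ c ≤ β) ∧ x = slideBox fromLeft c δ := by
  obtain ⟨x₀, hx₀⟩ := hS.nonempty
  obtain ⟨δ, hδ⟩ := exists_eq_slideBox fromLeft (hS.shape.1 x₀ hx₀)
  -- A path of edge neighbours keeps the slide and changes the content by one at a time, so it
  -- passes through all contents in between.
  have key : ∀ (c₁ : ℕ), slideBox fromLeft c₁ δ ∈ S → ∀ y ∈ S, ∃ c₂, y = slideBox fromLeft c₂ δ ∧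
      ∀ c, (c₁ ≤ c ∧ c ≤ c₂ ∨ c₂ ≤ c ∧ c ≤ c₁) → slideBox fromLeft c δ ∈ S := by
    intro c₁ h₁ y hy
    have hpath := hS.connected _ h₁ y hy
    clear hy
    induction hpath with
    | refl =>
      refine ⟨c₁, rfl, fun c hc => ?_⟩
      obtain rfl : c = c₁ := by omega
      exact h₁
    | tail hab hbc ih =>
      obtain ⟨c₃, rfl, h₃⟩ := ih
      obtain ⟨c₂, rfl, h₂⟩ := exists_slideBox_of_edgeAdjacent hS.shape hleft hbelow
        (h₃ c₃ (by omega)) hbc.1 hbc.2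
      refine ⟨c₂, rfl, fun c hc => ?_⟩
      rcases eq_or_ne c c₂ with rfl | hne
      · exact hbc.1
      · exact h₃ c (by omega)
  have hC : (S.image fun x => (content x).toNat).Nonempty := hS.nonempty.image _
  set C := S.image fun x => (content x).toNat with hCdef
  have hx₀' : slideBox fromLeft (content x₀).toNat δ ∈ S := hδ ▸ hx₀
  have hmem : ∀ c ∈ C, slideBox fromLeft c δ ∈ S := by
    intro c hc
    obtain ⟨x, hx, rfl⟩ := Finset.mem_image.1 hc
    obtain ⟨c₂, rfl, _⟩ := key _ hx₀' x hx
    rw [content_slideBox]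
    exact hx
  refine ⟨C.min' hC, C.max' hC, δ, C.min'_le_max' hC, fun x => ⟨fun hx => ?_, ?_⟩⟩
  · obtain ⟨c, rfl, _⟩ := key _ hx₀' x hx
    have hc : c ∈ C := Finset.mem_image.2 ⟨_, hx, by rw [content_slideBox]; simp⟩
    exact ⟨c, ⟨C.min'_le c hc, C.le_max' c hc⟩, rfl⟩
  · rintro ⟨c, hc, rfl⟩
    obtain ⟨c₂, h₂, h⟩ := key _ (hmem _ (C.min'_mem hC)) _ (hmem _ (C.max'_mem hC))
    obtain ⟨h₂, -⟩ := slideBox_injective fromLeft h₂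
    exact h c (Or.inl ⟨hc.1, h₂ ▸ hc.2⟩)

/-- An outside decomposition is a system of strips. -/
theorem IsOutsideDecomposition.exists_stripSystem {D : Finset Box} {r : ℕ} {θ : Fin r → Finset Box}
    (hθ : IsOutsideDecomposition D θ) (hrule : IsApproachRule D θ fromLeft)
    (hD : IsSkewShiftedShape D) :
    ∃ T : StripSystem (fun c : ℕ => fromLeft c) r, T.IsOutside ∧ T.Describes D ∧
      ∀ p x, x ∈ θ p ↔ ∃ c, T.Act c p ∧ x = slideBox fromLeft c (T.δ p) := by
  have h := fun p => (hθ.strip p).exists_slideBox (fromLeft := fromLeft) (hrule.left p)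
    (hrule.below p)
  choose α β δ hle hmem using h
  let T : StripSystem (fun c : ℕ => fromLeft c) r := ⟨α, β, δ, hle⟩
  have hmemT : ∀ p x, x ∈ θ p ↔ ∃ c, T.Act c p ∧ x = slideBox fromLeft c (T.δ p) := hmem
  have hDθ : ∀ x, x ∈ D ↔ ∃ p, x ∈ θ p := by
    intro x
    rw [← hθ.union]
    simp
  have hdesc : T.Describes D := by
    intro x
    rw [hDθ]
    simp only [hmemT]
  have hbox : ∀ {c p}, T.Act c p → slideBox fromLeft c (T.δ p) ∈ D :=
    fun {c p} h => (hdesc _).2 ⟨p, c, h, rfl⟩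
  have hstart : ∀ p, IsStartingBox (θ p) (slideBox fromLeft (T.α p) (T.δ p)) := by
    intro p
    refine ⟨(hmemT _ _).2 ⟨_, ⟨le_rfl, T.le p⟩, rfl⟩, fun y hy => ?_⟩
    obtain ⟨c, hc, rfl⟩ := (hmemT _ _).1 hy
    exact ⟨slideBox_antitone_fst hc.1 _, slideBox_monotone_snd hc.1 _⟩
  -- If `q` started right after a box of another strip with the same slide, that box of `D` would
  -- lie on the side from which the starting box is approached; but then the rule assigns the other
  -- direction.
  have hne1 : ∀ c p q, T.Act c p → T.Act (c + 1) q → T.δ p = T.δ q → p = q := by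
    intro c p q hp hq hδ
    by_contra hpq
    by_cases hqc : T.Act c q
    · have h1 := (hmemT p _).2 ⟨c, hp, rfl⟩
      have h2 := (hmemT q _).2 ⟨c, hqc, rfl⟩
      rw [← hδ] at h2
      exact Finset.disjoint_left.1 (hθ.disjoint p q hpq) h1 h2
    · have hα : T.α q = c + 1 := by unfold StripSystem.Act at hq hqc; omega
      have hs := hstart q
      have hx := hbox hp
      rw [hα, ← hδ] at hs
      cases hf : fromLeft ((c + 1 : ℕ) : ℤ)
      · have h1 := hrule.start_left q _ hs (by
          rw [slideBox_succ_of_below hf]; simpa using hx)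
        rw [content_slideBox, hf] at h1
        exact Bool.false_ne_true h1
      · have h1 := hrule.start_below q _ hs (by
          rw [slideBox_succ_of_left hf]; simpa using hx)
        rw [content_slideBox, hf] at h1
        exact Bool.false_ne_true h1.symm
  have hne0 : ∀ c p q, T.Act c p → T.Act c q → T.δ p = T.δ q → p = q := by
    intro c p q hp hq hδ
    by_contra hpq
    have h1 := (hmemT p _).2 ⟨c, hp, rfl⟩
    have h2 := (hmemT q _).2 ⟨c, hq, rfl⟩
    rw [← hδ] at h2
    exact Finset.disjoint_left.1 (hθ.disjoint p q hpq) h1 h2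
  have hbefore : ∀ c p, T.α p = c + 1 → slideBox fromLeft c (T.δ p) ∉ D := by
    intro c p hp h
    obtain ⟨p', c', h1, h2⟩ := (hdesc _).1 h
    obtain ⟨rfl, h3⟩ := slideBox_injective fromLeft h2
    have := hne1 c p' p h1 ⟨hp.le, hp ▸ T.le p⟩ h3.symm
    subst this
    have := h1.1
    omega
  have hafter : ∀ c p, T.β p = c → slideBox fromLeft (c + 1) (T.δ p) ∉ D := by
    intro c p hp h
    obtain ⟨p', c', h1, h2⟩ := (hdesc _).1 h
    obtain ⟨rfl, h3⟩ := slideBox_injective fromLeft h2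
    have := hne1 c p p' ⟨hp ▸ T.le p, hp.ge⟩ h1 h3
    subst this
    have := h1.2
    omega
  have hshift : ∀ c d d', slideBox fromLeft c d' =
      ((slideBox fromLeft c d).1 + (d' - d), (slideBox fromLeft c d).2 + (d' - d)) := by
    intro c d d'
    simp only [slideBox]
    ext <;> simp only <;> ring
  refine ⟨T, ⟨?_, ?_, ?_⟩, hdesc, hmemT⟩
  · rintro c p q hpq (hp | hp) (hq | hq) hδ
    · exact hpq (hne0 c p q hp hq hδ)
    · exact hpq (hne1 c p q hp hq hδ)
    · exact hpq (hne1 c q p hq hp hδ.symm).symm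
    · exact hpq (hne0 (c + 1) p q hp hq hδ)
  -- If `q` had a smaller key, the box before the start of `p` on the infinite strip would lie
  -- between that start and a box of `q`, hence in `D` by convexity, against `hbefore`.
  · intro c p q hp hq
    by_contra hkey
    rw [not_le] at hkey
    apply hbefore c p hp
    have hy : slideBox fromLeft (c + 1) (T.δ p) ∈ D := hbox ⟨hp.le, hp ▸ T.le p⟩
    unfold StripSystem.key at hkey
    cases hf : fromLeft ((c + 1 : ℕ) : ℤ)
    · simp only [hf] at hkey
      have hlt : T.δ p < T.δ q := by simpa using hkey
      rcases hq with hq | hq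
      · refine hD.2 _ hy _ (hbox hq) _ (slideBox_fst_le_snd _ _) ?_ ?_
        · rw [slideBox_succ_of_below hf]
          exact ⟨by dsimp only; omega, le_rfl⟩
        · rw [hshift c (T.δ p) (T.δ q)]
          exact ⟨by dsimp only; omega, by dsimp only; omega⟩
      · refine hD.2 _ hy _ (hbox hq) _ (slideBox_fst_le_snd _ _) ?_ ?_
        · rw [slideBox_succ_of_below hf]
          exact ⟨by dsimp only; omega, le_rfl⟩
        · rw [slideBox_succ_of_below hf, hshift c (T.δ p) (T.δ q)]
          exact ⟨by dsimp only; omega, by dsimp only; omega⟩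
    · simp only [hf, if_true] at hkey
      rcases hq with hq | hq
      · refine hD.2 _ (hbox hq) _ hy _ (slideBox_fst_le_snd _ _) ?_ ?_
        · rw [hshift c (T.δ p) (T.δ q)]
          exact ⟨by dsimp only; omega, by dsimp only; omega⟩
        · rw [slideBox_succ_of_left hf]
          exact ⟨le_rfl, by dsimp only; omega⟩
      · refine hD.2 _ (hbox hq) _ hy _ (slideBox_fst_le_snd _ _) ?_ ?_
        · rw [slideBox_succ_of_left hf, hshift c (T.δ p) (T.δ q)]
          exact ⟨by dsimp only; omega, by dsimp only; omega⟩
        · rw [slideBox_succ_of_left hf]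
          exact ⟨le_rfl, by dsimp only; omega⟩
  -- The same argument with the box after the end of `p`, against `hafter`.
  · intro c p q hp hq
    by_contra hkey
    rw [not_le] at hkey
    apply hafter c p hp
    have hx : slideBox fromLeft c (T.δ p) ∈ D := hbox ⟨hp ▸ T.le p, hp.ge⟩
    unfold StripSystem.key at hkey
    cases hf : fromLeft ((c + 1 : ℕ) : ℤ)
    · simp only [hf] at hkey
      have hlt : T.δ q < T.δ p := by simpa using hkey
      rcases hq with hq | hq
      · refine hD.2 _ (hbox hq) _ hx _ (slideBox_fst_le_snd _ _) ?_ ?_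
        · rw [slideBox_succ_of_below hf, hshift c (T.δ p) (T.δ q)]
          exact ⟨by dsimp only; omega, by dsimp only; omega⟩
        · rw [slideBox_succ_of_below hf]
          exact ⟨by dsimp only; omega, le_rfl⟩
      · refine hD.2 _ (hbox hq) _ hx _ (slideBox_fst_le_snd _ _) ?_ ?_
        · rw [hshift (c + 1) (T.δ p) (T.δ q)]
          exact ⟨by dsimp only; omega, by dsimp only; omega⟩
        · rw [slideBox_succ_of_below hf]
          exact ⟨by dsimp only; omega, le_rfl⟩
    · simp only [hf, if_true] at hkey
      rcases hq with hq | hq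
      · refine hD.2 _ hx _ (hbox hq) _ (slideBox_fst_le_snd _ _) ?_ ?_
        · rw [slideBox_succ_of_left hf]
          exact ⟨le_rfl, by dsimp only; omega⟩
        · rw [slideBox_succ_of_left hf, hshift c (T.δ p) (T.δ q)]
          exact ⟨by dsimp only; omega, by dsimp only; omega⟩
      · refine hD.2 _ hx _ (hbox hq) _ (slideBox_fst_le_snd _ _) ?_ ?_
        · rw [slideBox_succ_of_left hf]
          exact ⟨le_rfl, by dsimp only; omega⟩
        · rw [hshift (c + 1) (T.δ p) (T.δ q)]
          exact ⟨by dsimp only; omega, by dsimp only; omega⟩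

end Geometry

/-! ### Letters on the main diagonal as increasing words -/

namespace StripSystem

open Classical in
/-- The sum over the letters of content `0` as a sum over strictly increasing sequences. -/
theorem sum_valid_eq_sum_strictMono {fl : ℕ → Bool} {r k : ℕ} (T : StripSystem fl r) (hk : k ≤ r)
    (hα : ∀ p : Fin r, T.α p = 0 ↔ (p : ℕ) < k)
    (hδ : ∀ p q : Fin r, p < q → (q : ℕ) < k → T.δ p < T.δ q)
    {Λ K : Type*} [LinearOrder Λ] [Fintype Λ] [CommRing K] (pr : Λ → Prop) (w : ℕ → Λ → K) :
    (∑ u : Fin r → Option Λ, if T.Valid 0 u ∧ T.Increasing u then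
        weight w 0 u * (T.gram pr w 0 u).det else 0) =
      ∑ v : Fin k → Λ with StrictMono v, (Matrix.of fun p : Fin r =>
        if hp : (p : ℕ) < k then fun q => w 0 (v ⟨p, hp⟩) * tailSum pr w fl 0 (v ⟨p, hp⟩) (T.β q)
        else fun q => fullSum pr w fl (T.α p) (T.β q)).det := by
  have hact : ∀ p, T.Act 0 p ↔ (p : ℕ) < k := by
    intro p
    rw [← hα]
    unfold Act
    omega
  rw [← Finset.sum_filter]
  let U : (Fin k → Λ) → Fin r → Option Λ := fun v p =>
    if hp : (p : ℕ) < k then some (v ⟨p, hp⟩) else none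
  have hU : ∀ v, T.Valid 0 (U v) := by
    intro v p
    rw [hact]
    simp only [U]
    split_ifs with h <;> simp [h]
  have hUi : ∀ v, T.Increasing (U v) ↔ StrictMono v := by
    intro v
    constructor
    · intro h i j hij
      have hi : (i : ℕ) < r := i.2.trans_le hk
      have hj : (j : ℕ) < r := j.2.trans_le hk
      refine h ⟨i, hi⟩ ⟨j, hj⟩ _ _ ?_ ?_ (hδ ⟨i, hi⟩ ⟨j, hj⟩ hij j.2)
      · simp [U]
      · simp [U]
    · intro h p q a b hp hq hpq
      simp only [U] at hp hq
      split_ifs at hp hq with hp' hq'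
      rw [← Option.some_injective _ hp, ← Option.some_injective _ hq]
      apply h
      rw [Fin.mk_lt_mk]
      by_contra hle
      rcases (not_lt.1 hle).eq_or_lt with he | hlt
      · have : q = p := Fin.ext he
        subst this
        exact lt_irrefl _ hpq
      · exact lt_asymm hpq (hδ q p hlt hp')
  symm
  refine Finset.sum_bij (fun v _ => U v) ?_ ?_ ?_ ?_
  · intro v hv
    rw [Finset.mem_filter_univ] at hv ⊢
    exact ⟨hU v, (hUi v).2 hv⟩
  · intro v _ v' _ h
    funext i
    have := congrFun h ⟨i, i.2.trans_le hk⟩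
    simpa [U] using this
  · intro u hu
    rw [Finset.mem_filter_univ] at hu
    have hsome : ∀ i : Fin k, ∃ a, u ⟨i, i.2.trans_le hk⟩ = some a := by
      intro i
      rw [← Option.isSome_iff_exists, hu.1, hact]
      exact i.2
    choose v hv using hsome
    have hUv : U v = u := by
      funext p
      simp only [U]
      split_ifs with hp
      · exact (hv ⟨p, hp⟩).symm
      · symm
        rw [← Option.not_isSome_iff_eq_none, hu.1, hact]
        exact hp
    refine ⟨v, ?_, hUv⟩
    rw [Finset.mem_filter_univ, ← hUi, hUv]
    exact hu.2
  · intro v _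
    rw [weight, ← Matrix.det_mul_column]
    congr 1
    ext p q
    simp only [Matrix.of_apply, gram, U]
    split_ifs with hp
    · simp [rowVec]
    · simp [rowVec]

end StripSystem

/-! ### Single strips -/

section RuleStrips

variable {fromLeft : ℤ → Bool}

/-- Along the infinite strip rows weakly decrease while columns weakly increase. One of the two
coordinates therefore compares the slides. -/
theorem slideBox_le_slideBox {c c' : ℕ} {d d' : ℤ}
    (h : slideBox fromLeft c d ≤ slideBox fromLeft c' d') : d ≤ d' := by
  have h1 := h.1
  have h2 := h.2
  simp only [slideBox] at h1 h2
  rcases le_total c c' with hc | hc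
  · have := ruleBox_fst_antitone fromLeft hc
    simp only at this
    omega
  · have := ruleBox_snd_monotone fromLeft hc
    simp only at this
    omega

theorem mem_ruleStrip (a b : ℕ) (x : Box) : x ∈ ruleStrip fromLeft a b ↔
    ∃ c, (a ≤ c ∧ c ≤ b) ∧ x = slideBox fromLeft c 0 := by
  simp only [ruleStrip, Finset.mem_image, Finset.mem_Icc]
  constructor
  · rintro ⟨c, hc, rfl⟩
    refine ⟨c.toNat, by omega, ?_⟩
    have : (c.toNat : ℤ) = c := Int.toNat_of_nonneg (by omega)
    simp [slideBox, this]
  · rintro ⟨c, hc, rfl⟩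
    exact ⟨c, by omega, by simp [slideBox]⟩

/-- The piece of the infinite strip with contents `a, …, b`, moved `d` steps along the diagonal. -/
theorem isSkewShiftedShape_slide {S : Finset Box} {a b : ℕ} {d : ℤ}
    (hS : ∀ x, x ∈ S ↔ ∃ c, (a ≤ c ∧ c ≤ b) ∧ x = slideBox fromLeft c d) : IsSkewShiftedShape S := by
  refine ⟨fun x hx => ?_, fun x hx y hy z hz hxz hzy => ?_⟩
  · obtain ⟨c, _, rfl⟩ := (hS x).1 hx
    exact slideBox_fst_le_snd _ _
  · obtain ⟨cx, hcx, rfl⟩ := (hS x).1 hx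
    obtain ⟨cy, hcy, rfl⟩ := (hS y).1 hy
    obtain ⟨dz, hdz⟩ := exists_eq_slideBox fromLeft hz
    generalize (content z).toNat = cz at hdz
    subst hdz
    -- The slide of a box in between is squeezed; the monotone coordinates, whose difference is the
    -- content, then squeeze its content too.
    obtain rfl : dz = d := le_antisymm (slideBox_le_slideBox hzy) (slideBox_le_slideBox hxz)
    refine (hS _).2 ⟨cz, ?_, rfl⟩
    have e1 := content_ruleBox fromLeft cz
    have h1 := hxz.1
    have h2 := hxz.2
    have h3 := hzy.1
    have h4 := hzy.2
    simp only [slideBox] at h1 h2 h3 h4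
    unfold content at e1
    constructor
    · by_contra hlt
      have e2 := content_ruleBox fromLeft (min cx cy)
      unfold content at e2
      have m1 := ruleBox_snd_monotone fromLeft (show cz ≤ min cx cy by omega)
      have m2 := ruleBox_snd_monotone fromLeft (min_le_left cx cy)
      have m3 := ruleBox_fst_antitone fromLeft (show cz ≤ min cx cy by omega)
      have m4 := ruleBox_fst_antitone fromLeft (min_le_right cx cy)
      simp only at m1 m2 m3 m4
      omega
    · by_contra hlt
      have e2 := content_ruleBox fromLeft (max cx cy)
      unfold content at e2
      have m1 := ruleBox_snd_monotone fromLeft (show max cx cy ≤ cz by omega)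
      have m2 := ruleBox_snd_monotone fromLeft (le_max_right cx cy)
      have m3 := ruleBox_fst_antitone fromLeft (show max cx cy ≤ cz by omega)
      have m4 := ruleBox_fst_antitone fromLeft (le_max_left cx cy)
      simp only at m1 m2 m3 m4
      omega

/-- The system that consists of one strip. -/
def singleSystem (fl : ℕ → Bool) (a b : ℕ) (d : ℤ) (h : a ≤ b) : StripSystem fl 1 :=
  ⟨fun _ => a, fun _ => b, fun _ => d, fun _ => h⟩

theorem isOutside_singleSystem (fl : ℕ → Bool) (a b : ℕ) (d : ℤ) (h : a ≤ b) :
    (singleSystem fl a b d h).IsOutside := by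
  refine ⟨fun c p q hpq => absurd (Subsingleton.elim p q) hpq, fun c p q _ _ => ?_,
    fun c p q _ _ => ?_⟩
  · rw [Subsingleton.elim p q]
  · rw [Subsingleton.elim p q]

/-- The weights of the letters of a finite alphabet. -/
noncomputable def weightIn (L : Finset MarkedNat) (a : ℤ → ℂ) (c : ℕ) (m : L) : ℂ :=
  letterWeight a c m.1

/-- The generating function of the strips of contents `0, …, b` that start with a given letter. -/
noncomputable def startSum (L : Finset MarkedNat) (fromLeft : ℤ → Bool) (a : ℤ → ℂ) (b : ℕ)
    (m : L) : ℂ :=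
  weightIn L a 0 m * StripSystem.tailSum (primedIn L) (weightIn L a) (fun c : ℕ => fromLeft c) 0 m b

theorem truncZeta_eq_sum_strictMono {r k : ℕ} {T : StripSystem (fun c : ℕ => fromLeft c) r}
    (hT : T.IsOutside) {D : Finset Box} (hD : T.Describes D) (hS : IsSkewShiftedShape D)
    (hk : k ≤ r) (hα : ∀ p : Fin r, T.α p = 0 ↔ (p : ℕ) < k)
    (hδ : ∀ p q : Fin r, p < q → (q : ℕ) < k → T.δ p < T.δ q) (L : Finset MarkedNat) (a : ℤ → ℂ)
    [DecidablePred fun v : Fin k → L => StrictMono v] :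
    truncZeta L a D = ∑ v : Fin k → L with StrictMono v, (Matrix.of fun p : Fin r =>
        if hp : (p : ℕ) < k then fun q => startSum L fromLeft a (T.β q) (v ⟨p, hp⟩)
        else fun q => StripSystem.fullSum (primedIn L) (weightIn L a) (fun c : ℕ => fromLeft c)
          (T.α p) (T.β q)).det := by
  rw [StripSystem.truncZeta_eq_sum_det hT hD hS]
  refine (T.sum_valid_eq_sum_strictMono hk hα hδ (primedIn L) (weightIn L a)).trans ?_
  congr

/-- The general determinant formula for one strip, where the determinant has size one. It evaluates
the entries next to the empty strip. -/
theorem truncZeta_slide_zero {S : Finset Box} {b : ℕ} {d : ℤ}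
    (hS : ∀ x, x ∈ S ↔ ∃ c, c ≤ b ∧ x = slideBox fromLeft c d) (L : Finset MarkedNat) (a : ℤ → ℂ) :
    truncZeta L a S = ∑ m, startSum L fromLeft a b m := by
  classical
  have hS' : ∀ x, x ∈ S ↔ ∃ c, (0 ≤ c ∧ c ≤ b) ∧ x = slideBox fromLeft c d := by
    intro x; rw [hS]; simp
  let T := singleSystem (fun c : ℕ => fromLeft c) 0 b d (Nat.zero_le b)
  have hD : T.Describes S := by
    intro x
    rw [hS']
    exact ⟨fun ⟨c, h⟩ => ⟨0, c, h⟩, fun ⟨_, c, h⟩ => ⟨c, h⟩⟩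
  rw [truncZeta_eq_sum_strictMono (k := 1) (isOutside_singleSystem _ 0 b d (Nat.zero_le b)) hD
    (isSkewShiftedShape_slide hS') le_rfl (fun p => iff_of_true rfl p.2)
    (fun p q hpq => absurd hpq (by rw [Subsingleton.elim p q]; exact lt_irrefl _))]
  rw [Finset.filter_true_of_mem (fun v _ => Subsingleton.strictMono v),
    ← (Equiv.funUnique (Fin 1) L).symm.sum_comp]
  refine Finset.sum_congr rfl fun m _ => ?_
  rw [Matrix.det_unique]
  rfl

theorem truncZeta_ruleStrip {b c : ℕ} (hb : 0 < b) (hbc : b ≤ c) (L : Finset MarkedNat)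
    (a : ℤ → ℂ) : truncZeta L a (ruleStrip fromLeft b c) =
      StripSystem.fullSum (primedIn L) (weightIn L a) (fun c : ℕ => fromLeft c) b c := by
  classical
  have hS := mem_ruleStrip (fromLeft := fromLeft) b c
  let T := singleSystem (fun c : ℕ => fromLeft c) b c 0 hbc
  have hD : T.Describes (ruleStrip fromLeft b c) := by
    intro x
    rw [hS]
    exact ⟨fun ⟨c, h⟩ => ⟨0, c, h⟩, fun ⟨_, c, h⟩ => ⟨c, h⟩⟩
  rw [truncZeta_eq_sum_strictMono (k := 0) (isOutside_singleSystem _ b c 0 hbc) hD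
    (isSkewShiftedShape_slide hS) (Nat.zero_le _) (fun p => iff_of_false hb.ne' (Nat.not_lt_zero _))
    (fun p q _ h => absurd h (Nat.not_lt_zero _))]
  rw [Finset.filter_true_of_mem (fun v _ => Subsingleton.strictMono v), Fintype.sum_unique,
    Matrix.det_unique]
  rfl

end RuleStrips

/-! ### Juxtaposed pairs of strips -/

section Pairs

variable {fromLeft : ℤ → Bool}

theorem mem_juxtapose_ruleStrip (b b' : ℕ) (x : Box) :
    x ∈ juxtapose (ruleStrip fromLeft 0 b) (ruleStrip fromLeft 0 b') ↔
      (∃ c, c ≤ b ∧ x = slideBox fromLeft c 0) ∨ ∃ c, c ≤ b' ∧ x = slideBox fromLeft c 1 := by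
  have h : ∀ (b : ℕ) (x : Box), x ∈ ruleStrip fromLeft 0 b ↔
      ∃ c, c ≤ b ∧ x = slideBox fromLeft c 0 := by
    intro b x
    have := mem_ruleStrip (fromLeft := fromLeft) 0 b x
    simpa using this
  unfold juxtapose
  rw [Finset.mem_union, h, Finset.mem_image]
  refine or_congr Iff.rfl ?_
  constructor
  · rintro ⟨y, hy, rfl⟩
    obtain ⟨c, hc, rfl⟩ := (h b' y).1 hy
    exact ⟨c, hc, by simp [slideBox]⟩
  · rintro ⟨c, hc, rfl⟩
    exact ⟨slideBox fromLeft c 0, (h b' _).2 ⟨c, hc, rfl⟩, by simp [slideBox]⟩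

/-- The condition for the juxtaposition of the strips of contents `0, …, b` and `0, …, b'` to be a
shape: the first box after the end of the shorter one is approached from the side of the longer
one. -/
def PairFits (fromLeft : ℤ → Bool) (b b' : ℕ) : Prop :=
  (b' < b → fromLeft ((b' + 1 : ℕ) : ℤ) = true) ∧ (b < b' → fromLeft ((b + 1 : ℕ) : ℤ) = false)

/-- With the wrong direction, the missing box that would extend the shorter strip lies between two
boxes of the pair. -/
theorem pairFits_of_shape {b b' : ℕ}
    (hS : IsSkewShiftedShape (juxtapose (ruleStrip fromLeft 0 b) (ruleStrip fromLeft 0 b'))) :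
    PairFits fromLeft b b' := by
  constructor
  · intro hlt
    by_contra hf
    have hf : fromLeft ((b' + 1 : ℕ) : ℤ) = false := by simpa using hf
    have hx := (mem_juxtapose_ruleStrip (fromLeft := fromLeft) b b' _).2 (Or.inl ⟨b' + 1, hlt, rfl⟩)
    have hy := (mem_juxtapose_ruleStrip (fromLeft := fromLeft) b b' _).2 (Or.inr ⟨b', le_rfl, rfl⟩)
    have hz := hS.2 _ hx _ hy (slideBox fromLeft (b' + 1) 1) (slideBox_fst_le_snd _ _)
      ⟨by simp [slideBox], by simp [slideBox]⟩
      (by rw [slideBox_succ_of_below hf]; exact ⟨by simp, le_rfl⟩)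
    rcases (mem_juxtapose_ruleStrip (fromLeft := fromLeft) b b' _).1 hz with ⟨c, _, h⟩ | ⟨c, hc, h⟩
    · exact one_ne_zero (slideBox_injective fromLeft h).2
    · have := (slideBox_injective fromLeft h).1
      omega
  · intro hlt
    by_contra hf
    have hf : fromLeft ((b + 1 : ℕ) : ℤ) = true := by simpa using hf
    have hx := (mem_juxtapose_ruleStrip (fromLeft := fromLeft) b b' _).2 (Or.inl ⟨b, le_rfl, rfl⟩)
    have hy := (mem_juxtapose_ruleStrip (fromLeft := fromLeft) b b' _).2 (Or.inr ⟨b + 1, hlt, rfl⟩)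
    have hz := hS.2 _ hx _ hy (slideBox fromLeft (b + 1) 0) (slideBox_fst_le_snd _ _)
      (by rw [slideBox_succ_of_left hf]; exact ⟨le_rfl, by simp⟩)
      ⟨by simp [slideBox], by simp [slideBox]⟩
    rcases (mem_juxtapose_ruleStrip (fromLeft := fromLeft) b b' _).1 hz with ⟨c, hc, h⟩ | ⟨c, _, h⟩
    · have := (slideBox_injective fromLeft h).1
      omega
    · exact zero_ne_one (slideBox_injective fromLeft h).2

theorem shape_of_pairFits {b b' : ℕ} (hne : b ≠ b') (h : PairFits fromLeft b b') :
    IsSkewShiftedShape (juxtapose (ruleStrip fromLeft 0 b) (ruleStrip fromLeft 0 b')) := by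
  have hS := mem_juxtapose_ruleStrip (fromLeft := fromLeft) b b'
  have hS' : ∀ x, x ∈ juxtapose (ruleStrip fromLeft 0 b) (ruleStrip fromLeft 0 b') ↔
      ∃ (c : ℕ) (d : ℤ), (d = 0 ∧ c ≤ b ∨ d = 1 ∧ c ≤ b') ∧ x = slideBox fromLeft c d := by
    intro x
    rw [hS]
    constructor
    · rintro (⟨c, hc, rfl⟩ | ⟨c, hc, rfl⟩)
      · exact ⟨c, 0, Or.inl ⟨rfl, hc⟩, rfl⟩
      · exact ⟨c, 1, Or.inr ⟨rfl, hc⟩, rfl⟩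
    · rintro ⟨c, d, ⟨rfl, hc⟩ | ⟨rfl, hc⟩, rfl⟩
      · exact Or.inl ⟨c, hc, rfl⟩
      · exact Or.inr ⟨c, hc, rfl⟩
  refine ⟨fun x hx => ?_, fun x hx y hy z hz hxz hzy => ?_⟩
  · obtain ⟨c, d, _, rfl⟩ := (hS' x).1 hx
    exact slideBox_fst_le_snd _ _
  · obtain ⟨cx, dx, hcx, rfl⟩ := (hS' x).1 hx
    obtain ⟨cy, dy, hcy, rfl⟩ := (hS' y).1 hy
    obtain ⟨dz, hdz⟩ := exists_eq_slideBox fromLeft hz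
    generalize (content z).toNat = cz at hdz
    subst hdz
    have l1 := slideBox_le_slideBox hxz
    have l2 := slideBox_le_slideBox hzy
    have h1 := hxz.1
    have h2 := hxz.2
    have h3 := hzy.1
    have h4 := hzy.2
    simp only [slideBox] at h1 h2 h3 h4
    refine (hS' _).2 ⟨cz, dz, ?_, rfl⟩
    have hanti := ruleBox_fst_antitone fromLeft
    have hmono := ruleBox_snd_monotone fromLeft
    have econt := content_ruleBox fromLeft
    unfold content at econt
    rcases (by omega : dz = 0 ∨ dz = 1) with rfl | rfl
    · refine Or.inl ⟨rfl, ?_⟩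
      by_contra hlt
      rw [not_le] at hlt
      have hcx' : cx ≤ b := by omega
      have m1 := hanti hlt.le
      have m2 := hanti hcx'
      have m3 := hmono hlt.le
      have e1 := econt b
      have e2 := econt cz
      simp only at m1 m2 m3
      rcases hcy with ⟨rfl, hcy⟩ | ⟨rfl, hcy⟩
      · have m4 := hmono hcy
        simp only at m4
        omega
      · rcases lt_or_gt_of_ne hne with hbb | hbb
        · have hf := h.2 hbb
          have r1 := ruleBox_succ fromLeft b
          rw [hf] at r1
          have m5 := hanti (show b + 1 ≤ cz from hlt)
          simp only at m5
          rw [r1] at m5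
          simp only [Bool.false_eq_true, if_false] at m5
          omega
        · have hf := h.1 hbb
          have r1 := ruleBox_succ fromLeft b'
          rw [if_pos hf] at r1
          have m4 := hmono hcy
          have m5 := hmono (show b' + 1 ≤ b from hbb)
          simp only at m4 m5
          rw [r1] at m5
          simp only at m5
          omega
    · refine Or.inr ⟨rfl, ?_⟩
      by_contra hlt
      rw [not_le] at hlt
      have hdy : dy = 1 := by omega
      have hcy' : cy ≤ b' := by omega
      subst hdy
      have m1 := hmono hlt.le
      have m2 := hmono hcy'
      have m3 := hanti hlt.le
      have e1 := econt b'
      have e2 := econt cz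
      simp only at m1 m2 m3
      rcases hcx with ⟨rfl, hcx⟩ | ⟨rfl, hcx⟩
      · rcases lt_or_gt_of_ne hne with hbb | hbb
        · have hf := h.2 hbb
          have r1 := ruleBox_succ fromLeft b
          rw [hf] at r1
          have m4 := hanti hcx
          have m5 := hanti (show b + 1 ≤ b' from hbb)
          simp only at m4 m5
          rw [r1] at m5
          simp only [Bool.false_eq_true, if_false] at m5
          omega
        · have hf := h.1 hbb
          have r1 := ruleBox_succ fromLeft b'
          rw [if_pos hf] at r1
          have m5 := hmono (show b' + 1 ≤ cz from hlt)
          simp only at m5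
          rw [r1] at m5
          simp only at m5
          omega
      · have m4 := hanti hcx
        simp only at m4
        omega

/-- The system of two strips that start on the main diagonal. -/
def pairSystem (fl : ℕ → Bool) (b b' : ℕ) : StripSystem fl 2 :=
  ⟨fun _ => 0, ![b, b'], ![0, 1], fun _ => Nat.zero_le _⟩

/-- `PairFits` says precisely that the strip that ends earlier has the greater key at its end; both
strips start at content `0`, where nothing is required. -/
theorem isOutside_pairSystem {b b' : ℕ} (hne : b ≠ b') (h : PairFits fromLeft b b') :
    (pairSystem (fun c : ℕ => fromLeft c) b b').IsOutside := by
  refine ⟨fun c p q hpq _ _ => ?_, fun c p q hp => ?_, fun c p q hp hq => ?_⟩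
  · fin_cases p <;> fin_cases q <;> simp_all [pairSystem]
  · exact absurd hp (Nat.succ_ne_zero c).symm
  · have hq' : c ≤ (pairSystem (fun c : ℕ => fromLeft c) b b').β q := by
      unfold StripSystem.Near StripSystem.Act at hq
      omega
    fin_cases p <;> fin_cases q
    · exact le_rfl
    · have hp' : b = c := hp
      subst hp'
      have hq'' : b ≤ b' := hq'
      have hf := h.2 (lt_of_le_of_ne hq'' hne)
      simp [StripSystem.key, pairSystem] at *
      simp [hf]
    · have hp' : b' = c := hp
      subst hp'
      have hq'' : b' ≤ b := hq'
      have hf := h.1 (lt_of_le_of_ne hq'' hne.symm)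
      simp [StripSystem.key, pairSystem] at *
      simp [hf]
    · exact le_rfl

theorem sum_strictMono_fin_two {Λ : Type*} [LinearOrder Λ] [Fintype Λ] (f g : Λ → ℂ)
    [DecidablePred fun v : Fin 2 → Λ => StrictMono v] :
    ∑ v : Fin 2 → Λ with StrictMono v, (f (v 0) * g (v 1) - g (v 0) * f (v 1)) =
      ∑ m, ∑ m', orderSign ℂ m m' * (f m * g m') := by
  have hmono : ∀ v : Fin 2 → Λ, StrictMono v ↔ v 0 < v 1 := by
    intro v
    rw [Fin.strictMono_iff_lt_succ]
    simp [Fin.forall_fin_one]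
  rw [Finset.sum_filter, ← (finTwoArrowEquiv Λ).symm.sum_comp, Fintype.sum_prod_type]
  have h1 : ∀ x y : Λ, (if StrictMono ((finTwoArrowEquiv Λ).symm (x, y)) then
      (f ((finTwoArrowEquiv Λ).symm (x, y) 0) * g ((finTwoArrowEquiv Λ).symm (x, y) 1) -
        g ((finTwoArrowEquiv Λ).symm (x, y) 0) * f ((finTwoArrowEquiv Λ).symm (x, y) 1)) else 0) =
      (if x < y then f x * g y else 0) - (if x < y then f y * g x else 0) := by
    intro x y
    have : StrictMono ((finTwoArrowEquiv Λ).symm (x, y)) ↔ x < y := by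
      rw [hmono]; simp
    simp only [this]
    split_ifs
    · simp; ring
    · simp
  simp only [h1, Finset.sum_sub_distrib]
  rw [Finset.sum_comm (f := fun x y => if x < y then f y * g x else 0)]
  simp only [← Finset.sum_sub_distrib]
  refine Finset.sum_congr rfl fun x _ => Finset.sum_congr rfl fun y _ => ?_
  unfold orderSign
  rcases lt_trichotomy x y with h | rfl | h
  · simp [h, h.not_gt]
  · simp
  · simp [h, h.not_gt]

/-- The determinant formula for two strips: the sum of the `2 × 2` determinants over `m < m'` is the
antisymmetric form of the two vectors of letters. -/
theorem truncZeta_juxtapose {b b' : ℕ} (hne : b ≠ b') (h : PairFits fromLeft b b')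
    (L : Finset MarkedNat) (a : ℤ → ℂ) :
    truncZeta L a (juxtapose (ruleStrip fromLeft 0 b) (ruleStrip fromLeft 0 b')) =
      ∑ m, ∑ m', orderSign ℂ m m' *
        (startSum L fromLeft a b m * startSum L fromLeft a b' m') := by
  classical
  have hD : (pairSystem (fun c : ℕ => fromLeft c) b b').Describes
      (juxtapose (ruleStrip fromLeft 0 b) (ruleStrip fromLeft 0 b')) := by
    intro x
    rw [mem_juxtapose_ruleStrip, Fin.exists_fin_two]
    simp [pairSystem, StripSystem.Act]
  rw [truncZeta_eq_sum_strictMono (k := 2) (isOutside_pairSystem hne h) hD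
    (shape_of_pairFits hne h) le_rfl (fun p => iff_of_true rfl p.2), ← sum_strictMono_fin_two]
  · refine Finset.sum_congr rfl fun v _ => ?_
    rw [Matrix.det_fin_two]
    simp [pairSystem]
  · intro p q hpq _
    fin_cases p <;> fin_cases q <;> simp_all [pairSystem]

end Pairs

/-! ### The additional letter and coordinate for an odd number of diagonal strips -/

section Augmentation

variable {Λ : Type*} [LinearOrder Λ] [Fintype Λ]

omit [LinearOrder Λ] in
theorem sum_withBot {M : Type*} [AddCommMonoid M] (F : WithBot Λ → M) :
    ∑ m, F m = F ⊥ + ∑ m : Λ, F m := Fintype.sum_option F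

/-- The vectors of the letters, with an additional smallest letter and `e` additional coordinates
that only the new letter has. -/
def augmentVectors {r : ℕ} (e : ℕ) (f : Λ → Fin r → ℂ) (m : WithBot Λ) (p : Fin (r + e)) : ℂ :=
  if h : (p : ℕ) < e then (if m = ⊥ then 1 else 0)
  else WithBot.recBotCoe (C := fun _ => ℂ) 0 (fun m => f m ⟨p - e, by omega⟩) m

/-- The matrix `B` with `e` additional vanishing rows. -/
def augmentMatrix {r d : ℕ} (e : ℕ) (B : Fin r → Fin d → ℂ) : Matrix (Fin (r + e)) (Fin d) ℂ :=
  Matrix.of fun p c => if h : (p : ℕ) < e then 0 else B ⟨p - e, by omega⟩ c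

-- The additional column has its only nonzero entry, a `1`, in the row of the new letter.
omit [Fintype Λ] in
theorem det_letterMatrix_augment_one {r k : ℕ} (hR : k + 1 + (r - k) = r + 1)
    (f : Λ → Fin r → ℂ) (B : Fin r → Fin (r - k) → ℂ)
    (v : Fin k → Λ) :
    (letterMatrix hR (augmentVectors 1 f) (augmentMatrix 1 B)
        (Fin.cons (⊥ : WithBot Λ) (fun i => ((v i : Λ) : WithBot Λ)))).det =
      (Matrix.of fun p : Fin r =>
        if hp : (p : ℕ) < k then f (v ⟨p, hp⟩)
        else fun q => B q ⟨r - 1 - p, by omega⟩).det := by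
  have hlt : ((0 : Fin (r + 1)) : ℕ) < 1 := Nat.zero_lt_one
  rw [Matrix.det_succ_column_zero, Finset.sum_eq_single 0]
  · have h1 : letterMatrix hR (augmentVectors 1 f) (augmentMatrix 1 B)
        (Fin.cons (⊥ : WithBot Λ) (fun i => ((v i : Λ) : WithBot Λ))) 0 0 = 1 := by
      rw [letterMatrix, Matrix.of_apply, dif_pos (show ((0 : Fin (r + 1)) : ℕ) < k + 1 from Nat.succ_pos k), augmentVectors, dif_pos hlt]
      exact if_pos rfl
    rw [h1, Fin.val_zero, pow_zero, one_mul, one_mul]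
    congr 1
    ext p q
    rw [Matrix.submatrix_apply, Fin.zero_succAbove, letterMatrix, Matrix.of_apply, Matrix.of_apply]
    have hq : ¬ ((q.succ : Fin (r + 1)) : ℕ) < 1 := by simp
    by_cases hp : (p : ℕ) < k
    · have hp' : ((p.succ : Fin (r + 1)) : ℕ) < k + 1 := by simpa using hp
      rw [dif_pos hp, dif_pos hp', augmentVectors, dif_neg hq]
      rfl
    · have hp' : ¬ ((p.succ : Fin (r + 1)) : ℕ) < k + 1 := by simpa using hp
      rw [dif_neg hp, dif_neg hp', augmentMatrix, Matrix.of_apply, dif_neg hq]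
      congr 1
      apply Fin.ext
      simp only [Fin.val_succ]
      omega
  · intro p _ hp
    have h1 : letterMatrix hR (augmentVectors 1 f) (augmentMatrix 1 B)
        (Fin.cons (⊥ : WithBot Λ) (fun i => ((v i : Λ) : WithBot Λ))) p 0 = 0 := by
      obtain ⟨p, rfl⟩ := Fin.exists_succ_eq.2 hp
      by_cases hp : ((p.succ : Fin (r + 1)) : ℕ) < k + 1
      · rw [letterMatrix, Matrix.of_apply, dif_pos hp, augmentVectors, dif_pos hlt, if_neg]
        exact WithBot.coe_ne_bot
      · rw [letterMatrix, Matrix.of_apply, dif_neg hp, augmentMatrix, Matrix.of_apply, dif_pos hlt]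
    rw [h1, mul_zero, zero_mul]
  · simp

-- With the new coordinate, the determinant vanishes unless the new letter occurs, and being the
-- smallest it then comes first. Without that coordinate, the new letter has a zero row and cannot
-- occur.
open Classical in
theorem sum_det_letterMatrix_augment {r k e : ℕ} (hk : k ≤ r) (he : e = 0 ∨ e = 1)
    (hR : k + e + (r - k) = r + e) (f : Λ → Fin r → ℂ) (B : Fin r → Fin (r - k) → ℂ) :
    ∑ u : Fin (k + e) → WithBot Λ with StrictMono u,
        (letterMatrix hR (augmentVectors e f) (augmentMatrix e B) u).det =
      ∑ v : Fin k → Λ with StrictMono v, (Matrix.of fun p : Fin r =>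
        if hp : (p : ℕ) < k then f (v ⟨p, hp⟩)
        else fun q => B q ⟨r - 1 - p, by omega⟩).det := by
  symm
  rcases he with rfl | rfl
  · refine Finset.sum_bij_ne_zero (fun v _ _ i => ((v i : Λ) : WithBot Λ)) ?_ ?_ ?_ ?_
    · intro v hv _
      rw [Finset.mem_filter_univ] at hv ⊢
      exact WithBot.coe_strictMono.comp hv
    · intro v _ _ v' _ _ h
      funext i
      exact WithBot.coe_injective (congrFun h i)
    · intro u hu hne
      rw [Finset.mem_filter_univ] at hu
      have hbot : ∀ i, u i ≠ ⊥ := by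
        intro i hi
        apply hne
        apply Matrix.det_eq_zero_of_row_eq_zero ⟨i, by omega⟩
        intro q
        have : ((⟨i, by omega⟩ : Fin (r + 0)) : ℕ) < k + 0 := i.2
        rw [letterMatrix, Matrix.of_apply, dif_pos this, augmentVectors, dif_neg (Nat.not_lt_zero _)]
        have h2 : u ⟨((⟨i, by omega⟩ : Fin (r + 0)) : ℕ), this⟩ = ⊥ := hi
        rw [h2]
        rfl
      choose v hv using fun i => WithBot.ne_bot_iff_exists.1 (hbot i)
      have huv : (fun i => ((v i : Λ) : WithBot Λ)) = u := funext hv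
      refine ⟨v, ?_, ?_, huv⟩
      · rw [Finset.mem_filter_univ]
        intro i j hij
        have := hu hij
        rw [← hv, ← hv] at this
        exact WithBot.coe_lt_coe.1 this
      · rw [← huv] at hne
        exact hne
    · intro v _ _
      congr 1
  · refine Finset.sum_bij_ne_zero (fun v _ _ =>
      Fin.cons (⊥ : WithBot Λ) (fun i => ((v i : Λ) : WithBot Λ))) ?_ ?_ ?_ ?_
    · intro v hv _
      rw [Finset.mem_filter_univ] at hv ⊢
      intro i j hij
      induction i using Fin.cases with
      | zero =>
        obtain ⟨j, rfl⟩ := Fin.exists_succ_eq.2 (Fin.pos_iff_ne_zero.1 hij)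
        simp
      | succ i =>
        obtain ⟨j, rfl⟩ := Fin.exists_succ_eq.2 (Fin.pos_iff_ne_zero.1 (lt_of_le_of_lt (Fin.zero_le _) hij))
        simpa using hv (Fin.succ_lt_succ_iff.1 hij)
    · intro v _ _ v' _ _ h
      funext i
      have := congrFun h i.succ
      simp only [Fin.cons_succ] at this
      exact WithBot.coe_injective this
    · intro u hu hne
      rw [Finset.mem_filter_univ] at hu
      have h0 : u 0 = ⊥ := by
        by_contra h0
        apply hne
        apply Matrix.det_eq_zero_of_column_eq_zero 0
        intro p
        have hlt : ((0 : Fin (r + 1)) : ℕ) < 1 := Nat.zero_lt_one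
        by_cases hp : (p : ℕ) < k + 1
        · rw [letterMatrix, Matrix.of_apply, dif_pos hp, augmentVectors, dif_pos hlt, if_neg]
          intro h
          have := hu.monotone (Fin.zero_le ⟨p, hp⟩)
          rw [h] at this
          exact h0 (le_bot_iff.1 this)
        · rw [letterMatrix, Matrix.of_apply, dif_neg hp, augmentMatrix, Matrix.of_apply,
            dif_pos hlt]
      have hbot : ∀ i : Fin k, u i.succ ≠ ⊥ := by
        intro i
        have := hu (Fin.succ_pos i)
        exact (lt_of_le_of_lt bot_le this).ne'
      choose v hv using fun i => WithBot.ne_bot_iff_exists.1 (hbot i)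
      have huv : Fin.cons (⊥ : WithBot Λ) (fun i => ((v i : Λ) : WithBot Λ)) = u := by
        funext i
        induction i using Fin.cases with
        | zero => exact h0.symm
        | succ i => exact hv i
      refine ⟨v, ?_, ?_, huv⟩
      · rw [Finset.mem_filter_univ]
        intro i j hij
        have := hu (Fin.succ_lt_succ_iff.2 hij)
        rw [← hv, ← hv] at this
        exact WithBot.coe_lt_coe.1 this
      · rw [← huv, det_letterMatrix_augment_one hR] at hne
        exact hne
    · intro v _ _
      exact (det_letterMatrix_augment_one hR f B v).symm

end Augmentation

/-! ### Evaluation of the entries of the block matrix -/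

section Entries

variable {fromLeft : ℤ → Bool}

/-- The box of content `0` is `(0, 0)`. -/
theorem slideBox_zero (d : ℤ) : slideBox fromLeft 0 d = (d, d) := by
  simp [slideBox, ruleBox]

theorem slide_nonempty {S : Finset Box} {a b : ℕ} {d : ℤ} (h : a ≤ b)
    (hS : ∀ x, x ∈ S ↔ ∃ c, (a ≤ c ∧ c ≤ b) ∧ x = slideBox fromLeft c d) : S.Nonempty :=
  ⟨_, (hS _).2 ⟨a, ⟨le_rfl, h⟩, rfl⟩⟩

theorem slide_inf_content {S : Finset Box} {a b : ℕ} {d : ℤ} (h : a ≤ b)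
    (hS : ∀ x, x ∈ S ↔ ∃ c, (a ≤ c ∧ c ≤ b) ∧ x = slideBox fromLeft c d) (hne : S.Nonempty) :
    S.inf' hne content = a := by
  apply le_antisymm
  · exact (Finset.inf'_le content ((hS _).2 ⟨a, ⟨le_rfl, h⟩, rfl⟩)).trans
      (content_slideBox fromLeft a d).le
  · refine Finset.le_inf' _ _ fun x hx => ?_
    obtain ⟨c, hc, rfl⟩ := (hS x).1 hx
    rw [content_slideBox]
    exact_mod_cast hc.1

theorem slide_sup_content {S : Finset Box} {a b : ℕ} {d : ℤ} (h : a ≤ b)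
    (hS : ∀ x, x ∈ S ↔ ∃ c, (a ≤ c ∧ c ≤ b) ∧ x = slideBox fromLeft c d) (hne : S.Nonempty) :
    S.sup' hne content = b := by
  apply le_antisymm
  · refine Finset.sup'_le _ _ fun x hx => ?_
    obtain ⟨c, hc, rfl⟩ := (hS x).1 hx
    rw [content_slideBox]
    exact_mod_cast hc.2
  · exact (content_slideBox fromLeft b d).ge.trans
      (Finset.le_sup' content ((hS _).2 ⟨b, ⟨h, le_rfl⟩, rfl⟩))

theorem stripHash_slide {S T : Finset Box} {a b a' b' : ℕ} {d d' : ℤ} (h : a ≤ b) (h' : a' ≤ b')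
    (hS : ∀ x, x ∈ S ↔ ∃ c, (a ≤ c ∧ c ≤ b) ∧ x = slideBox fromLeft c d)
    (hT : ∀ x, x ∈ T ↔ ∃ c, (a' ≤ c ∧ c ≤ b') ∧ x = slideBox fromLeft c d') :
    stripHash fromLeft S T = if a' ≤ b + 1 then some (ruleStrip fromLeft a' b) else none := by
  have hSn := slide_nonempty h hS
  have hTn := slide_nonempty h' hT
  rw [stripHash, dif_pos ⟨hSn, hTn⟩, slide_inf_content h' hT, slide_sup_content h hS]
  norm_cast

theorem extendStrip_empty : extendStrip fromLeft ∅ = ∅ := by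
  simp [extendStrip, stripHash]

theorem extendStrip_slide {S : Finset Box} {a b : ℕ} {d : ℤ} (h : a ≤ b)
    (hS : ∀ x, x ∈ S ↔ ∃ c, (a ≤ c ∧ c ≤ b) ∧ x = slideBox fromLeft c d) :
    extendStrip fromLeft S = ruleStrip fromLeft 0 b := by
  have hT : ∀ x : Box, x ∈ ({(0, 0)} : Finset Box) ↔
      ∃ c : ℕ, (0 ≤ c ∧ c ≤ 0) ∧ x = slideBox fromLeft c 0 := by
    intro x
    rw [Finset.mem_singleton]
    constructor
    · rintro rfl
      exact ⟨0, ⟨le_rfl, le_rfl⟩, (slideBox_zero 0).symm⟩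
    · rintro ⟨c, hc, rfl⟩
      rw [Nat.le_zero.1 hc.2, slideBox_zero]
  rw [extendStrip, stripHash_slide h le_rfl hS hT, if_pos (Nat.zero_le _)]
  rfl

open Classical in
/-- The value of a function of shapes on the pair `(P, Q)`, with the sign of the juxtaposition. -/
noncomputable def pairEntry (Z : Finset Box → ℂ) (P Q : Finset Box) : ℂ :=
  if IsSkewShiftedShape (juxtapose P Q) then Z (pairShape P Q) else -Z (pairShape P Q)

/-- The value of a function of shapes on `S # T`, or `0` if that is undefined. -/
noncomputable def hashEntry (fromLeft : ℤ → Bool) (Z : Finset Box → ℂ) (S T : Finset Box) : ℂ :=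
  (stripHash fromLeft S T).elim 0 Z

/-- The antisymmetric block of a function of shapes. -/
noncomputable def pairMatrix {r : ℕ} (k : ℕ) (θ : Fin r → Finset Box) (fromLeft : ℤ → Bool)
    (Z : Finset Box → ℂ) : Matrix (Fin (r + k % 2)) (Fin (r + k % 2)) ℂ :=
  Matrix.of fun p q =>
    if p < q then
      pairEntry Z (extendStrip fromLeft (augment k θ p)) (extendStrip fromLeft (augment k θ q))
    else if q < p then
      -pairEntry Z (extendStrip fromLeft (augment k θ q)) (extendStrip fromLeft (augment k θ p))
    else 0

/-- The other block of a function of shapes. -/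
noncomputable def hashMatrix {r : ℕ} (k : ℕ) (θ : Fin r → Finset Box) (fromLeft : ℤ → Bool)
    (Z : Finset Box → ℂ) : Matrix (Fin (r + k % 2)) (Fin (r - k)) ℂ :=
  Matrix.of fun i c => hashEntry fromLeft Z (augment k θ i) (columnStrip k θ c)

theorem hamelMatrix_eq_skewBlock {r k : ℕ} (hk : k ≤ r) (θ : Fin r → Finset Box) (a : ℤ → ℂ) :
    hamelMatrix hk θ fromLeft a = skewBlock (hamelSize hk)
      (pairMatrix k θ fromLeft fun S => zetaQ S (diagFilling a S))
      (hashMatrix k θ fromLeft fun S => zetaQ S (diagFilling a S)) := by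
  have h : hashBlock k θ fromLeft a =
      hashMatrix k θ fromLeft fun S => zetaQ S (diagFilling a S) := by
    ext i c
    simp only [hashBlock, hashMatrix, hashEntry, hashZeta, Matrix.of_apply]
    cases stripHash fromLeft (augment k θ i) (columnStrip k θ c) <;> rfl
  rw [hamelMatrix, h]
  rfl

theorem hashEntry_truncZeta {S T : Finset Box} {a b a' b' : ℕ} {d d' : ℤ} (h : a ≤ b)
    (h' : a' ≤ b') (hS : ∀ x, x ∈ S ↔ ∃ c, (a ≤ c ∧ c ≤ b) ∧ x = slideBox fromLeft c d)
    (hT : ∀ x, x ∈ T ↔ ∃ c, (a' ≤ c ∧ c ≤ b') ∧ x = slideBox fromLeft c d') (ha' : 0 < a')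
    (L : Finset MarkedNat) (w : ℤ → ℂ) :
    hashEntry fromLeft (truncZeta L w) S T =
      StripSystem.fullSum (primedIn L) (weightIn L w) (fun c : ℕ => fromLeft c) a' b := by
  rw [hashEntry, stripHash_slide h h' hS hT]
  by_cases h1 : a' ≤ b
  · rw [if_pos (h1.trans (Nat.le_succ b))]
    exact truncZeta_ruleStrip ha' h1 L w
  by_cases h2 : a' = b + 1
  · rw [if_pos h2.le, StripSystem.fullSum, if_neg h1, if_pos h2]
    have h3 : ruleStrip fromLeft a' b = ∅ := by
      rw [ruleStrip, Finset.Icc_eq_empty (by exact_mod_cast h1), Finset.image_empty]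
    simp only [Option.elim]
    rw [h3, truncZeta_empty]
  · rw [if_neg (by omega), StripSystem.fullSum, if_neg h1, if_neg h2]
    rfl

theorem pairEntry_empty_truncZeta (b : ℕ) (L : Finset MarkedNat) (w : ℤ → ℂ) :
    pairEntry (truncZeta L w) ∅ (ruleStrip fromLeft 0 b) = ∑ m, startSum L fromLeft w b m := by
  have hS : ∀ x, x ∈ juxtapose ∅ (ruleStrip fromLeft 0 b) ↔
      ∃ c, c ≤ b ∧ x = slideBox fromLeft c 1 := by
    intro x
    simp only [juxtapose, Finset.empty_union, Finset.mem_image]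
    constructor
    · rintro ⟨y, hy, rfl⟩
      obtain ⟨c, hc, rfl⟩ := (mem_ruleStrip 0 b y).1 hy
      refine ⟨c, hc.2, ?_⟩
      simp [slideBox]
    · rintro ⟨c, hc, rfl⟩
      refine ⟨slideBox fromLeft c 0, (mem_ruleStrip 0 b _).2 ⟨c, ⟨Nat.zero_le _, hc⟩, rfl⟩, ?_⟩
      simp [slideBox]
  have hshape : IsSkewShiftedShape (juxtapose ∅ (ruleStrip fromLeft 0 b)) :=
    isSkewShiftedShape_slide (fromLeft := fromLeft) (a := 0) (b := b) (d := 1) (by simpa using hS)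
  rw [pairEntry, pairShape, if_pos hshape, if_pos hshape]
  exact truncZeta_slide_zero hS L w

/-- The direction at the first content after the shorter strip admits one order of the pair. In the
other order the sign in `pairEntry` is the antisymmetry of the form. -/
theorem pairEntry_truncZeta {b b' : ℕ} (hne : b ≠ b') (L : Finset MarkedNat) (w : ℤ → ℂ) :
    pairEntry (truncZeta L w) (ruleStrip fromLeft 0 b) (ruleStrip fromLeft 0 b') =
      ∑ m, ∑ m', orderSign ℂ m m' *
        (startSum L fromLeft w b m * startSum L fromLeft w b' m') := by
  rw [pairEntry, pairShape]
  by_cases hS : IsSkewShiftedShape (juxtapose (ruleStrip fromLeft 0 b) (ruleStrip fromLeft 0 b'))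
  · rw [if_pos hS, if_pos hS]
    exact truncZeta_juxtapose hne (pairFits_of_shape hS) L w
  · have hfits : PairFits fromLeft b' b := by
      by_contra h
      refine hS (shape_of_pairFits hne ?_)
      unfold PairFits at h ⊢
      rcases lt_or_gt_of_ne hne with h1 | h1
      · refine ⟨fun h2 => absurd h2 h1.not_gt, fun _ => ?_⟩
        by_contra h3
        exact h ⟨fun _ => by simpa using h3, fun h2 => absurd h2 h1.not_gt⟩
      · refine ⟨fun _ => ?_, fun h2 => absurd h2 h1.not_gt⟩
        by_contra h3
        exact h ⟨fun h2 => absurd h2 h1.not_gt, fun _ => by simpa using h3⟩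
    rw [if_neg hS, if_neg hS, truncZeta_juxtapose hne.symm hfits, Finset.sum_comm,
      ← Finset.sum_neg_distrib]
    refine Finset.sum_congr rfl fun m _ => ?_
    rw [← Finset.sum_neg_distrib]
    refine Finset.sum_congr rfl fun m' _ => ?_
    rw [orderSign_antisymm m' m]
    ring

end Entries

/-! ### The pfaffian identity over a finite alphabet -/

section FiniteIdentity

variable {fromLeft : ℤ → Bool}

theorem augment_eq_empty {r k : ℕ} (θ : Fin r → Finset Box) {p : Fin (r + k % 2)}
    (h : (p : ℕ) < k % 2) : augment k θ p = ∅ := dif_pos h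

theorem augment_eq_strip {r k : ℕ} (θ : Fin r → Finset Box) {p : Fin (r + k % 2)}
    (h : ¬ (p : ℕ) < k % 2) : augment k θ p = θ ⟨p - k % 2, by omega⟩ := dif_neg h

variable {r : ℕ} {T : StripSystem (fun c : ℕ => fromLeft c) r} {θ : Fin r → Finset Box}

/-- The empty strip corresponds to the new letter, which is below all others, so that its order
signs are all `1` and only the sum over a single strip remains. Distinct strips have distinct ends,
as `pairEntry_truncZeta` requires. -/
theorem pairMatrix_truncZeta (hT : T.IsOutside)
    (hθ : ∀ p x, x ∈ θ p ↔ ∃ c, T.Act c p ∧ x = slideBox fromLeft c (T.δ p)) (k : ℕ)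
    (L : Finset MarkedNat) (a : ℤ → ℂ) :
    pairMatrix k θ fromLeft (truncZeta L a) =
      letterForm (augmentVectors (k % 2) fun (m : L) q => startSum L fromLeft a (T.β q) m) := by
  set g := augmentVectors (k % 2) fun (m : L) q => startSum L fromLeft a (T.β q) m with hg
  have hext : ∀ p, extendStrip fromLeft (θ p) = ruleStrip fromLeft 0 (T.β p) :=
    fun p => extendStrip_slide (T.le p) (hθ p)
  have key : ∀ p q : Fin (r + k % 2), p < q →
      pairEntry (truncZeta L a) (extendStrip fromLeft (augment k θ p))
        (extendStrip fromLeft (augment k θ q)) = letterForm g p q := by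
    intro p q hpq
    have hq : ¬ (q : ℕ) < k % 2 := by
      have : (p : ℕ) < q := hpq
      omega
    rw [augment_eq_strip θ hq, hext, letterForm, Matrix.of_apply, sum_withBot]
    have hgq : ∀ m : L, g m q = startSum L fromLeft a (T.β ⟨q - k % 2, by omega⟩) m := fun m => by
      rw [hg, augmentVectors, dif_neg hq]
      rfl
    have hgq' : g ⊥ q = 0 := by
      rw [hg, augmentVectors, dif_neg hq]
      rfl
    by_cases hp : (p : ℕ) < k % 2
    · have hgp : ∀ m : L, g m p = 0 := fun m => by
        rw [hg, augmentVectors, dif_pos hp, if_neg WithBot.coe_ne_bot]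
      have hgp' : g ⊥ p = 1 := by
        rw [hg, augmentVectors, dif_pos hp, if_pos rfl]
      rw [augment_eq_empty θ hp, extendStrip_empty, pairEntry_empty_truncZeta]
      have h0 : ∀ m : L, ∑ m', orderSign ℂ (m : WithBot L) m' * (g m p * g m' q) = 0 := by
        intro m
        refine Finset.sum_eq_zero fun m' _ => ?_
        rw [hgp, zero_mul, mul_zero]
      rw [Finset.sum_eq_zero fun m _ => h0 m, add_zero, sum_withBot, hgq', mul_zero, mul_zero,
        zero_add]
      refine Finset.sum_congr rfl fun m _ => ?_
      rw [hgp', one_mul, hgq, orderSign, if_pos (WithBot.bot_lt_coe m), one_mul]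
    · have hgp : ∀ m : L, g m p = startSum L fromLeft a (T.β ⟨p - k % 2, by omega⟩) m :=
        fun m => by
        rw [hg, augmentVectors, dif_neg hp]
        rfl
      have hgp' : g ⊥ p = 0 := by
        rw [hg, augmentVectors, dif_neg hp]
        rfl
      rw [augment_eq_strip θ hp, hext, pairEntry_truncZeta]
      · have h0 : ∑ m', orderSign ℂ ⊥ m' * (g ⊥ p * g m' q) = 0 :=
          Finset.sum_eq_zero fun m' _ => by rw [hgp', zero_mul, mul_zero]
        rw [h0, zero_add]
        refine Finset.sum_congr rfl fun m _ => ?_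
        rw [sum_withBot, hgq', mul_zero, mul_zero, zero_add]
        refine Finset.sum_congr rfl fun m' _ => ?_
        rw [orderSign_strictMono WithBot.coe_strictMono, hgp, hgq]
      · intro h
        have := congrArg Fin.val (hT.ending_unique h)
        have hpq' : (p : ℕ) < q := hpq
        simp only at this
        omega
  ext p q
  rw [pairMatrix, Matrix.of_apply]
  rcases lt_trichotomy p q with h | rfl | h
  · rw [if_pos h, key p q h]
  · rw [if_neg (lt_irrefl _), if_neg (lt_irrefl _)]
    exact (self_eq_neg.1 (letterForm_antisymm g p p)).symm
  · rw [if_neg h.not_gt, if_pos h, key q p h, letterForm_antisymm g p q]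

theorem hashMatrix_truncZeta
    (hθ : ∀ p x, x ∈ θ p ↔ ∃ c, T.Act c p ∧ x = slideBox fromLeft c (T.δ p)) {k : ℕ}
    (hα : ∀ p : Fin r, T.α p = 0 ↔ (p : ℕ) < k) (L : Finset MarkedNat) (a : ℤ → ℂ) :
    hashMatrix k θ fromLeft (truncZeta L a) = augmentMatrix (k % 2) fun q (c : Fin (r - k)) =>
      StripSystem.fullSum (primedIn L) (weightIn L a) (fun c : ℕ => fromLeft c)
        (T.α ⟨r - 1 - c, by omega⟩) (T.β q) := by
  ext i c
  rw [hashMatrix, augmentMatrix, Matrix.of_apply, Matrix.of_apply]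
  by_cases hi : (i : ℕ) < k % 2
  · rw [dif_pos hi, augment_eq_empty θ hi, hashEntry, stripHash, dif_neg (by simp)]
    rfl
  · rw [dif_neg hi, augment_eq_strip θ hi]
    refine hashEntry_truncZeta (T.le _) (T.le _) (hθ _) (hθ _) ?_ L a
    refine Nat.pos_of_ne_zero fun h => ?_
    have := (hα _).1 h
    simp only at this
    omega

/-- Both sides are sums over increasing letters on the main diagonal of one and the same
determinant: the left by the determinant formula, the right by minor summation after removal of the
new letter. -/
theorem truncZeta_eq_pfaffian (hT : T.IsOutside) {D : Finset Box} (hD : T.Describes D)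
    (hS : IsSkewShiftedShape D)
    (hθ : ∀ p x, x ∈ θ p ↔ ∃ c, T.Act c p ∧ x = slideBox fromLeft c (T.δ p)) {k : ℕ} (hk : k ≤ r)
    (hα : ∀ p : Fin r, T.α p = 0 ↔ (p : ℕ) < k)
    (hδ : ∀ p q : Fin r, p < q → (q : ℕ) < k → T.δ p < T.δ q) (L : Finset MarkedNat)
    (a : ℤ → ℂ) :
    truncZeta L a D = pfaffian (skewBlock (hamelSize hk) (pairMatrix k θ fromLeft (truncZeta L a))
      (hashMatrix k θ fromLeft (truncZeta L a))) := by
  classical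
  have hR : k + k % 2 + (r - k) = r + k % 2 := by omega
  rw [pairMatrix_truncZeta hT hθ, hashMatrix_truncZeta hθ hα,
    pfaffian_skewBlock_letterForm (k := k + k % 2) (r - k) (hamelSize hk) hR,
    truncZeta_eq_sum_strictMono hT hD hS hk hα hδ]
  refine Eq.trans ?_ (Eq.trans (sum_det_letterMatrix_augment hk (Nat.mod_two_eq_zero_or_one k) hR
    (fun (m : L) q => startSum L fromLeft a (T.β q) m) (fun q (c : Fin (r - k)) =>
      StripSystem.fullSum (primedIn L) (weightIn L a) (fun c : ℕ => fromLeft c)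
        (T.α ⟨r - 1 - c, by omega⟩) (T.β q))).symm ?_)
  · refine Finset.sum_congr (by congr) fun v _ => ?_
    congr 1
    ext p q
    rw [Matrix.of_apply, Matrix.of_apply]
    by_cases hp : (p : ℕ) < k
    · rw [dif_pos hp, dif_pos hp]
    · rw [dif_neg hp, dif_neg hp]
      congr 3
      simp only [Fin.ext_iff]
      omega
  · congr

theorem IsOutsideDecomposition.truncZeta_eq_pfaffian {D : Finset Box} (hθ : IsOutsideDecomposition D θ)
    (hS : IsSkewShiftedShape D) (hrule : IsApproachRule D θ fromLeft) {k : ℕ} (hk : k ≤ r)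
    (hdiag : ∀ p : Fin r, (∃ x ∈ θ p, content x = 0) ↔ (p : ℕ) < k)
    (hord : ∀ p q : Fin r, p < q → ∀ x ∈ θ p, ∀ y ∈ θ q,
      content x = 0 → content y = 0 → x.1 < y.1) (L : Finset MarkedNat) (a : ℤ → ℂ) :
    truncZeta L a D = pfaffian (skewBlock (hamelSize hk) (pairMatrix k θ fromLeft (truncZeta L a))
      (hashMatrix k θ fromLeft (truncZeta L a))) := by
  obtain ⟨T, hT, hD, hmem⟩ := hθ.exists_stripSystem hrule hS
  have hα : ∀ p : Fin r, T.α p = 0 ↔ (p : ℕ) < k := by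
    intro p
    rw [← hdiag]
    constructor
    · intro h
      refine ⟨slideBox fromLeft 0 (T.δ p), (hmem _ _).2 ⟨0, ⟨h.le, Nat.zero_le _⟩, rfl⟩, ?_⟩
      rw [content_slideBox]
      rfl
    · rintro ⟨x, hx, hx0⟩
      obtain ⟨c, hc, rfl⟩ := (hmem _ _).1 hx
      rw [content_slideBox] at hx0
      have := hc.1
      omega
  refine _root_.truncZeta_eq_pfaffian hT hD hS hmem hk hα (fun p q hpq hq => ?_) L a
  have hbox : ∀ p : Fin r, (p : ℕ) < k → (T.δ p, T.δ p) ∈ θ p := fun p hp =>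
    (hmem _ _).2 ⟨0, ⟨((hα p).2 hp).le, Nat.zero_le _⟩, (slideBox_zero _).symm⟩
  exact hord p q hpq _ (hbox p (lt_trans (show (p : ℕ) < q from hpq) hq)) _ (hbox q hq)
    (sub_self _) (sub_self _)

end FiniteIdentity

/-! ### Passage to the infinite alphabet -/

section Limit

open Filter Topology

open Classical in
/-- The tableaux with letters in a finite set. -/
noncomputable def tableauxIn (L : Finset MarkedNat) (S : Finset Box) : Finset (QSST S) :=
  (Fintype.piFinset fun _ : S => L).subtype (IsQTableau S)

theorem mem_tableauxIn {L : Finset MarkedNat} {S : Finset Box} {M : QSST S} :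
    M ∈ tableauxIn L S ↔ ∀ x, M.1 x ∈ L := by
  classical
  exact Finset.mem_subtype.trans Fintype.mem_piFinset

theorem tableauxIn_mono (S : Finset Box) : Monotone fun L => tableauxIn L S := fun _ _ h _ hM =>
  mem_tableauxIn.2 fun x => h (mem_tableauxIn.1 hM x)

theorem exists_mem_tableauxIn {S : Finset Box} (M : QSST S) : ∃ L, M ∈ tableauxIn L S := by
  classical
  exact ⟨Finset.univ.image M.1, mem_tableauxIn.2 fun x =>
    Finset.mem_image_of_mem _ (Finset.mem_univ x)⟩

/-- Every tableau uses finitely many letters, so growing alphabets exhaust all tableaux. Truncated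
series are thus partial sums along a cofinal net. -/
theorem tendsto_tableauxIn (S : Finset Box) :
    Tendsto (fun L => tableauxIn L S) atTop atTop :=
  tendsto_atTop_finset_of_monotone (tableauxIn_mono S) exists_mem_tableauxIn

theorem truncZeta_eq_sum_tableauxIn (L : Finset MarkedNat) (a : ℤ → ℂ) (S : Finset Box) :
    truncZeta L a S = ∑ M ∈ tableauxIn L S, zetaQTerm S (diagFilling a S) M := by
  classical
  have h1 : ∑ M ∈ tableauxIn L S, zetaQTerm S (diagFilling a S) M =
      ∑ t ∈ Fintype.piFinset (fun _ : S => L) with IsQTableau S t,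
        ∏ x : S, letterWeight a (content x.1) (t x) :=
    Finset.sum_subtype_eq_sum_filter (s := Fintype.piFinset (fun _ : S => L)) (p := IsQTableau S)
      (fun t => ∏ x : S, letterWeight a (content x.1) (t x))
  rw [h1, Finset.sum_filter, truncZeta]
  refine Finset.sum_bij (fun t _ x => (t x).1) (fun t _ => ?_) (fun t _ t' _ h => ?_)
    (fun t ht => ?_) (fun t _ => ?_)
  · exact Fintype.mem_piFinset.2 fun x => (t x).2
  · funext x
    exact Subtype.ext (congrFun h x)
  · exact ⟨fun x => ⟨t x, Fintype.mem_piFinset.1 ht x⟩, Finset.mem_univ _, rfl⟩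
  · congr

theorem tendsto_truncZeta {a : ℤ → ℂ} {S : Finset Box} (h : ConvergesQ S (diagFilling a S)) :
    Tendsto (fun L => truncZeta L a S) atTop (𝓝 (zetaQ S (diagFilling a S))) := by
  simp only [truncZeta_eq_sum_tableauxIn]
  have h1 := h.hasSum
  rw [HasSum, SummationFilter.unconditional_filter] at h1
  exact h1.comp (tendsto_tableauxIn S)

theorem tendsto_pfaffian {ι : Type*} {l : Filter ι} {n : ℕ}
    {A : ι → Matrix (Fin (2 * n)) (Fin (2 * n)) ℂ} {A' : Matrix (Fin (2 * n)) (Fin (2 * n)) ℂ}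
    (h : ∀ i j, Tendsto (fun L => A L i j) l (𝓝 (A' i j))) :
    Tendsto (fun L => pfaffian (A L)) l (𝓝 (pfaffian A')) :=
  tendsto_finsetSum _ fun _ _ => (tendsto_finsetProd _ fun _ _ => h _ _).const_mul _

theorem tendsto_skewBlock {ι : Type*} {l : Filter ι} {R d n : ℕ} (h : R + d = 2 * n)
    {A : ι → Matrix (Fin R) (Fin R) ℂ} {A' : Matrix (Fin R) (Fin R) ℂ}
    {B : ι → Matrix (Fin R) (Fin d) ℂ} {B' : Matrix (Fin R) (Fin d) ℂ}
    (hA : ∀ i j, Tendsto (fun L => A L i j) l (𝓝 (A' i j)))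
    (hB : ∀ i j, Tendsto (fun L => B L i j) l (𝓝 (B' i j))) (i j : Fin (2 * n)) :
    Tendsto (fun L => skewBlock h (A L) (B L) i j) l (𝓝 (skewBlock h A' B' i j)) := by
  obtain ⟨i, rfl⟩ := (finSumFinEquiv.trans (finCongr h)).surjective i
  obtain ⟨j, rfl⟩ := (finSumFinEquiv.trans (finCongr h)).surjective j
  simp only [skewBlock, Matrix.reindex_apply, Matrix.submatrix_apply, Equiv.symm_apply_apply]
  rcases i with i | i <;> rcases j with j | j
  · exact hA i j
  · exact hB i j
  · exact (hB j i).neg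
  · exact tendsto_const_nhds

theorem tendsto_pfaffian_hamelMatrix {r k : ℕ} (hk : k ≤ r) {θ : Fin r → Finset Box}
    {fromLeft : ℤ → Bool} {a : ℤ → ℂ} (hconv : EntriesConverge k θ fromLeft a) :
    Tendsto (fun L => pfaffian (skewBlock (hamelSize hk) (pairMatrix k θ fromLeft (truncZeta L a))
        (hashMatrix k θ fromLeft (truncZeta L a)))) atTop
      (𝓝 (pfaffian (hamelMatrix hk θ fromLeft a))) := by
  rw [hamelMatrix_eq_skewBlock]
  refine tendsto_pfaffian (tendsto_skewBlock _ (fun p q => ?_) fun i c => ?_)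
  · have key : ∀ p q : Fin (r + k % 2), p < q → Tendsto (fun L => pairEntry (truncZeta L a)
        (extendStrip fromLeft (augment k θ p)) (extendStrip fromLeft (augment k θ q))) atTop
        (𝓝 (pairEntry (fun S => zetaQ S (diagFilling a S)) (extendStrip fromLeft (augment k θ p))
          (extendStrip fromLeft (augment k θ q)))) := by
      intro p q hpq
      have h := tendsto_truncZeta (hconv.1 p q hpq)
      unfold pairEntry
      split_ifs
      · exact h
      · exact h.neg
    simp only [pairMatrix, Matrix.of_apply]
    split_ifs with h1 h2
    · exact key p q h1
    · exact (key q p h2).neg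
    · exact tendsto_const_nhds
  · simp only [hashMatrix, hashEntry, Matrix.of_apply]
    cases h : stripHash fromLeft (augment k θ i) (columnStrip k θ c) with
    | none => exact tendsto_const_nhds
    | some R => exact tendsto_truncZeta (hconv.2 i c R h)

end Limit

/-! ### Absolute convergence from real exponents -/

section AbsoluteConvergence

/-- Taking real parts of the exponents replaces the terms of the series by their absolute values. -/
theorem zetaQTerm_re (a : ℤ → ℂ) (S : Finset Box) (M : QSST S) :
    zetaQTerm S (diagFilling (fun c => ((a c).re : ℂ)) S) M =
      (‖zetaQTerm S (diagFilling a S) M‖ : ℝ) := by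
  simp only [zetaQTerm, diagFilling, norm_prod, Complex.ofReal_prod]
  refine Finset.prod_congr rfl fun x _ => ?_
  rw [norm_div, norm_one, Complex.norm_natCast_cpow_of_pos (M.1 x).abs.pos, Complex.ofReal_div,
    Complex.ofReal_one, Complex.ofReal_cpow (Nat.cast_nonneg _), Complex.ofReal_natCast]

theorem ConvergesQ.re {a : ℤ → ℂ} {S : Finset Box} (h : ConvergesQ S (diagFilling a S)) :
    ConvergesQ S (diagFilling (fun c => ((a c).re : ℂ)) S) := by
  have : zetaQTerm S (diagFilling (fun c => ((a c).re : ℂ)) S) =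
      fun M => ((‖zetaQTerm S (diagFilling a S) M‖ : ℝ) : ℂ) := funext (zetaQTerm_re a S)
  rw [ConvergesQ, this]
  exact Complex.summable_ofReal.2 h.norm

theorem EntriesConverge.re {r k : ℕ} {θ : Fin r → Finset Box} {fromLeft : ℤ → Bool} {a : ℤ → ℂ}
    (h : EntriesConverge k θ fromLeft a) :
    EntriesConverge k θ fromLeft fun c => ((a c).re : ℂ) :=
  ⟨fun p q hpq => (h.1 p q hpq).re, fun i c R hR => (h.2 i c R hR).re⟩

-- The truncations with real exponents are increasing sums of absolute values. A limit bounds them,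
-- and every finite set of tableaux is contained in one of them.
open Filter Topology in
theorem convergesQ_of_tendsto {a : ℤ → ℂ} {S : Finset Box} {z : ℂ}
    (h : Tendsto (fun L => truncZeta L (fun c => ((a c).re : ℂ)) S) atTop (𝓝 z)) :
    ConvergesQ S (diagFilling a S) := by
  have h1 : Tendsto (fun L => ∑ M ∈ tableauxIn L S, ‖zetaQTerm S (diagFilling a S) M‖) atTop
      (𝓝 z.re) := by
    refine ((Complex.continuous_re.tendsto z).comp h).congr fun L => ?_
    rw [Function.comp_apply, truncZeta_eq_sum_tableauxIn, Complex.re_sum]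
    refine Finset.sum_congr rfl fun M _ => ?_
    rw [zetaQTerm_re, Complex.ofReal_re]
  have hmono : Monotone fun L => ∑ M ∈ tableauxIn L S, ‖zetaQTerm S (diagFilling a S) M‖ :=
    fun L L' hL => Finset.sum_le_sum_of_subset_of_nonneg (tableauxIn_mono S hL)
      fun _ _ _ => norm_nonneg _
  refine Summable.of_norm (summable_of_sum_le (c := z.re) (fun _ => norm_nonneg _) fun u => ?_)
  obtain ⟨L, hL⟩ := ((tendsto_tableauxIn S).eventually (eventually_ge_atTop u)).exists
  exact (Finset.sum_le_sum_of_subset_of_nonneg hL fun _ _ _ => norm_nonneg _).trans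
    (hmono.ge_of_tendsto h1 L)

end AbsoluteConvergence

theorem mainTheorem3 (lam mu : StrictPartition) (hle : shiftedDiagram mu ⊆ shiftedDiagram lam)
    {r k : ℕ} (hk : k ≤ r) (θ : Fin r → Finset Box)
    (hθ : IsOutsideDecomposition (skewShiftedDiagram lam mu) θ)
    (hdiag : ∀ p : Fin r, (∃ x ∈ θ p, content x = 0) ↔ (p : ℕ) < k)
    (hord : ∀ p q : Fin r, p < q → ∀ x ∈ θ p, ∀ y ∈ θ q,
      content x = 0 → content y = 0 → x.1 < y.1)
    (fromLeft : ℤ → Bool) (hrule : IsApproachRule (skewShiftedDiagram lam mu) θ fromLeft)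
    (s : skewShiftedDiagram lam mu → ℂ) (a : ℤ → ℂ) (hs : ∀ x, s x = a (content x.1))
    (hconv : EntriesConverge k θ fromLeft a) :
    ConvergesQ (skewShiftedDiagram lam mu) s ∧
      zetaQ (skewShiftedDiagram lam mu) s = pfaffian (hamelMatrix hk θ fromLeft a) := by
  have hlim : ∀ a : ℤ → ℂ, EntriesConverge k θ fromLeft a → Filter.Tendsto
      (fun L => truncZeta L a (skewShiftedDiagram lam mu)) Filter.atTop
      (nhds (pfaffian (hamelMatrix hk θ fromLeft a))) := fun a h =>
    (tendsto_pfaffian_hamelMatrix hk h).congr fun L => (hθ.truncZeta_eq_pfaffian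
      (isSkewShiftedShape_skewShiftedDiagram lam mu) hrule hk hdiag hord L a).symm
  have hs' : s = diagFilling a (skewShiftedDiagram lam mu) := funext hs
  subst hs'
  -- The finite identity is used with the real parts of the exponents, for which the entries still
  -- converge, before it is used with the exponents themselves.
  have h := convergesQ_of_tendsto (hlim _ hconv.re)
  exact ⟨h, tendsto_nhds_unique (tendsto_truncZeta h) (hlim a hconv)⟩
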